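/- Let $\Omega\subset\mathbb R^3$ be a bounded open set, $T>0$, and let $W_{\mathrm{reg}},W_{\mathrm{sing}},V_{\mathrm{con}}:\Omega\to\mathbb R$ satisfy $\langle x\rangle^{-2}W_{\mathrm{reg}},\ \langle x\rangle^{-2}V_{\mathrm{con}}\in L^\infty(\Omega)$, with $\langle x\rangle^2=1+|x|^2$, and $W_{\mathrm{sing}}\in L^2(\Omega)$. Put $V=W_{\mathrm{reg}}+W_{\mathrm{sing}}$ and let $u:(0,T)\to\mathbb R$ be piecewise $W^{1,1}$. Let $H^2_2(\Omega)$ be the weighted Sobolev space with norm $\|\varphi\|_{H^2_2}^2=\|\varphi\|_{H^2(\Omega)}^2+\||x|^2\varphi\|_{L^2(\Omega)}^2$. For a real kernel $k$ on the difference set $\Omega-\Omega=\{x-y:\ x,y\in\Omega\}$ and an initial state $\varphi_0\in H^2_2(\Omega)\cap H^1_0(\Omega)$, a solution of the Dirichlet problem with kernel $k$ is a $\psi\in C([0,T];L^2(\Omega))\cap W^{1,1}(0,T;L^2(\Omega))\cap L^\infty(0,T;H^2_2(\Omega)\cap H^1_0(\Omega))$ with $\psi(0)=\varphi_0$ and,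 in $L^2(\Omega)$ for almost every $t\in(0,T)$, $$i\partial_t\psi=(-\Delta+V+u(t)V_{\mathrm{con}})\psi+\Big(\int_\Omega k(\cdot-y)|\psi(y,t)|^2\,dy\Big)\psi .$$ **(a)** For every $M\ge 0$ there is a constant $C$, depending only on $T$, $M$, $\Omega$, $V$, $V_{\mathrm{con}}$ and $u$, such that the following holds for every $\varphi_0\in H^2_2(\Omega)\cap H^1_0(\Omega)$ with $\|\varphi_0\|_{H^2_2}\le M$ and every real $f\in C^\infty(\Omega-\Omega)\cap L^2(\Omega-\Omega)$. If $\psi$ is a solution with kernel $1/|x|$ (the Hartree equation) and $\widetilde\psi$ is a solution with kernel $f$, both with initial state $\varphi_0$, then $\xi=\widetilde\psi-\psi$ satisfies $$i\partial_t\xi=(-\Delta+V+u(t)V_{\mathrm{con}})\xi+\Big(\int_\Omega f(\cdot-y)|\widetilde\psi(y,t)|^2dy\Big)\widetilde\psi-\Big(\int_\Omega\frac{|\psi(y,t)|^2}{|\cdot-y|}dy\Big)\psi$$ in $L^2(\Omega)$ for almost every $t\in(0,T)$, and $$\|\xi\|^2_{L^\infty(0,T;L^2(\Omega))}\le C\,\Big\|f-\frac1{|\cdot|}\Big\|_{L^1(\Omega-\Omega)}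 .$$ **(b)** For $\varepsilon>0$ the function $f_\varepsilon(x)=(|x|^2+\varepsilon^2)^{-1/2}$ is smooth on $\mathbb R^3$, and for every bounded set $D\subset\mathbb R^3$ there is a constant $C_D$ with $\|f_\varepsilon-1/|\cdot|\,\|_{L^1(D)}\le C_D\,\varepsilon$ for all $\varepsilon>0$. Consequently, for every $M\ge0$ there is a constant $C'$, depending only on $T$, $M$, $\Omega$, $V$, $V_{\mathrm{con}}$ and $u$, such that $\|\xi\|^2_{L^\infty(0,T;L^2(\Omega))}\le C'\varepsilon$ for all $\varepsilon>0$ and all $\varphi_0,\psi,\widetilde\psi$ as in (a) with $f=f_\varepsilon$. -/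

import Mathlib

open MeasureTheory Set Filter Topology
open scoped ENNReal NNReal ContDiff Pointwise

noncomputable section

namespace Hartree

/-- Three-dimensional Euclidean space. -/
abbrev E3 : Type := EuclideanSpace ℝ (Fin 3)

/-- Lebesgue measure on `Ω`. -/
abbrev vol (Ω : Set E3) : Measure E3 := (volume : Measure E3).restrict Ω

/-- The complex Hilbert space `L²(Ω)`. -/
abbrev L2 (Ω : Set E3) : Type := Lp ℂ 2 (vol Ω)

/-- Classical partial derivative in the direction of the `i`-th coordinate. -/
def partialDeriv {F : Type*} [NormedAddCommGroup F] [NormedSpace ℝ F]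
    (i : Fin 3) (φ : E3 → F) (x : E3) : F :=
  fderiv ℝ φ x (EuclideanSpace.single i (1 : ℝ))

/-- `φ ∈ C_c^∞(Ω; F)`. -/
structure IsTestFunction {F : Type*} [NormedAddCommGroup F] [NormedSpace ℝ F]
    (Ω : Set E3) (φ : E3 → F) : Prop where
  contDiff : ContDiff ℝ ∞ φ
  hasCompactSupport : HasCompactSupport φ
  tsupport_subset : tsupport φ ⊆ Ω

/-- `g` is the weak derivative `∂ᵢ u` on `Ω`. It is only used for square-integrable `u`, `g`. -/
def HasWeakPartial (Ω : Set E3) (i : Fin 3) (u g : E3 → ℂ) : Prop :=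
  ∀ φ : E3 → ℝ, IsTestFunction Ω φ →
    ∫ x in Ω, partialDeriv i φ x • u x = - ∫ x in Ω, φ x • g x

/-- `u ∈ H²(Ω)`, with first weak derivatives `v i = ∂ᵢ u` and second weak derivatives
`w i j = ∂ⱼ ∂ᵢ u`, all of them in `L²(Ω)`. -/
structure IsH2Jet (Ω : Set E3) (u : E3 → ℂ) (v : Fin 3 → E3 → ℂ)
    (w : Fin 3 → Fin 3 → E3 → ℂ) : Prop where
  memLp_zero : MemLp u 2 (vol Ω)
  memLp_one : ∀ i, MemLp (v i) 2 (vol Ω)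
  memLp_two : ∀ i j, MemLp (w i j) 2 (vol Ω)
  weak_one : ∀ i, HasWeakPartial Ω i u (v i)
  weak_two : ∀ i j, HasWeakPartial Ω j (v i) (w i j)

/-- The norm of the weighted Sobolev space `H²₂(Ω)`,
`‖u‖² = ‖u‖²_{H²} + ‖ |x|² u ‖²_{L²}`, with value `∞` when `u` is not in that space.
The weak derivatives are unique up to null sets, so that the infimum runs over equal values,
or over the empty family when `u` is not in `H²(Ω)`. -/
def normH22 (Ω : Set E3) (u : E3 → ℂ) : ℝ≥0∞ :=
  ⨅ (v : Fin 3 → E3 → ℂ) (w : Fin 3 → Fin 3 → E3 → ℂ) (_ : IsH2Jet Ω u v w),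
    (eLpNorm u 2 (vol Ω) ^ 2 + ∑ i, eLpNorm (v i) 2 (vol Ω) ^ 2
      + ∑ i, ∑ j, eLpNorm (w i j) 2 (vol Ω) ^ 2
      + eLpNorm (fun x => ((‖x‖ ^ 2 : ℝ) : ℂ) * u x) 2 (vol Ω) ^ 2) ^ (1 / 2 : ℝ)

/-- `u ∈ H¹₀(Ω)`: `u` is a limit of test functions in the `H¹(Ω)` norm. The limits `v i` of the
derivatives are then the weak derivatives of `u`. -/
def MemH10 (Ω : Set E3) (u : E3 → ℂ) : Prop :=
  MemLp u 2 (vol Ω) ∧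
  ∃ v : Fin 3 → E3 → ℂ, (∀ i, MemLp (v i) 2 (vol Ω)) ∧
  ∃ φ : ℕ → E3 → ℂ, (∀ n, IsTestFunction Ω (φ n)) ∧
    Tendsto (fun n => eLpNorm (fun x => φ n x - u x) 2 (vol Ω)) atTop (𝓝 0) ∧
    ∀ i, Tendsto (fun n => eLpNorm (fun x => partialDeriv i (φ n) x - v i x) 2 (vol Ω))
      atTop (𝓝 0)

/-- `u ∈ H²(Ω)` and `g = Δ u` almost everywhere on `Ω`. -/
def HasLaplacian (Ω : Set E3) (u g : E3 → ℂ) : Prop :=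
  ∃ (v : Fin 3 → E3 → ℂ) (w : Fin 3 → Fin 3 → E3 → ℂ), IsH2Jet Ω u v w ∧
    ∀ᵐ x ∂(vol Ω), g x = ∑ i, w i i x

/-- The Coulomb kernel `1/|x|`. -/
def coulomb (x : E3) : ℝ := 1 / ‖x‖

/-- The regularised kernel `(|x|² + ε²)^{-1/2}`. -/
def softCoulomb (ε : ℝ) (x : E3) : ℝ := 1 / Real.sqrt (‖x‖ ^ 2 + ε ^ 2)

/-- The self-consistent potential `x ↦ ∫_Ω k(x - y) |u(y)|² dy`. -/
def hartreePotential (Ω : Set E3) (k : E3 → ℝ) (u : E3 → ℂ) (x : E3) : ℝ :=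
  ∫ y in Ω, k (x - y) * ‖u y‖ ^ 2

/-- Assumptions on the real potentials `W_reg`, `W_sing`, `V_con` on `Ω`:
`⟨x⟩⁻² W_reg` and `⟨x⟩⁻² V_con` are in `L^∞(Ω)` and `W_sing` is in `L²(Ω)`. -/
structure AdmissiblePotentials (Ω : Set E3) (Wreg Wsing Vcon : E3 → ℝ) : Prop where
  reg : MemLp (fun x => (1 + ‖x‖ ^ 2)⁻¹ * Wreg x) ∞ (vol Ω)
  sing : MemLp Wsing 2 (vol Ω)
  con : MemLp (fun x => (1 + ‖x‖ ^ 2)⁻¹ * Vcon x) ∞ (vol Ω)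

/-- `c` is piecewise `W^{1,1}` on `(0,T)`: away from a finite set `S` it is locally absolutely
continuous, with a derivative that is integrable on `(0,T)`. -/
def PiecewiseW11 (T : ℝ) (c : ℝ → ℝ) : Prop :=
  ∃ (S : Finset ℝ) (c' : ℝ → ℝ), IntegrableOn c' (Ioo 0 T) ∧
    ∀ s t : ℝ, 0 < s → s ≤ t → t < T → (∀ r ∈ S, r ∉ Icc s t) →
      c t - c s = ∫ r in s..t, c' r

/-- `ψ ∈ C([0,T]; L²(Ω)) ∩ W^{1,1}(0,T; L²(Ω))` with time derivative `ψ'`. -/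
def HasTimeDeriv {Ω : Set E3} (T : ℝ) (ψ ψ' : ℝ → L2 Ω) : Prop :=
  IntegrableOn ψ' (Ioo 0 T) ∧ ∀ t ∈ Icc 0 T, ψ t = ψ 0 + ∫ s in (0 : ℝ)..t, ψ' s

/-- `ψ ∈ L^∞(0,T; H²₂(Ω) ∩ H¹₀(Ω))` solves
`i ∂ₜ ψ = (-Δ + V + c(t) V_con) ψ + (∫_Ω k(· - y) |ψ(y)|² dy) ψ` on `Ω × (0,T)`
with Dirichlet boundary condition and `ψ(0) = φ₀`. The equation holds in `L²(Ω)` for almost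
every time. -/
structure IsSolution {Ω : Set E3} (T : ℝ) (V Vcon : E3 → ℝ) (c : ℝ → ℝ) (k : E3 → ℝ)
    (φ₀ : L2 Ω) (ψ : ℝ → L2 Ω) : Prop where
  initial : ψ 0 = φ₀
  bounded : ∃ B : ℝ≥0, ∀ᵐ t ∂(volume.restrict (Ioo 0 T)), normH22 Ω (ψ t) ≤ B
  dirichlet : ∀ᵐ t ∂(volume.restrict (Ioo 0 T)), MemH10 Ω (ψ t)
  equation : ∃ ψ' : ℝ → L2 Ω, HasTimeDeriv T ψ ψ' ∧
    ∀ᵐ t ∂(volume.restrict (Ioo 0 T)), ∃ lap : E3 → ℂ, HasLaplacian Ω (ψ t) lap ∧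
      ∀ᵐ x ∂(vol Ω), Complex.I * ψ' t x =
        -lap x + ((V x + c t * Vcon x : ℝ) : ℂ) * ψ t x
          + (hartreePotential Ω k (ψ t) x : ℂ) * ψ t x

/-- The equation of the difference `ξ` of the solution `χ` with kernel `f` and the solution `ψ`
with the Coulomb kernel:
`i ∂ₜ ξ = (-Δ + V + c(t) V_con) ξ + (∫_Ω f(· - y) |χ(y)|² dy) χ - (∫_Ω |ψ(y)|² / |· - y| dy) ψ`. -/
def DifferenceEquation {Ω : Set E3} (T : ℝ) (V Vcon : E3 → ℝ) (c : ℝ → ℝ) (f : E3 → ℝ)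
    (χ ψ ξ : ℝ → L2 Ω) : Prop :=
  ∃ ξ' : ℝ → L2 Ω, HasTimeDeriv T ξ ξ' ∧
    ∀ᵐ t ∂(volume.restrict (Ioo 0 T)), ∃ lap : E3 → ℂ, HasLaplacian Ω (ξ t) lap ∧
      ∀ᵐ x ∂(vol Ω), Complex.I * ξ' t x =
        -lap x + ((V x + c t * Vcon x : ℝ) : ℂ) * ξ t x
          + (hartreePotential Ω f (χ t) x : ℂ) * χ t x
          - (hartreePotential Ω coulomb (ψ t) x : ℂ) * ψ t x

/-- The norm of `L^∞(0,T; L²(Ω))`. -/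
def normLinftyL2 {Ω : Set E3} (T : ℝ) (ξ : ℝ → L2 Ω) : ℝ≥0∞ :=
  eLpNorm ξ ∞ (volume.restrict (Ioo 0 T))

/-- `‖f - 1/|·|‖_{L¹(D)}`. -/
def kernelDist (D : Set E3) (f : E3 → ℝ) : ℝ≥0∞ :=
  eLpNorm (fun x => f x - coulomb x) 1 (vol D)

end Hartree

end

/-! The difference ξ = χ − ψ is estimated by Grönwall's inequality. In Re⟨ξ, ξ'⟩ the Dirichlet
Laplacian drops out because it is symmetric, and the common real potential drops out because it is
real. What remains is the difference of the two self-consistent potentials acting on ψ. It splits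
into a Lipschitz part, bounded by a constant times ‖ξ‖², and a source containing f − 1/|x|. If ψ and
χ are bounded and |ξ| ≤ 1 pointwise, the source is at most a constant times the L¹ distance δ of the
kernels; this gives ‖ξ‖² ≤ Cδ. The whole difficulty is to obtain pointwise bounds whose constants
depend only on the data, since the definition of a solution provides H² bounds that may depend on
the solution.

Elliptic tool. For u in the domain of the Dirichlet Laplacian on an arbitrary bounded open set,
‖u‖_∞ ≤ ε‖Δu‖ + C_ε‖u‖ (`exists_ae_norm_le`). No regularity of the boundary is available, so this is
derived from Kato's inequality tested against e^{−λ|x−x₀|²}/√(|x−x₀|² + η²): as η → 0, Lebesgue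
differentiation recovers |u(x₀)|, and λ → ∞ makes the factor of ‖Δu‖ small.

From a potential bound to regularity (`Setting.exists_regularity`). Suppose the convolution of the
kernel with the density is bounded by Q. A solution is compared with its own translate in time. The
square integrable, time independent potential cancels, and the control enters only through the L¹
norm of its increments, which is O(h) because a piecewise W^{1,1} function has bounded variation. So
the solution is Lipschitz in time, the equation bounds ‖Δχ‖ after absorption of the singular
potential, and the elliptic estimate bounds χ pointwise.

The Coulomb solution (`Setting.exists_potBound_coulomb`). Here Q comes from the energy. With so
little regularity the energy is not differentiated. Instead, s ↦ Re⟨ψ(s+h), iψ(s)⟩ is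
differentiated: the Laplacians cancel, and the evenness of the kernel turns the self-interaction
into a difference of self-energies up to O(h²). Dividing by h and letting h → 0 gives an energy
inequality (`IsPrim.ae_re_inner_le`). The bounds that depend on the particular solution enter only
at order h² and disappear. Positivity of the kernel and the L⁴ estimate then bound the kinetic
energy, hence the potential, as 1/|x| is locally square integrable.

The solution with kernel f. This kernel need be neither even nor positive, so a continuation
argument replaces the energy (`Setting.exists_stability`). While |ξ| ≤ 1, χ is bounded, Q is
explicit, ‖ξ‖² ≤ C₀δ, and the elliptic estimate improves |ξ| ≤ 1 to |ξ| ≤ 1/2 once δ is below a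
threshold depending on the data. For larger δ, conservation of mass already gives the claim. Part
(b) follows from |f_ε − 1/|x|| ≤ ε|x|⁻². -/

noncomputable section

/-! ### Absolutely continuous curves in Hilbert space and Grönwall's inequality. -/

namespace Hartree

/-- `w` is absolutely continuous on `[a, b]` with derivative `w'`. -/
structure IsPrim {E : Type*} [NormedAddCommGroup E] [NormedSpace ℝ E]
    (a b : ℝ) (w w' : ℝ → E) : Prop where
  le : a ≤ b
  integrable : IntervalIntegrable w' volume a b
  eq : ∀ t ∈ Icc a b, w t = w a + ∫ s in a..t, w' s

namespace IsPrim

section Basic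

variable {E : Type*} [NormedAddCommGroup E] [NormedSpace ℝ E] {a b : ℝ} {w w' v v' : ℝ → E}

theorem intervalIntegrable_of_mem (h : IsPrim a b w w') {s t : ℝ} (hs : s ∈ Icc a b)
    (ht : t ∈ Icc a b) : IntervalIntegrable w' volume s t :=
  h.integrable.mono_set (uIcc_subset_uIcc (by rwa [uIcc_of_le h.le]) (by rwa [uIcc_of_le h.le]))

theorem sub_eq (h : IsPrim a b w w') {s t : ℝ} (hs : s ∈ Icc a b) (ht : t ∈ Icc a b) :
    w t - w s = ∫ r in s..t, w' r := by
  have ha : a ∈ Icc a b := left_mem_Icc.2 h.le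
  rw [h.eq t ht, h.eq s hs, add_sub_add_left_eq_sub,
    intervalIntegral.integral_interval_sub_left (h.intervalIntegrable_of_mem ha ht)
      (h.intervalIntegrable_of_mem ha hs)]

theorem mono (h : IsPrim a b w w') {c d : ℝ} (hc : a ≤ c) (hcd : c ≤ d) (hd : d ≤ b) :
    IsPrim c d w w' where
  le := hcd
  integrable := h.intervalIntegrable_of_mem ⟨hc, hcd.trans hd⟩ ⟨hc.trans hcd, hd⟩
  eq t ht := by
    rw [← h.sub_eq (s := c) ⟨hc, hcd.trans hd⟩ ⟨hc.trans ht.1, ht.2.trans hd⟩]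
    abel

theorem shift (h : IsPrim a b w w') (c : ℝ) :
    IsPrim (a - c) (b - c) (fun t => w (t + c)) (fun t => w' (t + c)) where
  le := by linarith [h.le]
  integrable := by
    have := h.integrable.comp_add_right c
    simpa using this
  eq t ht := by
    have hs : (t + c) ∈ Icc a b := ⟨by linarith [ht.1], by linarith [ht.2]⟩
    rw [intervalIntegral.integral_comp_add_right (fun t => w' t) c]
    simpa using h.eq _ hs

theorem sub (h : IsPrim a b w w') (k : IsPrim a b v v') :
    IsPrim a b (fun t => w t - v t) (fun t => w' t - v' t) where
  le := h.le
  integrable := h.integrable.sub k.integrable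
  eq t ht := by
    have ha : a ∈ Icc a b := left_mem_Icc.2 h.le
    rw [intervalIntegral.integral_sub (h.intervalIntegrable_of_mem ha ht)
      (k.intervalIntegrable_of_mem ha ht), h.eq t ht, k.eq t ht]
    abel

theorem const (hab : a ≤ b) (x : E) : IsPrim a b (fun _ => x) (fun _ => 0) where
  le := hab
  integrable := by simp
  eq t _ := by simp

theorem norm_sub_le (h : IsPrim a b w w') {s t : ℝ} (hs : s ∈ Icc a b) (ht : t ∈ Icc a b) :
    ‖w t - w s‖ ≤ |(∫ r in a..t, ‖w' r‖) - ∫ r in a..s, ‖w' r‖| := by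
  have ha : a ∈ Icc a b := left_mem_Icc.2 h.le
  rw [h.sub_eq hs ht, intervalIntegral.integral_interval_sub_left
    (h.intervalIntegrable_of_mem ha ht).norm (h.intervalIntegrable_of_mem ha hs).norm]
  exact intervalIntegral.norm_integral_le_abs_integral_norm

theorem continuousOn (h : IsPrim a b w w') : ContinuousOn w (Icc a b) := by
  have : ContinuousOn (fun t => w a + ∫ s in a..t, w' s) (Icc a b) :=
    continuousOn_const.add (by
      have := intervalIntegral.continuousOn_primitive_interval (f := w') (μ := volume) (a := a)
        (b := b) (by
          rw [uIcc_of_le h.le, integrableOn_Icc_iff_integrableOn_Ioc]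
          exact (intervalIntegrable_iff_integrableOn_Ioc_of_le h.le).1 h.integrable)
      rwa [uIcc_of_le h.le] at this)
  exact this.congr h.eq

theorem ae_hasDerivAt [CompleteSpace E] (h : IsPrim a b w w') :
    ∀ᵐ t ∂(volume.restrict (Ioo a b)), HasDerivAt w (w' t) t := by
  rw [ae_restrict_iff' measurableSet_Ioo]
  filter_upwards [h.integrable.ae_hasDerivAt_integral] with t ht hmem
  have h1 := ht (by rw [uIcc_of_le h.le]; exact Ioo_subset_Icc_self hmem) a (by simp)
  refine (h1.const_add (w a)).congr_of_eventuallyEq ?_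
  filter_upwards [Icc_mem_nhds hmem.1 hmem.2] with s hs using h.eq s hs

end Basic

/-- The sums in the definition of absolute continuity are dominated term by term. This transfers the
property from a scalar primitive to the pairing of two curves. -/
theorem absolutelyContinuous_of_dist_le {X : Type*} [PseudoMetricSpace X] {a b : ℝ} {f : ℝ → X}
    {Φ : ℝ → ℝ}
    (hΦ : AbsolutelyContinuousOnInterval Φ a b)
    (h : ∀ s ∈ uIcc a b, ∀ t ∈ uIcc a b, dist (f s) (f t) ≤ dist (Φ s) (Φ t)) :
    AbsolutelyContinuousOnInterval f a b := by
  rw [absolutelyContinuousOnInterval_iff] at hΦ ⊢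
  intro ε hε
  obtain ⟨δ, hδ, H⟩ := hΦ ε hε
  refine ⟨δ, hδ, fun E hE hlen => lt_of_le_of_lt (Finset.sum_le_sum fun i hi => ?_) (H E hE hlen)⟩
  have := hE.1 i hi
  exact h _ this.1 _ this.2

section Inner

variable {E : Type*} [NormedAddCommGroup E] [InnerProductSpace ℂ E] [NormedSpace ℝ E]
  {a b : ℝ} {w w' v v' : ℝ → E}

theorem intervalIntegrable_re_inner_left (h : IsPrim a b w w') (k : IsPrim a b v v') :
    IntervalIntegrable (fun t => (inner ℂ (w' t) (v t)).re) volume a b := by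
  obtain ⟨C, hC⟩ := isCompact_Icc.exists_bound_of_continuousOn k.continuousOn
  have hint := (intervalIntegrable_iff_integrableOn_Ioc_of_le h.le).1 h.integrable
  rw [intervalIntegrable_iff_integrableOn_Ioc_of_le h.le]
  have hv : AEStronglyMeasurable v (volume.restrict (Ioc a b)) :=
    (k.continuousOn.mono Ioc_subset_Icc_self).aestronglyMeasurable measurableSet_Ioc
  refine Integrable.mono' (hint.norm.mul_const C)
    (Complex.continuous_re.comp_aestronglyMeasurable (hint.aestronglyMeasurable.inner hv)) ?_
  filter_upwards [ae_restrict_mem measurableSet_Ioc] with t ht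
  rw [Real.norm_eq_abs]
  calc |(inner ℂ (w' t) (v t)).re| ≤ ‖inner ℂ (w' t) (v t)‖ := Complex.abs_re_le_norm _
    _ ≤ ‖w' t‖ * ‖v t‖ := norm_inner_le_norm _ _
    _ ≤ ‖w' t‖ * C := by gcongr; exact hC t (Ioc_subset_Icc_self ht)

theorem intervalIntegrable_re_inner_right (h : IsPrim a b w w') (k : IsPrim a b v v') :
    IntervalIntegrable (fun t => (inner ℂ (w t) (v' t)).re) volume a b := by
  refine (k.intervalIntegrable_re_inner_left h).congr fun t _ => ?_
  rw [← inner_conj_symm, Complex.conj_re]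

/-- Product rule in integrated form. Splitting the increment of the pairing bounds it by the
increment of a weighted sum of the primitives of ‖w'‖ and ‖v'‖, so the pairing is absolutely
continuous and equals the integral of its almost everywhere derivative. -/
theorem re_inner_sub_eq [CompleteSpace E] (h : IsPrim a b w w') (k : IsPrim a b v v') :
    (inner ℂ (w b) (v b)).re - (inner ℂ (w a) (v a)).re =
      ∫ t in a..b, ((inner ℂ (w' t) (v t)).re + (inner ℂ (w t) (v' t)).re) := by
  have hab := h.le
  obtain ⟨Cv, hCv⟩ := isCompact_Icc.exists_bound_of_continuousOn k.continuousOn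
  obtain ⟨Cw, hCw⟩ := isCompact_Icc.exists_bound_of_continuousOn h.continuousOn
  set Cv' := max Cv 0
  set Cw' := max Cw 0
  set Φ : ℝ → ℝ := fun t => Cv' * (∫ r in a..t, ‖w' r‖) + Cw' * ∫ r in a..t, ‖v' r‖
  have hΦ : AbsolutelyContinuousOnInterval Φ a b :=
    ((h.integrable.norm.absolutelyContinuousOnInterval_intervalIntegral (by simp)).const_mul _).add
      ((k.integrable.norm.absolutelyContinuousOnInterval_intervalIntegral (by simp)).const_mul _)
  have hmono : ∀ u : ℝ → E, IntervalIntegrable u volume a b → ∀ s ∈ Icc a b, ∀ t ∈ Icc a b,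
      s ≤ t → (∫ r in a..s, ‖u r‖) ≤ ∫ r in a..t, ‖u r‖ := by
    intro u hu s hs t ht hst
    refine intervalIntegral.integral_mono_interval le_rfl hs.1 hst (ae_of_all _ fun _ => norm_nonneg _) ?_
    exact (hu.mono_set (by
      rw [uIcc_of_le ht.1, uIcc_of_le hab]; exact Icc_subset_Icc le_rfl ht.2)).norm
  have hac : AbsolutelyContinuousOnInterval (fun t => (inner ℂ (w t) (v t)).re) a b := by
    refine absolutelyContinuous_of_dist_le hΦ ?_
    rw [uIcc_of_le hab]
    have key : ∀ s ∈ Icc a b, ∀ t ∈ Icc a b, s ≤ t →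
        dist (inner ℂ (w s) (v s)).re (inner ℂ (w t) (v t)).re ≤ dist (Φ s) (Φ t) := by
      intro s hs t ht hst
      have h1 := h.norm_sub_le hs ht
      have h2 := k.norm_sub_le hs ht
      have m1 := hmono w' h.integrable s hs t ht hst
      have m2 := hmono v' k.integrable s hs t ht hst
      rw [abs_of_nonneg (sub_nonneg.2 m1)] at h1
      rw [abs_of_nonneg (sub_nonneg.2 m2)] at h2
      have e : inner ℂ (w t) (v t) - inner ℂ (w s) (v s)
          = inner ℂ (w t - w s) (v t) + inner ℂ (w s) (v t - v s) := by
        rw [inner_sub_left, inner_sub_right]; ring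
      rw [dist_comm, Real.dist_eq, ← Complex.sub_re, e, dist_comm, Real.dist_eq]
      refine (Complex.abs_re_le_norm _).trans ((norm_add_le _ _).trans ?_)
      refine le_trans (add_le_add (norm_inner_le_norm _ _) (norm_inner_le_norm _ _)) ?_
      have b1 : ‖v t‖ ≤ Cv' := (hCv t ht).trans (le_max_left _ _)
      have b2 : ‖w s‖ ≤ Cw' := (hCw s hs).trans (le_max_left _ _)
      have c1 : 0 ≤ Cv' := le_max_right _ _
      have c2 : 0 ≤ Cw' := le_max_right _ _
      refine le_trans ?_ (le_abs_self _)
      simp only [Φ]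
      have := mul_le_mul h1 b1 (norm_nonneg _) (sub_nonneg.2 m1)
      have := mul_le_mul b2 h2 (norm_nonneg _) c2
      nlinarith
    intro s hs t ht
    rcases le_total s t with hst | hst
    · exact key s hs t ht hst
    · rw [dist_comm, dist_comm (Φ s)]; exact key t ht s hs hst
  rw [← hac.integral_deriv_eq_sub]
  refine intervalIntegral.integral_congr_ae ?_
  have hd1 := h.ae_hasDerivAt
  have hd2 := k.ae_hasDerivAt
  rw [restrict_Ioo_eq_restrict_Ioc, ae_restrict_iff' measurableSet_Ioc] at hd1 hd2
  filter_upwards [hd1, hd2] with t h1 h2 hmem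
  rw [uIoc_of_le hab] at hmem
  have := Complex.reCLM.hasFDerivAt.comp_hasDerivAt t ((h1 hmem).inner ℂ (h2 hmem))
  have e := this.deriv
  rw [show (fun t => (inner ℂ (w t) (v t)).re) = Complex.reCLM ∘ fun t => inner ℂ (w t) (v t) from rfl, e]
  simp [add_comm]

theorem norm_sq_sub_eq [CompleteSpace E] (h : IsPrim a b w w') :
    ‖w b‖ ^ 2 - ‖w a‖ ^ 2 = ∫ t in a..b, 2 * (inner ℂ (w t) (w' t)).re := by
  have := h.re_inner_sub_eq h
  have e : ∀ x : E, (inner ℂ x x).re = ‖x‖ ^ 2 := fun x => inner_self_eq_norm_sq (𝕜 := ℂ) x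
  rw [e, e] at this
  rw [this]
  refine intervalIntegral.integral_congr fun t _ => ?_
  rw [← inner_conj_symm, Complex.conj_re]
  ring

/-- Grönwall's inequality for the norm of an absolutely continuous function. -/
theorem norm_sq_le_gronwall [CompleteSpace E] (h : IsPrim a b w w') {r : ℝ → ℝ} {Λ : ℝ} (hΛ : 0 ≤ Λ)
    (hr : IntervalIntegrable r volume a b) (hr0 : ∀ t, 0 ≤ r t)
    (hle : ∀ᵐ t ∂(volume.restrict (Ioo a b)),
      (inner ℂ (w t) (w' t)).re ≤ r t + Λ * ‖w t‖ ^ 2) {t : ℝ} (ht : t ∈ Icc a b) :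
    ‖w t‖ ^ 2 ≤ Real.exp (2 * Λ * (b - a)) * (‖w a‖ ^ 2 + 2 * ∫ s in a..b, r s) := by
  have hab := h.le
  set K := ‖w a‖ ^ 2 + 2 * ∫ s in a..b, r s with hK
  have hK0 : 0 ≤ K := by
    have : 0 ≤ ∫ s in a..b, r s := intervalIntegral.integral_nonneg hab fun t _ => hr0 t
    positivity
  have hNc : ContinuousOn (fun t => ‖w t‖ ^ 2) (Icc a b) := h.continuousOn.norm.pow 2
  have hNi : ∀ t ∈ Icc a b, IntervalIntegrable (fun t => ‖w t‖ ^ 2) volume a t := fun t ht =>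
    (hNc.mono (Icc_subset_Icc le_rfl ht.2)).intervalIntegrable_of_Icc ht.1
  have hsub : ∀ t ∈ Icc a b, uIcc a t ⊆ uIcc a b := fun t ht => by
    rw [uIcc_of_le hab, uIcc_of_le ht.1]; exact Icc_subset_Icc le_rfl ht.2
  have key : ∀ t ∈ Icc a b, ‖w t‖ ^ 2 ≤ K + 2 * Λ * ∫ s in a..t, ‖w s‖ ^ 2 := by
    intro t ht
    have h1 := (h.mono le_rfl ht.1 ht.2).norm_sq_sub_eq
    have h2 : ∫ s in a..t, 2 * (inner ℂ (w s) (w' s)).re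
        ≤ ∫ s in a..t, (2 * r s + 2 * Λ * ‖w s‖ ^ 2) := by
      refine intervalIntegral.integral_mono_ae_restrict ht.1 ?_ ?_ ?_
      · exact ((h.mono le_rfl ht.1 ht.2).intervalIntegrable_re_inner_right
          (h.mono le_rfl ht.1 ht.2)).const_mul 2
      · exact ((hr.mono_set (hsub t ht)).const_mul 2).add ((hNi t ht).const_mul _)
      · rw [← restrict_Ioo_eq_restrict_Icc]
        have := ae_restrict_of_ae_restrict_of_subset (Ioo_subset_Ioo le_rfl ht.2) hle
        filter_upwards [this] with s hs
        nlinarith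
    rw [← h1, intervalIntegral.integral_add ((hr.mono_set (hsub t ht)).const_mul 2)
      ((hNi t ht).const_mul _), intervalIntegral.integral_const_mul,
      intervalIntegral.integral_const_mul] at h2
    have h3 : ∫ s in a..t, r s ≤ ∫ s in a..b, r s :=
      intervalIntegral.integral_mono_interval le_rfl ht.1 ht.2 (ae_of_all _ hr0) hr
    linarith
  set y : ℝ → ℝ := fun t => ∫ s in a..t, ‖w s‖ ^ 2
  have hyc : ContinuousOn y (Icc a b) := by
    have := intervalIntegral.continuousOn_primitive_interval (f := fun t => ‖w t‖ ^ 2)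
      (μ := volume) (a := a) (b := b) (by
        rw [uIcc_of_le hab]; exact hNc.integrableOn_Icc)
    rwa [uIcc_of_le hab] at this
  have hyd : ∀ t ∈ Ioo a b, HasDerivAt y (‖w t‖ ^ 2) t := by
    intro t ht
    refine intervalIntegral.integral_hasDerivAt_right (hNi t (Ioo_subset_Icc_self ht)) ?_
      (hNc.continuousAt (Icc_mem_nhds ht.1 ht.2))
    exact hNc.stronglyMeasurableAtFilter_nhdsWithin measurableSet_Icc t |>.filter_mono
      (le_of_eq (nhdsWithin_eq_nhds.2 (Icc_mem_nhds ht.1 ht.2)).symm)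
  -- Working with y, the integral of the continuous function ‖w‖², makes Z classically
  -- differentiable, although ‖w‖² itself is only absolutely continuous.
  set Z : ℝ → ℝ := fun t => Real.exp (-(2 * Λ * (t - a))) * (K + 2 * Λ * y t)
  have hZ : AntitoneOn Z (Icc a b) := by
    have hd : ∀ t ∈ Ioo a b, HasDerivAt Z
        (Real.exp (-(2 * Λ * (t - a))) * (-(2 * Λ * 1)) * (K + 2 * Λ * y t)
          + Real.exp (-(2 * Λ * (t - a))) * (2 * Λ * ‖w t‖ ^ 2)) t := by
      intro t ht
      have e1 : HasDerivAt (fun t => Real.exp (-(2 * Λ * (t - a))))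
          (Real.exp (-(2 * Λ * (t - a))) * (-(2 * Λ * 1))) t :=
        ((((hasDerivAt_id t).sub_const a).const_mul (2 * Λ)).neg).exp
      exact e1.mul (((hyd t ht).const_mul (2 * Λ)).const_add K)
    refine antitoneOn_of_deriv_nonpos (convex_Icc a b) ?_ ?_ ?_
    · exact ContinuousOn.mul (by fun_prop) (by fun_prop)
    · rw [interior_Icc]; exact fun t ht => (hd t ht).differentiableAt.differentiableWithinAt
    · rw [interior_Icc]; intro t ht
      rw [(hd t ht).deriv]
      have := key t (Ioo_subset_Icc_self ht)
      have e := (Real.exp_pos (-(2 * Λ * (t - a)))).le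
      have : Real.exp (-(2 * Λ * (t - a))) * (2 * Λ) * (‖w t‖ ^ 2 - (K + 2 * Λ * y t)) ≤ 0 :=
        mul_nonpos_of_nonneg_of_nonpos (by positivity) (by simp only [y]; linarith)
      linarith
  have hZt := hZ (left_mem_Icc.2 hab) ht ht.1
  simp only [Z, y, sub_self, mul_zero, neg_zero, Real.exp_zero, one_mul,
    intervalIntegral.integral_same, add_zero] at hZt
  have h4 : K + 2 * Λ * (∫ s in a..t, ‖w s‖ ^ 2) ≤ Real.exp (2 * Λ * (t - a)) * K := by
    rw [Real.exp_neg, inv_mul_le_iff₀ (Real.exp_pos _)] at hZt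
    exact hZt
  refine (key t ht).trans (h4.trans ?_)
  gcongr
  exact ht.2

/-- The forcing ℓ‖w‖ is linear in the norm. It is replaced by ℓm with m the maximum of the norm; the
quadratic inequality at a maximum point is then divided by m. -/
theorem norm_le_gronwall [CompleteSpace E] (h : IsPrim a b w w') {ℓ : ℝ → ℝ} {Λ : ℝ} (hΛ : 0 ≤ Λ)
    (hr : IntervalIntegrable ℓ volume a b) (hr0 : ∀ t, 0 ≤ ℓ t)
    (hle : ∀ᵐ t ∂(volume.restrict (Ioo a b)),
      (inner ℂ (w t) (w' t)).re ≤ ℓ t * ‖w t‖ + Λ * ‖w t‖ ^ 2) {t : ℝ} (ht : t ∈ Icc a b) :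
    ‖w t‖ ≤ Real.exp (2 * Λ * (b - a)) * (‖w a‖ + 2 * ∫ s in a..b, ℓ s) := by
  have hab := h.le
  obtain ⟨t₀, ht₀, hmax⟩ := isCompact_Icc.exists_isMaxOn (nonempty_Icc.2 hab)
    h.continuousOn.norm
  set m := ‖w t₀‖
  have hm : ∀ s ∈ Icc a b, ‖w s‖ ≤ m := fun s hs => hmax hs
  refine (hm t ht).trans ?_
  have key := h.norm_sq_le_gronwall hΛ (r := fun t => ℓ t * m) (hr.mul_const m)
    (fun t => mul_nonneg (hr0 t) (norm_nonneg _)) (by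
      filter_upwards [hle, ae_restrict_mem measurableSet_Ioo] with s hs hmem
      have := mul_le_mul_of_nonneg_left (hm s (Ioo_subset_Icc_self hmem)) (hr0 s)
      linarith) ht₀
  rw [intervalIntegral.integral_mul_const] at key
  have hL : 0 ≤ ∫ s in a..b, ℓ s := intervalIntegral.integral_nonneg hab fun t _ => hr0 t
  set L := ∫ s in a..b, ℓ s
  set e := Real.exp (2 * Λ * (b - a))
  have he : 1 ≤ e := Real.one_le_exp (mul_nonneg (by positivity) (by linarith))
  have h0 : ‖w a‖ ≤ m := hm a (left_mem_Icc.2 hab)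
  have hm0 : 0 ≤ m := norm_nonneg _
  have key2 : m * m ≤ e * (‖w a‖ + 2 * L) * m := by
    have : ‖w a‖ ^ 2 ≤ ‖w a‖ * m := by
      rw [sq]; exact mul_le_mul_of_nonneg_left h0 (norm_nonneg _)
    have := mul_le_mul_of_nonneg_left this (by linarith : 0 ≤ e)
    nlinarith
  rcases hm0.eq_or_lt with h1 | h1
  · rw [← h1]; positivity
  · exact le_of_mul_le_mul_right key2 h1

end Inner

end IsPrim

theorem HasTimeDeriv.isPrim {Ω : Set E3} {T : ℝ} (hT : 0 ≤ T) {ψ ψ' : ℝ → L2 Ω}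
    (h : HasTimeDeriv T ψ ψ') : IsPrim 0 T ψ ψ' where
  le := hT
  integrable := by
    rw [intervalIntegrable_iff_integrableOn_Ioo_of_le hT]; exact h.1
  eq := h.2

end Hartree
end


/-! ### Piecewise W^{1,1} controls: boundedness and the L¹ size of translations. -/

noncomputable section

namespace Hartree

/-- A function that is bounded and of bounded variation off a finite set, in a
quantitative form: `K` bounds it and `B` is a bound for its total variation. -/
structure ControlBound (T : ℝ) (c : ℝ → ℝ) (S : Finset ℝ) (K B : ℝ) : Prop where
  nonneg : 0 ≤ K
  nonneg' : 0 ≤ B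
  bound : ∀ t ∈ Ioo 0 T, t ∉ S → |c t| ≤ K
  variation : ∀ h : ℝ, 0 < h → ∃ ℓ : ℝ → ℝ, (∀ t, 0 ≤ ℓ t) ∧
    (∀ τ, 0 ≤ τ → IntervalIntegrable ℓ volume 0 τ ∧ ∫ t in (0 : ℝ)..τ, ℓ t ≤ h * B) ∧
    ∀ t, 0 < t → t + h < T → t ∉ S → t + h ∉ S → |c (t + h) - c t| ≤ ℓ t

/-- A component of the interval minus S is encoded by the set of points of S to its left. There are
finitely many codes, and on each component one value of c together with I bounds the others; a sum
over all codes serves as a common bound. -/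
theorem exists_bound_of_increment_le {T : ℝ} {c : ℝ → ℝ} {S : Finset ℝ} {I : ℝ}
    (h : ∀ s t : ℝ, 0 < s → s ≤ t → t < T → (∀ r ∈ S, r ∉ Icc s t) → |c t - c s| ≤ I) :
    ∃ K, 0 ≤ K ∧ ∀ t ∈ Ioo 0 T, t ∉ S → |c t| ≤ K := by
  classical
  have key : ∀ P ∈ S.powerset, ∃ K, 0 ≤ K ∧
      ∀ t ∈ Ioo 0 T, t ∉ S → S.filter (· < t) = P → |c t| ≤ K := by
    intro P _
    by_cases hex : ∃ t₀ ∈ Ioo 0 T, t₀ ∉ S ∧ S.filter (· < t₀) = P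
    · obtain ⟨t₀, ht₀, hS₀, hP₀⟩ := hex
      refine ⟨|c t₀| + |I|, by positivity, fun t ht hS hP => ?_⟩
      have aux : ∀ s t : ℝ, s ≤ t → s ∉ S → t ∉ S → S.filter (· < s) = S.filter (· < t) →
          ∀ r ∈ S, r ∉ Icc s t := by
        intro s t _ hs ht he r hr hmem
        have hrt : r < t := lt_of_le_of_ne hmem.2 (fun e => ht (e ▸ hr))
        have : r ∈ S.filter (· < s) := by rw [he]; simp [hr, hrt]
        exact absurd (Finset.mem_filter.1 this).2 (not_lt.2 hmem.1)
      have hle : |c t - c t₀| ≤ I := by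
        rcases le_total t₀ t with h1 | h1
        · exact h t₀ t ht₀.1 h1 ht.2 (aux _ _ h1 hS₀ hS (hP₀.trans hP.symm))
        · rw [abs_sub_comm]
          exact h t t₀ ht.1 h1 ht₀.2 (aux _ _ h1 hS hS₀ (hP.trans hP₀.symm))
      have := abs_add_le (c t - c t₀) (c t₀)
      rw [sub_add_cancel] at this
      linarith [le_abs_self I]
    · exact ⟨0, le_rfl, fun t ht hS hP => absurd ⟨t, ht, hS, hP⟩ hex⟩
  choose! K hK0 hK using key
  refine ⟨∑ P ∈ S.powerset, K P, Finset.sum_nonneg hK0, fun t ht hS => ?_⟩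
  have hmem : S.filter (· < t) ∈ S.powerset := by simp
  exact (hK _ hmem t ht hS rfl).trans (Finset.single_le_sum hK0 hmem)

theorem PiecewiseW11.exists_controlBound {T : ℝ} {c : ℝ → ℝ} (hc : PiecewiseW11 T c) :
    ∃ S K B, ControlBound T c S K B := by
  classical
  obtain ⟨S, c', hint, hc⟩ := hc
  set g : ℝ → ℝ := (Ioo 0 T).indicator c'
  have hg : Integrable g := (integrable_indicator_iff measurableSet_Ioo).2 hint
  set Φ : ℝ → ℝ := fun t => ∫ r in (0 : ℝ)..t, ‖g r‖
  have hΦc : Continuous Φ := intervalIntegral.continuous_primitive (fun a b => hg.norm.intervalIntegrable) 0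
  have hΦm : Monotone Φ := by
    intro s t hst
    have := intervalIntegral.integral_interval_sub_left (f := fun r => ‖g r‖) (μ := volume)
      (a := 0) (b := t) (c := s) hg.norm.intervalIntegrable hg.norm.intervalIntegrable
    have h0 : 0 ≤ ∫ r in s..t, ‖g r‖ :=
      intervalIntegral.integral_nonneg hst fun _ _ => norm_nonneg _
    simp only [Φ]; linarith
  have hΦI : ∀ t, 0 ≤ t → Φ t ≤ ∫ r, ‖g r‖ := by
    intro t ht
    simp only [Φ]
    rw [intervalIntegral.integral_of_le ht]
    exact setIntegral_le_integral hg.norm (ae_of_all _ fun _ => norm_nonneg _)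
  set I := ∫ r, ‖g r‖
  have hΦ0 : Φ 0 = 0 := by simp [Φ]
  have hI : 0 ≤ I := integral_nonneg fun _ => norm_nonneg _
  have hinc : ∀ s t : ℝ, 0 < s → s ≤ t → t < T → (∀ r ∈ S, r ∉ Icc s t) →
      |c t - c s| ≤ Φ t - Φ s := by
    intro s t hs hst ht hS
    rw [hc s t hs hst ht hS]
    simp only [Φ]
    rw [intervalIntegral.integral_interval_sub_left hg.norm.intervalIntegrable
      hg.norm.intervalIntegrable]
    have e : ∫ r in s..t, c' r = ∫ r in s..t, g r := by
      refine intervalIntegral.integral_congr fun r hr => ?_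
      rw [uIcc_of_le hst] at hr
      simp only [g]
      rw [indicator_of_mem (show r ∈ Ioo 0 T from ⟨hs.trans_le hr.1, hr.2.trans_lt ht⟩)]
    rw [e, ← Real.norm_eq_abs]
    exact intervalIntegral.norm_integral_le_integral_norm hst
  obtain ⟨K, hK0, hK⟩ := exists_bound_of_increment_le (I := I) fun s t hs hst ht hS => by
    have := hinc s t hs hst ht hS
    have h1 := hΦI t (hs.le.trans hst)
    have h2 : Φ 0 ≤ Φ s := hΦm hs.le
    linarith
  refine ⟨S, K, I + 2 * K * S.card, hK0, by positivity, hK, ?_⟩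
  · intro h hh
    -- J t counts the points of S in [t, t + h]. If there is one, the increment of c is estimated
    -- crudely by 2K; each point of S contributes mass h to the integral of J. Elsewhere the
    -- increment is at most that of Φ.
    set J : ℝ → ℝ := fun t => ∑ s ∈ S, (Icc (s - h) s).indicator (fun _ => (1 : ℝ)) t
    have hJ1 : ∀ s : ℝ, Integrable ((Icc (s - h) s).indicator (fun _ => (1 : ℝ))) := fun s =>
      (integrable_indicator_iff measurableSet_Icc).2 (by simp)
    have hJ0 : ∀ s t : ℝ, 0 ≤ (Icc (s - h) s).indicator (fun _ => (1 : ℝ)) t := fun s t =>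
      indicator_nonneg (fun _ _ => zero_le_one) _
    have hJi : Integrable J := integrable_finsetSum _ fun s _ => hJ1 s
    have hJnn : ∀ t, 0 ≤ J t := fun t => Finset.sum_nonneg fun s _ => hJ0 s t
    have hJint : ∫ t, J t = S.card * h := by
      simp only [J]
      rw [integral_finsetSum _ fun s _ => hJ1 s]
      have : ∀ s : ℝ, ∫ t, (Icc (s - h) s).indicator (fun _ => (1 : ℝ)) t = h := fun s => by
        rw [integral_indicator measurableSet_Icc]
        simp [hh.le]
      simp [this]
    have hΦh : Continuous fun t => Φ (t + h) := hΦc.comp (by fun_prop)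
    refine ⟨fun t => (Φ (t + h) - Φ t) + 2 * K * J t, fun t => ?_, fun τ hτ => ?_, ?_⟩
    · have := hΦm (show t ≤ t + h by linarith)
      have := mul_nonneg (mul_nonneg zero_le_two hK0) (hJnn t)
      linarith
    · have i1 : IntervalIntegrable (fun t => Φ (t + h)) volume 0 τ := hΦh.intervalIntegrable _ _
      have i2 : IntervalIntegrable Φ volume 0 τ := hΦc.intervalIntegrable _ _
      have i3 : IntervalIntegrable (fun t => 2 * K * J t) volume 0 τ :=
        (hJi.const_mul _).intervalIntegrable
      refine ⟨(i1.sub i2).add i3, ?_⟩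
      rw [intervalIntegral.integral_add (i1.sub i2) i3, intervalIntegral.integral_sub i1 i2,
        intervalIntegral.integral_const_mul, intervalIntegral.integral_comp_add_right Φ h, zero_add]
      have e1 : ∫ t in (0:ℝ)..τ, J t ≤ S.card * h := by
        rw [← hJint, intervalIntegral.integral_of_le hτ]
        exact setIntegral_le_integral hJi (ae_of_all _ hJnn)
      -- The integral of the increments of Φ telescopes to two intervals of length h, which is where
      -- the factor h comes from.
      have e2 : (∫ t in h..(τ + h), Φ t) - ∫ t in (0:ℝ)..τ, Φ t
          = (∫ t in τ..(τ + h), Φ t) - ∫ t in (0:ℝ)..h, Φ t := by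
        have ii : ∀ a b : ℝ, IntervalIntegrable Φ volume a b := fun a b =>
          hΦc.intervalIntegrable a b
        have a1 := intervalIntegral.integral_add_adjacent_intervals (ii 0 h) (ii h (τ + h))
        have a2 := intervalIntegral.integral_add_adjacent_intervals (ii 0 τ) (ii τ (τ + h))
        linarith
      have e3 : ∫ t in τ..(τ + h), Φ t ≤ h * I := by
        have := intervalIntegral.integral_mono_on (show τ ≤ τ + h by linarith)
          (hΦc.intervalIntegrable (μ := volume) _ _) (intervalIntegrable_const (c := I))
          fun t ht => hΦI t (hτ.trans ht.1)
        simpa using this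
      have e4 : 0 ≤ ∫ t in (0:ℝ)..h, Φ t :=
        intervalIntegral.integral_nonneg hh.le fun t ht => by
          rw [← hΦ0]; exact hΦm ht.1
      have := mul_le_mul_of_nonneg_left e1 (mul_nonneg zero_le_two hK0)
      rw [e2]
      linarith
    · intro t ht hth hS hSh
      by_cases hex : ∃ r ∈ S, r ∈ Icc t (t + h)
      · obtain ⟨r, hr, hrm⟩ := hex
        have h1 : 1 ≤ J t := by
          have : (Icc (r - h) r).indicator (fun _ => (1 : ℝ)) t = 1 :=
            indicator_of_mem (show t ∈ Icc (r - h) r from ⟨by linarith [hrm.2], hrm.1⟩) _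
          rw [← this]
          exact Finset.single_le_sum (f := fun s => (Icc (s - h) s).indicator (fun _ => (1 : ℝ)) t)
            (fun s _ => hJ0 s t) hr
        have h2 := hK t ⟨ht, by linarith⟩ hS
        have h3 := hK (t + h) ⟨by linarith, hth⟩ hSh
        have h4 := abs_sub (c (t + h)) (c t)
        have h5 := hΦm (show t ≤ t + h by linarith)
        nlinarith
      · push Not at hex
        have := hinc t (t + h) ht (by linarith) hth fun r hr => hex r hr
        have := mul_nonneg (mul_nonneg zero_le_two hK0) (hJnn t)
        linarith

end Hartree
end


/-! ### Test functions, weak derivatives and the Dirichlet Laplacian. -/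

noncomputable section

namespace Hartree

variable {Ω : Set E3}

section TestFunctions

variable {F : Type*} [NormedAddCommGroup F] [NormedSpace ℝ F] {φ : E3 → F}

theorem IsTestFunction.partialDeriv (h : IsTestFunction Ω φ) (i : Fin 3) :
    IsTestFunction Ω (partialDeriv i φ) where
  contDiff := h.contDiff.fderiv_right (m := ∞) (by simp) |>.clm_apply contDiff_const
  hasCompactSupport := h.hasCompactSupport.fderiv_apply (𝕜 := ℝ) _
  tsupport_subset := (tsupport_fderiv_apply_subset ℝ _).trans h.tsupport_subset

theorem IsTestFunction.continuous (h : IsTestFunction Ω φ) : Continuous φ := h.contDiff.continuous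

theorem IsTestFunction.memLp (h : IsTestFunction Ω φ) (p : ℝ≥0∞) : MemLp φ p (vol Ω) :=
  (h.continuous.memLp_of_hasCompactSupport (μ := volume) h.hasCompactSupport).restrict Ω

theorem IsTestFunction.eq_zero (h : IsTestFunction Ω φ) {x : E3} (hx : x ∉ Ω) : φ x = 0 := by
  by_contra hne
  exact hx (h.tsupport_subset (subset_tsupport _ hne))

theorem IsTestFunction.integrable_smul {φ : E3 → ℝ} (h : IsTestFunction Ω φ) {u : E3 → ℂ}
    (hu : MemLp u 2 (vol Ω)) : Integrable (fun x => φ x • u x) (vol Ω) :=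
  (hu.locallyIntegrable one_le_two).integrable_smul_left_of_hasCompactSupport h.continuous
    h.hasCompactSupport

/-- A test function as an element of `L²(Ω)`. -/
def IsTestFunction.toL2 {φ : E3 → ℂ} (h : IsTestFunction Ω φ) : L2 Ω := (h.memLp 2).toLp φ

theorem IsTestFunction.sub {ψ : E3 → F} (h : IsTestFunction Ω φ) (k : IsTestFunction Ω ψ) :
    IsTestFunction Ω (fun x => φ x - ψ x) where
  contDiff := h.contDiff.sub k.contDiff
  hasCompactSupport := h.hasCompactSupport.sub k.hasCompactSupport
  tsupport_subset := (tsupport_sub φ ψ).trans (union_subset h.tsupport_subset k.tsupport_subset)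

theorem IsTestFunction.clm {G : Type*} [NormedAddCommGroup G] [NormedSpace ℝ G]
    (h : IsTestFunction Ω φ) (L : F →L[ℝ] G) : IsTestFunction Ω (fun x => L (φ x)) where
  contDiff := L.contDiff.comp h.contDiff
  hasCompactSupport := h.hasCompactSupport.comp_left (g := L) (map_zero L)
  tsupport_subset := (tsupport_comp_subset (map_zero L) φ).trans h.tsupport_subset

theorem partialDeriv_sub {ψ : E3 → F} (h : ContDiff ℝ ∞ φ) (k : ContDiff ℝ ∞ ψ) (i : Fin 3) :
    Hartree.partialDeriv i (fun x => φ x - ψ x)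
      = fun x => Hartree.partialDeriv i φ x - Hartree.partialDeriv i ψ x := by
  ext x
  simp only [Hartree.partialDeriv]
  rw [fderiv_fun_sub (h.differentiable (by simp) x) (k.differentiable (by simp) x)]
  rfl

theorem partialDeriv_clm {G : Type*} [NormedAddCommGroup G] [NormedSpace ℝ G]
    (h : ContDiff ℝ ∞ φ) (L : F →L[ℝ] G) (i : Fin 3) :
    Hartree.partialDeriv i (fun x => L (φ x)) = fun x => L (Hartree.partialDeriv i φ x) := by
  ext x
  simp only [Hartree.partialDeriv]
  have := (L.hasFDerivAt.comp x (h.differentiable (by simp) x).hasFDerivAt).fderiv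
  rw [show (fun x => L (φ x)) = L ∘ φ from rfl, this]
  rfl

theorem integral_partialDeriv_smul_eq_neg {φ : E3 → ℝ} {ψ : E3 → ℂ} (h : IsTestFunction Ω φ)
    (k : IsTestFunction Ω ψ) (i : Fin 3) :
    ∫ x in Ω, Hartree.partialDeriv i φ x • ψ x = - ∫ x in Ω, φ x • Hartree.partialDeriv i ψ x := by
  have e : ∀ {φ : E3 → ℝ} {ψ : E3 → ℂ}, IsTestFunction Ω φ → IsTestFunction Ω ψ →
      ∫ x in Ω, φ x • ψ x = ∫ x, φ x • ψ x := fun {φ ψ} h _ =>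
    setIntegral_eq_integral_of_forall_compl_eq_zero fun x hx => by rw [h.eq_zero hx, zero_smul]
  have I : ∀ {φ : E3 → ℝ} {ψ : E3 → ℂ}, IsTestFunction Ω φ → IsTestFunction Ω ψ →
      Integrable (fun x => φ x • ψ x) := fun {φ ψ} h k =>
    (h.continuous.smul k.continuous).integrable_of_hasCompactSupport
      (h.hasCompactSupport.smul_right)
  rw [e (h.partialDeriv i) k, e h (k.partialDeriv i), eq_comm, neg_eq_iff_eq_neg]
  exact integral_smul_fderiv_eq_neg_fderiv_smul_of_integrable (I (h.partialDeriv i) k)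
    (I h (k.partialDeriv i)) (I h k) (fun x _ => h.contDiff.differentiable (by simp) x)
    (fun x _ => k.contDiff.differentiable (by simp) x)

end TestFunctions

section WeakDerivatives

variable {i : Fin 3} {u g : E3 → ℂ}

theorem HasWeakPartial.sub {v k : E3 → ℂ} (h : HasWeakPartial Ω i u g) (h' : HasWeakPartial Ω i v k)
    (hu : MemLp u 2 (vol Ω)) (hg : MemLp g 2 (vol Ω)) (hv : MemLp v 2 (vol Ω))
    (hk : MemLp k 2 (vol Ω)) :
    HasWeakPartial Ω i (fun x => u x - v x) (fun x => g x - k x) := by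
  intro φ hφ
  simp only [smul_sub]
  rw [integral_sub ((hφ.partialDeriv i).integrable_smul hu) ((hφ.partialDeriv i).integrable_smul hv),
    integral_sub (hφ.integrable_smul hg) (hφ.integrable_smul hk), h φ hφ, h' φ hφ]
  ring

theorem HasWeakPartial.congr {v k : E3 → ℂ} (h : HasWeakPartial Ω i u g) (hu : u =ᵐ[vol Ω] v)
    (hg : g =ᵐ[vol Ω] k) : HasWeakPartial Ω i v k := by
  intro φ hφ
  have e1 : (fun x => Hartree.partialDeriv i φ x • u x) =ᵐ[vol Ω]
      fun x => Hartree.partialDeriv i φ x • v x := hu.mono fun x hx => by simp only [hx]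
  have e2 : (fun x => φ x • g x) =ᵐ[vol Ω] fun x => φ x • k x := hg.mono fun x hx => by
    simp only [hx]
  rw [← integral_congr_ae e1, ← integral_congr_ae e2]
  exact h φ hφ

theorem HasWeakPartial.ae_eq (hΩ : IsOpen Ω) {k : E3 → ℂ} (h : HasWeakPartial Ω i u g)
    (h' : HasWeakPartial Ω i u k) (hg : MemLp g 2 (vol Ω)) (hk : MemLp k 2 (vol Ω)) :
    g =ᵐ[vol Ω] k := by
  have hd := hΩ.ae_eq_zero_of_integral_contDiff_smul_eq_zero (μ := volume) (f := fun x => g x - k x)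
    (locallyIntegrableOn_of_locallyIntegrable_restrict
      ((hg.sub hk).locallyIntegrable one_le_two)) (fun φ h1 h2 h3 => by
      have hφ : IsTestFunction Ω φ := ⟨h1, h2, h3⟩
      rw [← setIntegral_eq_integral_of_forall_compl_eq_zero (s := Ω) fun x hx => by
        rw [hφ.eq_zero hx, zero_smul]]
      simp only [smul_sub]
      rw [integral_sub (hφ.integrable_smul hg) (hφ.integrable_smul hk), sub_eq_zero]
      have e1 := h φ hφ
      rw [h' φ hφ] at e1
      exact (neg_injective e1).symm)
  rw [EventuallyEq, ae_restrict_iff' hΩ.measurableSet]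
  filter_upwards [hd] with x hx hxΩ
  exact sub_eq_zero.1 (hx hxΩ)

/-- Weak derivatives are defined by real test functions. Complex ones follow by separating real and
imaginary parts; the minus sign in front of i in the proof stems from the conjugation in the first
slot of the inner product. -/
theorem HasWeakPartial.inner_toL2 {z w : L2 Ω} (h : HasWeakPartial Ω i z w) {φ : E3 → ℂ}
    (hφ : IsTestFunction Ω φ) :
    inner ℂ hφ.toL2 w = - inner ℂ (hφ.partialDeriv i).toL2 z := by
  have key : ∀ {φ : E3 → ℂ} (hφ : IsTestFunction Ω φ) (w : L2 Ω), inner ℂ hφ.toL2 w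
      = (∫ x in Ω, (φ x).re • w x) - Complex.I * ∫ x in Ω, (φ x).im • w x := by
    intro φ hφ w
    have h1 := (hφ.clm Complex.reCLM).integrable_smul (Lp.memLp w)
    have h2 := (hφ.clm Complex.imCLM).integrable_smul (Lp.memLp w)
    simp only [Complex.reCLM_apply, Complex.imCLM_apply] at h1 h2
    rw [L2.inner_def, ← integral_const_mul, ← integral_sub h1 (h2.const_mul _)]
    refine integral_congr_ae ?_
    filter_upwards [(hφ.memLp 2).coeFn_toLp] with x hx
    rw [IsTestFunction.toL2, hx]
    apply Complex.ext <;> simp <;> ring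
  rw [key hφ, key (hφ.partialDeriv i)]
  have e1 := h _ (hφ.clm Complex.reCLM)
  have e2 := h _ (hφ.clm Complex.imCLM)
  rw [partialDeriv_clm hφ.contDiff] at e1 e2
  simp only [Complex.reCLM_apply, Complex.imCLM_apply] at e1 e2
  rw [e1, e2]
  ring

end WeakDerivatives

/-- `u` is in `H¹₀(Ω)` with gradient `d`. -/
def DirGrad (Ω : Set E3) (u : L2 Ω) (d : Fin 3 → L2 Ω) : Prop :=
  ∃ (φ : ℕ → E3 → ℂ) (h : ∀ n, IsTestFunction Ω (φ n)),
    Tendsto (fun n => (h n).toL2) atTop (𝓝 u) ∧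
    ∀ i, Tendsto (fun n => ((h n).partialDeriv i).toL2) atTop (𝓝 (d i))

/-- `u` is in `H¹₀(Ω)` with gradient `d`, and `l` is its Laplacian. -/
def DirGradLap (Ω : Set E3) (u : L2 Ω) (d : Fin 3 → L2 Ω) (l : L2 Ω) : Prop :=
  DirGrad Ω u d ∧ ∃ w : Fin 3 → L2 Ω, (∀ i, HasWeakPartial Ω i (d i) (w i)) ∧ l = ∑ i, w i

/-- `u` is in the domain of the Dirichlet Laplacian, and `l` is its Laplacian. -/
def DirLap (Ω : Set E3) (u l : L2 Ω) : Prop := ∃ d, DirGradLap Ω u d l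

theorem DirGrad.sub {u v : L2 Ω} {d e : Fin 3 → L2 Ω} (h : DirGrad Ω u d) (k : DirGrad Ω v e) :
    DirGrad Ω (u - v) (fun i => d i - e i) := by
  obtain ⟨φ, hφ, h1, h2⟩ := h
  obtain ⟨χ, hχ, k1, k2⟩ := k
  refine ⟨fun n x => φ n x - χ n x, fun n => (hφ n).sub (hχ n), ?_, fun i => ?_⟩
  · exact h1.sub k1
  · refine ((h2 i).sub (k2 i)).congr fun n => ?_
    simp only [IsTestFunction.toL2]
    rw [← MemLp.toLp_sub]
    congr 1
    exact (partialDeriv_sub (hφ n).contDiff (hχ n).contDiff i).symm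

theorem DirGrad.hasWeakPartial {u : L2 Ω} {d : Fin 3 → L2 Ω} (h : DirGrad Ω u d) (i : Fin 3) :
    HasWeakPartial Ω i u (d i) := by
  obtain ⟨φ, hφ, h1, h2⟩ := h
  intro χ hχ
  have key : ∀ {χ : E3 → ℝ} (hχ : IsTestFunction Ω χ) (v : L2 Ω),
      inner ℂ (hχ.clm Complex.ofRealCLM).toL2 v = ∫ x in Ω, χ x • v x := by
    intro χ hχ v
    rw [L2.inner_def]
    refine integral_congr_ae ?_
    filter_upwards [((hχ.clm Complex.ofRealCLM).memLp 2).coeFn_toLp] with x hx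
    rw [IsTestFunction.toL2, hx]
    simp [mul_comm]
  have key2 : ∀ {χ : E3 → ℝ} (hχ : IsTestFunction Ω χ) {ψ : E3 → ℂ} (hψ : IsTestFunction Ω ψ),
      inner ℂ (hχ.clm Complex.ofRealCLM).toL2 hψ.toL2 = ∫ x in Ω, χ x • ψ x := by
    intro χ hχ ψ hψ
    rw [key hχ]
    refine integral_congr_ae ?_
    filter_upwards [(hψ.memLp 2).coeFn_toLp] with x hx
    rw [IsTestFunction.toL2, hx]
  rw [← key (hχ.partialDeriv i), ← key hχ]
  refine tendsto_nhds_unique (tendsto_const_nhds.inner h1) ?_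
  refine (tendsto_const_nhds.inner (h2 i)).neg.congr fun n => ?_
  rw [key2 (hχ.partialDeriv i), key2 hχ, integral_partialDeriv_smul_eq_neg hχ (hφ n)]

theorem DirGradLap.sub {u v l m : L2 Ω} {d e : Fin 3 → L2 Ω} (h : DirGradLap Ω u d l)
    (k : DirGradLap Ω v e m) : DirGradLap Ω (u - v) (fun i => d i - e i) (l - m) := by
  obtain ⟨h1, w, h2, rfl⟩ := h
  obtain ⟨k1, y, k2, rfl⟩ := k
  refine ⟨h1.sub k1, fun i => w i - y i, fun i => ?_, by rw [Finset.sum_sub_distrib]⟩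
  exact ((h2 i).sub (k2 i) (Lp.memLp _) (Lp.memLp _) (Lp.memLp _) (Lp.memLp _)).congr
    (Lp.coeFn_sub _ _).symm (Lp.coeFn_sub _ _).symm

theorem DirLap.sub {u v l m : L2 Ω} (h : DirLap Ω u l) (k : DirLap Ω v m) :
    DirLap Ω (u - v) (l - m) := by
  obtain ⟨d, h⟩ := h
  obtain ⟨e, k⟩ := k
  exact ⟨_, h.sub k⟩

/-- Green's formula. Integration by parts is exact on the test functions approximating u, and both
sides pass to the limit; no trace or boundary regularity enters. -/
theorem DirGrad.inner_eq {u : L2 Ω} {d : Fin 3 → L2 Ω} (h : DirGrad Ω u d) {v l : L2 Ω}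
    {e : Fin 3 → L2 Ω} (k : DirGradLap Ω v e l) :
    inner ℂ u l = - ∑ i, inner ℂ (d i) (e i) := by
  obtain ⟨φ, hφ, h1, h2⟩ := h
  obtain ⟨-, w, hw, rfl⟩ := k
  rw [inner_sum, ← Finset.sum_neg_distrib]
  refine Finset.sum_congr rfl fun i _ => ?_
  refine tendsto_nhds_unique (h1.inner tendsto_const_nhds) ?_
  exact ((h2 i).inner tendsto_const_nhds).neg.congr fun n => ((hw i).inner_toL2 (hφ n)).symm

/-- The Dirichlet Laplacian is symmetric. -/
theorem DirLap.inner_comm {u v l m : L2 Ω} (h : DirLap Ω u l) (k : DirLap Ω v m) :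
    inner ℂ u m = inner ℂ l v := by
  obtain ⟨d, h⟩ := h
  obtain ⟨e, k⟩ := k
  rw [h.1.inner_eq k, ← inner_conj_symm l v, k.1.inner_eq h, map_neg, map_sum]
  simp only [inner_conj_symm]

theorem DirLap.inner_self_im {u l : L2 Ω} (h : DirLap Ω u l) : (inner ℂ u l).im = 0 := by
  have := h.inner_comm h
  rw [← inner_conj_symm l u] at this
  exact Complex.conj_eq_iff_im.1 this.symm

theorem DirGradLap.re_inner_eq {u l : L2 Ω} {d : Fin 3 → L2 Ω} (h : DirGradLap Ω u d l) :
    (inner ℂ u l).re = - ∑ i, ‖d i‖ ^ 2 := by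
  have e : ∀ x : L2 Ω, (inner ℂ x x).re = ‖x‖ ^ 2 := fun x => inner_self_eq_norm_sq (𝕜 := ℂ) x
  rw [h.1.inner_eq h, Complex.neg_re, Complex.re_sum]
  simp only [e]

theorem tendsto_toLp_of_eLpNorm {φ : ℕ → E3 → ℂ} (hφ : ∀ n, MemLp (φ n) 2 (vol Ω)) {v : E3 → ℂ}
    (hv : MemLp v 2 (vol Ω))
    (h : Tendsto (fun n => eLpNorm (fun x => φ n x - v x) 2 (vol Ω)) atTop (𝓝 0)) :
    Tendsto (fun n => (hφ n).toLp (φ n)) atTop (𝓝 (hv.toLp v)) :=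
  (Lp.tendsto_Lp_iff_tendsto_eLpNorm'' φ hφ v hv).2 h

/-- The gradient obtained as a limit of test functions and the one in the H² jet are both weak
derivatives of u, hence agree; this places the jet in the domain of the Dirichlet Laplacian. -/
theorem exists_dirGradLap (hΩ : IsOpen Ω) {u : L2 Ω} (h : MemH10 Ω u) {v : Fin 3 → E3 → ℂ}
    {w : Fin 3 → Fin 3 → E3 → ℂ} (hj : IsH2Jet Ω u v w) :
    DirGradLap Ω u (fun i => (hj.memLp_one i).toLp (v i)) (∑ i, (hj.memLp_two i i).toLp (w i i)) := by
  obtain ⟨hu, v', hv', φ, hφ, h1, h2⟩ := h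
  have hg : DirGrad Ω u (fun i => (hv' i).toLp (v' i)) := by
    refine ⟨φ, hφ, ?_, fun i => ?_⟩
    · have := tendsto_toLp_of_eLpNorm (fun n => (hφ n).memLp 2) hu h1
      rwa [Lp.toLp_coeFn] at this
    · exact tendsto_toLp_of_eLpNorm (fun n => ((hφ n).partialDeriv i).memLp 2) (hv' i) (h2 i)
  have he : (fun i => (hv' i).toLp (v' i)) = fun i => (hj.memLp_one i).toLp (v i) := by
    funext i
    rw [MemLp.toLp_eq_toLp_iff]
    exact (HasWeakPartial.congr (hg.hasWeakPartial i) EventuallyEq.rfl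
      (hv' i).coeFn_toLp).ae_eq hΩ (hj.weak_one i) (hv' i) (hj.memLp_one i)
  rw [he] at hg
  exact ⟨hg, _, fun i => (hj.weak_two i i).congr (hj.memLp_one i).coeFn_toLp.symm
    (hj.memLp_two i i).coeFn_toLp.symm, rfl⟩

theorem HasLaplacian.sub {u v l m : E3 → ℂ} (h : HasLaplacian Ω u l) (k : HasLaplacian Ω v m) :
    HasLaplacian Ω (fun x => u x - v x) (fun x => l x - m x) := by
  obtain ⟨v1, w1, j1, e1⟩ := h
  obtain ⟨v2, w2, j2, e2⟩ := k
  refine ⟨fun i x => v1 i x - v2 i x, fun i j x => w1 i j x - w2 i j x, ⟨?_, ?_, ?_, ?_, ?_⟩, ?_⟩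
  · exact j1.memLp_zero.sub j2.memLp_zero
  · exact fun i => (j1.memLp_one i).sub (j2.memLp_one i)
  · exact fun i j => (j1.memLp_two i j).sub (j2.memLp_two i j)
  · exact fun i => (j1.weak_one i).sub (j2.weak_one i) j1.memLp_zero (j1.memLp_one i)
      j2.memLp_zero (j2.memLp_one i)
  · exact fun i j => (j1.weak_two i j).sub (j2.weak_two i j) (j1.memLp_one i) (j1.memLp_two i j)
      (j2.memLp_one i) (j2.memLp_two i j)
  · filter_upwards [e1, e2] with x h1 h2
    rw [h1, h2, Finset.sum_sub_distrib]

theorem HasLaplacian.congr {u v l : E3 → ℂ} (h : HasLaplacian Ω u l) (he : u =ᵐ[vol Ω] v) :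
    HasLaplacian Ω v l := by
  obtain ⟨v1, w1, j1, e1⟩ := h
  exact ⟨v1, w1, ⟨(memLp_congr_ae he).1 j1.memLp_zero, j1.memLp_one, j1.memLp_two,
    fun i => (j1.weak_one i).congr he EventuallyEq.rfl, j1.weak_two⟩, e1⟩

/-- A bound of the `H²₂` norm gives the Laplacian with a bound of its norm. -/
theorem exists_dirLap_of_normH22_le (hΩ : IsOpen Ω) {u : L2 Ω} (h : MemH10 Ω u) {M : ℝ≥0}
    (hM : normH22 Ω u ≤ M) : ∃ l, DirLap Ω u l ∧ ‖l‖ ≤ 3 * (M + 1) ∧ ‖u‖ ≤ M + 1 ∧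
      (-(inner ℂ u l).re) ≤ 3 * (M + 1) ^ 2 := by
  -- A jet can be extracted from the infimum only under a strict inequality, hence M + 1. The factor
  -- 3 in the conclusion counts the terms of the Laplacian and of the gradient.
  have hlt : normH22 Ω u < (M + 1 : ℝ≥0) := lt_of_le_of_lt hM (by
    exact_mod_cast lt_add_one M)
  simp only [normH22, iInf_lt_iff] at hlt
  obtain ⟨v, w, hj, hlt⟩ := hlt
  have hd := exists_dirGradLap hΩ h hj
  have hsq : (eLpNorm u 2 (vol Ω) ^ 2 + ∑ i, eLpNorm (v i) 2 (vol Ω) ^ 2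
      + ∑ i, ∑ j, eLpNorm (w i j) 2 (vol Ω) ^ 2
      + eLpNorm (fun x => ((‖x‖ ^ 2 : ℝ) : ℂ) * u x) 2 (vol Ω) ^ 2) ≤ ((M + 1 : ℝ≥0) : ℝ≥0∞) ^ 2 := by
    have := ENNReal.rpow_le_rpow hlt.le (zero_le_two : (0:ℝ) ≤ 2)
    rw [← ENNReal.rpow_mul] at this
    norm_num at this
    simpa using this
  have conv : ∀ f : E3 → ℂ, ∀ hf : MemLp f 2 (vol Ω), eLpNorm f 2 (vol Ω) ^ 2 ≤
      ((M + 1 : ℝ≥0) : ℝ≥0∞) ^ 2 → ‖hf.toLp f‖ ≤ M + 1 := by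
    intro f hf hle
    have h1 : eLpNorm f 2 (vol Ω) ≤ ((M + 1 : ℝ≥0) : ℝ≥0∞) := (ENNReal.pow_le_pow_left_iff two_ne_zero).1 hle
    rw [Lp.norm_toLp]
    exact ENNReal.toReal_le_coe_of_le_coe h1
  have b0 : ‖u‖ ≤ M + 1 := by
    have := conv u (Lp.memLp u) (le_trans (le_trans (le_trans le_self_add le_self_add) le_self_add) hsq)
    rwa [Lp.toLp_coeFn] at this
  have b1 : ∀ i, ‖(hj.memLp_one i).toLp (v i)‖ ≤ M + 1 := fun i => by
    refine conv _ _ (le_trans ?_ hsq)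
    refine le_trans ?_ (le_trans le_self_add le_self_add)
    exact (Finset.single_le_sum (f := fun i => eLpNorm (v i) 2 (vol Ω) ^ 2)
      (fun _ _ => zero_le) (Finset.mem_univ i)).trans le_add_self
  have b2 : ∀ i, ‖(hj.memLp_two i i).toLp (w i i)‖ ≤ M + 1 := fun i => by
    refine conv _ _ (le_trans ?_ hsq)
    refine le_trans ?_ le_self_add
    refine le_trans ?_ le_add_self
    refine le_trans ?_ (Finset.single_le_sum (f := fun i => ∑ j, eLpNorm (w i j) 2 (vol Ω) ^ 2)
      (fun _ _ => zero_le) (Finset.mem_univ i))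
    exact Finset.single_le_sum (f := fun j => eLpNorm (w i j) 2 (vol Ω) ^ 2)
      (fun _ _ => zero_le) (Finset.mem_univ i)
  refine ⟨_, ⟨_, hd⟩, ?_, b0, ?_⟩
  · refine (norm_sum_le _ _).trans ((Finset.sum_le_sum fun i _ => b2 i).trans ?_)
    simp
    linarith
  · rw [hd.re_inner_eq, neg_neg]
    refine (Finset.sum_le_sum fun i _ => pow_le_pow_left₀ (norm_nonneg _) (b1 i) 2).trans ?_
    simp

end Hartree
end


/-! ### The Sobolev inequality and an L⁴ estimate by the kinetic energy. -/

noncomputable section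

namespace Hartree

variable {Ω : Set E3}

theorem enorm_fderiv_le (φ : E3 → ℂ) (x : E3) :
    ‖fderiv ℝ φ x‖ ≤ ∑ i, ‖partialDeriv i φ x‖ := by
  refine ContinuousLinearMap.opNorm_le_bound _ (Finset.sum_nonneg fun _ _ => norm_nonneg _)
    fun v => ?_
  have hv : v = ∑ i, v i • EuclideanSpace.single i (1 : ℝ) := by
    ext j; simp [Finset.sum_apply, Pi.single_apply]
  conv_lhs => rw [hv, map_sum]
  rw [Finset.sum_mul]
  refine (norm_sum_le _ _).trans (Finset.sum_le_sum fun i _ => ?_)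
  rw [map_smul, norm_smul, mul_comm, partialDeriv]
  exact mul_le_mul_of_nonneg_left (PiLp.norm_apply_le v i) (norm_nonneg _)

theorem IsTestFunction.eLpNorm_eq {φ : E3 → ℂ} (h : IsTestFunction Ω φ) (p : ℝ≥0∞) : eLpNorm φ p (vol Ω) = eLpNorm φ p volume :=
  eLpNorm_restrict_eq_of_support_subset fun x hx => by
    by_contra hne; exact hx (h.eq_zero hne)

/-- The Sobolev inequality on `H¹₀(Ω)`. -/
theorem exists_sobolev_const (Ω : Set E3) : ∃ C : ℝ≥0, ∀ (u : L2 Ω) (d : Fin 3 → L2 Ω),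
    DirGrad Ω u d → eLpNorm u 6 (vol Ω) ≤ C * ENNReal.ofReal (∑ i, ‖d i‖) := by
  refine ⟨SNormLESNormFDerivOfEqConst ℂ (volume : Measure E3) 2, fun u d h => ?_⟩
  set C := SNormLESNormFDerivOfEqConst ℂ (volume : Measure E3) 2
  obtain ⟨φ, hφ, h1, h2⟩ := h
  have key : ∀ n, eLpNorm (hφ n).toL2 6 (vol Ω)
      ≤ C * ENNReal.ofReal (∑ i, ‖((hφ n).partialDeriv i).toL2‖) := by
    intro n
    rw [IsTestFunction.toL2, eLpNorm_congr_ae ((hφ n).memLp 2).coeFn_toLp,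
      (hφ n).eLpNorm_eq]
    have := eLpNorm_le_eLpNorm_fderiv_of_eq (volume : Measure E3) (p := 2) (p' := 6)
      ((hφ n).contDiff.of_le (by simp)) (hφ n).hasCompactSupport (by norm_num)
      (by simp) (by simp; norm_num)
    refine this.trans (mul_le_mul' le_rfl ?_)
    have e1 : eLpNorm (fderiv ℝ (φ n)) 2 volume
        ≤ eLpNorm (∑ i, fun x => ‖partialDeriv i (φ n) x‖) 2 volume := by
      refine eLpNorm_mono fun x => ?_
      rw [Finset.sum_apply, Real.norm_of_nonneg (Finset.sum_nonneg fun _ _ => norm_nonneg _)]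
      exact enorm_fderiv_le _ _
    refine e1.trans ((eLpNorm_sum_le (fun i _ =>
      ((hφ n).partialDeriv i).continuous.norm.aestronglyMeasurable) one_le_two).trans ?_)
    rw [ENNReal.ofReal_sum_of_nonneg fun _ _ => norm_nonneg _]
    refine Finset.sum_le_sum fun i _ => ?_
    rw [eLpNorm_norm, ← ((hφ n).partialDeriv i).eLpNorm_eq, IsTestFunction.toL2,
      Lp.norm_toLp, ENNReal.ofReal_toReal (((hφ n).partialDeriv i).memLp 2).2.ne]
  -- The test functions converge to u only in L². An almost everywhere convergent subsequence and
  -- Fatou's lemma carry the L⁶ bound to u.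
  obtain ⟨ns, hns, hae⟩ := (tendstoInMeasure_of_tendsto_Lp h1).exists_seq_tendsto_ae
  refine (Lp.eLpNorm_lim_le_liminf_eLpNorm (fun n => Lp.aestronglyMeasurable _) _ hae).trans ?_
  have hlim : Tendsto (fun n => C * ENNReal.ofReal
      (∑ i, ‖((hφ (ns n)).partialDeriv i).toL2‖)) atTop (𝓝 (C * ENNReal.ofReal (∑ i, ‖d i‖))) := by
    refine ENNReal.Tendsto.const_mul ?_ (Or.inr ENNReal.coe_ne_top)
    refine (ENNReal.continuous_ofReal.tendsto _).comp ?_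
    exact (tendsto_finsetSum _ fun i _ => (h2 i).norm).comp hns.tendsto_atTop
  rw [← hlim.liminf_eq]
  exact liminf_le_liminf (Eventually.of_forall fun n => key (ns n))

theorem lintegral_enorm_sq_eq (u : L2 Ω) :
    ∫⁻ x in Ω, ‖u x‖ₑ ^ 2 = ENNReal.ofReal (‖u‖ ^ 2) := by
  rw [Lp.norm_def, ← ENNReal.toReal_pow, ENNReal.ofReal_toReal (by
    exact (ENNReal.pow_lt_top (Lp.memLp u).2).ne)]
  rw [eLpNorm_eq_lintegral_rpow_enorm_toReal two_ne_zero ENNReal.ofNat_ne_top,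
    ← ENNReal.rpow_natCast, ← ENNReal.rpow_mul]
  simp

/-- Hölder's inequality gives ∫|u|⁴ ≤ ‖u‖₂‖u‖₆³, Sobolev's inequality bounds ‖u‖₆ by the gradient,
and Young's inequality makes the factor of the kinetic energy −Re⟨u, Δu⟩ arbitrarily small. -/
theorem exists_lintegral_pow_four_le (Ω : Set E3) {ε : ℝ} (hε : 0 < ε) :
    ∃ C : ℝ, 0 ≤ C ∧ ∀ (u l : L2 Ω), DirLap Ω u l →
      ∫⁻ x in Ω, ‖u x‖ₑ ^ 4 ≤ ENNReal.ofReal ((ε * (-(inner ℂ u l).re) + C * ‖u‖ ^ 2) ^ 2) := by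
  obtain ⟨C₀, hC₀⟩ := exists_sobolev_const Ω
  set K : ℝ := 3 * C₀ ^ 2 + 1
  have hK : 0 < K := by positivity
  set η := ε / K
  have hη : 0 < η := by positivity
  refine ⟨1 / (8 * η ^ 3), by positivity, fun u l h => ?_⟩
  obtain ⟨d, h⟩ := h
  rw [h.re_inner_eq, neg_neg]
  obtain ⟨a, ha'⟩ : ∃ a, a = ‖u‖ := ⟨_, rfl⟩
  obtain ⟨b, hb'⟩ : ∃ b, b = C₀ * ∑ i, ‖d i‖ := ⟨_, rfl⟩
  rw [← ha']
  have ha : 0 ≤ a := ha' ▸ norm_nonneg _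
  have hb : 0 ≤ b := by
    rw [hb']; exact mul_nonneg C₀.coe_nonneg (Finset.sum_nonneg fun _ _ => norm_nonneg _)
  have h6 : ∫⁻ x in Ω, ‖u x‖ₑ ^ 6 ≤ ENNReal.ofReal (b ^ 6) := by
    have h1 := hC₀ u d h.1
    rw [← ENNReal.ofReal_coe_nnreal, ← ENNReal.ofReal_mul (by positivity), ← hb'] at h1
    have h2 : eLpNorm u 6 (vol Ω) ^ 6 = ∫⁻ x in Ω, ‖u x‖ₑ ^ 6 := by
      rw [eLpNorm_eq_lintegral_rpow_enorm_toReal (by norm_num) ENNReal.ofNat_ne_top,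
        ← ENNReal.rpow_natCast, ← ENNReal.rpow_mul]
      rw [ENNReal.toReal_ofNat]
      norm_num
    rw [← h2, ENNReal.ofReal_pow hb]
    gcongr
  have h4 : ∫⁻ x in Ω, ‖u x‖ₑ ^ 4 ≤ ENNReal.ofReal (a * b ^ 3) := by
    have hm : AEMeasurable (fun x => ‖u x‖ₑ) (vol Ω) := (Lp.aestronglyMeasurable u).enorm
    have h1 := ENNReal.lintegral_mul_le_Lp_mul_Lq (vol Ω) Real.HolderConjugate.two_two hm
      (hm.pow_const 3)
    simp only [Pi.mul_apply] at h1
    have e1 : ∀ x, ‖u x‖ₑ * ‖u x‖ₑ ^ 3 = ‖u x‖ₑ ^ 4 := fun x => by ring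
    have e2 : ∀ x, (‖u x‖ₑ ^ 3) ^ (2 : ℝ) = ‖u x‖ₑ ^ 6 := fun x => by
      rw [ENNReal.rpow_ofNat, ← pow_mul]
    have e3 : ∀ x, ‖u x‖ₑ ^ (2 : ℝ) = ‖u x‖ₑ ^ 2 := fun x => by rw [ENNReal.rpow_ofNat]
    simp only [e1, e2, e3] at h1
    rw [lintegral_enorm_sq_eq, ← ha'] at h1
    refine h1.trans ((mul_le_mul_right (ENNReal.rpow_le_rpow h6 (by norm_num)) _).trans ?_)
    rw [ENNReal.ofReal_rpow_of_nonneg (by positivity) (by norm_num),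
      ENNReal.ofReal_rpow_of_nonneg (by positivity) (by norm_num),
      ← ENNReal.ofReal_mul (by positivity)]
    refine ENNReal.ofReal_le_ofReal (le_of_eq ?_)
    rw [← Real.sqrt_eq_rpow, ← Real.sqrt_eq_rpow, Real.sqrt_sq ha,
      show b ^ 6 = (b ^ 3) ^ 2 by ring, Real.sqrt_sq (by positivity)]
  refine h4.trans (ENNReal.ofReal_le_ofReal ?_)
  have hbb : b ^ 2 ≤ K * ∑ i, ‖d i‖ ^ 2 := by
    have h3 : (∑ i, ‖d i‖) ^ 2 ≤ 3 * ∑ i, ‖d i‖ ^ 2 := by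
      have := sq_sum_le_card_mul_sum_sq (s := (Finset.univ : Finset (Fin 3))) (f := fun i => ‖d i‖)
      simpa using this
    have h4 : 0 ≤ ∑ i, ‖d i‖ ^ 2 := Finset.sum_nonneg fun _ _ => sq_nonneg _
    have := mul_le_mul_of_nonneg_left h3 (sq_nonneg (C₀ : ℝ))
    rw [hb', mul_pow]
    simp only [K]
    nlinarith
  have h5 : η * b ^ 2 ≤ ε * ∑ i, ‖d i‖ ^ 2 := by
    have := mul_le_mul_of_nonneg_left hbb hη.le
    rwa [← mul_assoc, div_mul_cancel₀ _ hK.ne'] at this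
  -- The coefficient 1/(8η³) makes the cross term of the square equal to a²b²/(4η²), which completes
  -- η²b⁴ − ab³ to b² times a square.
  calc a * b ^ 3 ≤ (η * b ^ 2 + 1 / (8 * η ^ 3) * a ^ 2) ^ 2 := by
        have e : (η * b ^ 2 + 1 / (8 * η ^ 3) * a ^ 2) ^ 2 - a * b ^ 3
            = b ^ 2 * (η * b - a / (2 * η)) ^ 2 + (1 / (8 * η ^ 3) * a ^ 2) ^ 2 := by
          field_simp; ring
        have : 0 ≤ b ^ 2 * (η * b - a / (2 * η)) ^ 2 + (1 / (8 * η ^ 3) * a ^ 2) ^ 2 := by positivity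
        linarith
    _ ≤ _ := by gcongr

end Hartree
end


/-! ### Kato's inequality. -/

noncomputable section

namespace Hartree

variable {Ω : Set E3}

instance isFiniteMeasure_vol_of_fact [h : Fact (Bornology.IsBounded Ω)] :
    IsFiniteMeasure (vol Ω) :=
  ⟨by rw [Measure.restrict_apply_univ]; exact h.out.measure_lt_top⟩

theorem IsTestFunction.comp_left {a : E3 → ℝ} (h : IsTestFunction Ω a) {g : ℝ → ℝ}
    (hg : ContDiff ℝ ∞ g) (h0 : g 0 = 0) : IsTestFunction Ω (fun x => g (a x)) where
  contDiff := hg.comp h.contDiff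
  hasCompactSupport := h.hasCompactSupport.comp_left h0
  tsupport_subset := (tsupport_comp_subset h0 a).trans h.tsupport_subset

theorem IsTestFunction.mul_left {a θ : E3 → ℝ} (h : IsTestFunction Ω a) (hθ : ContDiff ℝ ∞ θ) :
    IsTestFunction Ω (fun x => θ x * a x) where
  contDiff := hθ.mul h.contDiff
  hasCompactSupport := h.hasCompactSupport.mul_left
  tsupport_subset := (tsupport_mul_subset_right (f := θ) (g := a)).trans h.tsupport_subset

theorem partialDeriv_comp {a : E3 → ℝ} (ha : ContDiff ℝ ∞ a) {g g' : ℝ → ℝ}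
    (hg : ∀ s, HasDerivAt g (g' s) s) (i : Fin 3) (x : E3) :
    partialDeriv i (fun x => g (a x)) x = g' (a x) * partialDeriv i a x := by
  have := (hg (a x)).comp_hasFDerivAt x (ha.differentiable (by simp) x).hasFDerivAt
  simp only [partialDeriv]
  rw [show (fun x => g (a x)) = g ∘ a from rfl, this.fderiv]
  rfl

theorem partialDeriv_mul {a b : E3 → ℝ} (ha : ContDiff ℝ ∞ a) (hb : ContDiff ℝ ∞ b) (i : Fin 3)
    (x : E3) : partialDeriv i (fun x => a x * b x) x
      = partialDeriv i a x * b x + a x * partialDeriv i b x := by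
  simp only [partialDeriv]
  rw [fderiv_fun_mul (ha.differentiable (by simp) x) (hb.differentiable (by simp) x)]
  simp; ring

theorem contDiff_partialDeriv {a : E3 → ℝ} (ha : ContDiff ℝ ∞ a) (i : Fin 3) :
    ContDiff ℝ ∞ (partialDeriv i a) :=
  ha.fderiv_right (m := ∞) (by simp) |>.clm_apply contDiff_const

theorem integral_partialDeriv_mul_eq_neg {θ b : E3 → ℝ} (hθ : ContDiff ℝ ∞ θ)
    (hb : IsTestFunction Ω b) (i : Fin 3) :
    ∫ x in Ω, θ x * partialDeriv i b x = - ∫ x in Ω, partialDeriv i θ x * b x := by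
  have e : ∀ {θ b : E3 → ℝ}, IsTestFunction Ω b →
      ∫ x in Ω, θ x * b x = ∫ x, θ x * b x := fun {θ b} h =>
    setIntegral_eq_integral_of_forall_compl_eq_zero fun x hx => by rw [h.eq_zero hx, mul_zero]
  have I : ∀ {θ b : E3 → ℝ}, ContDiff ℝ ∞ θ → IsTestFunction Ω b →
      Integrable (fun x => θ x * b x) := fun {θ b} h k =>
    (h.continuous.mul k.continuous).integrable_of_hasCompactSupport k.hasCompactSupport.mul_left
  rw [e hb, e (hb.partialDeriv i)]
  exact integral_mul_fderiv_eq_neg_fderiv_mul_of_integrable (I (contDiff_partialDeriv hθ i) hb)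
    (I hθ (hb.partialDeriv i)) (I hθ hb) (fun x _ => hθ.differentiable (by simp) x)
    (fun x _ => hb.contDiff.differentiable (by simp) x)

section Smoothing

variable {τ : ℝ}

/-- The function √(s² + τ²) − τ is a smooth convex substitute for |s| that vanishes at 0. The
properties needed below are that its first derivative is at most 1 in absolute value and its second
derivative lies between 0 and 1/τ. -/
theorem hasDerivAt_sqrt_sq_add (hτ : 0 < τ) (s : ℝ) :
    HasDerivAt (fun s => √(s ^ 2 + τ ^ 2) - τ) (s / √(s ^ 2 + τ ^ 2)) s := by
  have h1 : HasDerivAt (fun s : ℝ => s ^ 2 + τ ^ 2) (2 * s) s := by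
    simpa using (hasDerivAt_pow 2 s).add_const (τ ^ 2)
  have := (h1.sqrt (by positivity)).sub_const τ
  convert! this using 1
  field_simp

theorem hasDerivAt_div_sqrt_sq_add (hτ : 0 < τ) (s : ℝ) :
    HasDerivAt (fun s => s / √(s ^ 2 + τ ^ 2)) (τ ^ 2 / √(s ^ 2 + τ ^ 2) ^ 3) s := by
  have hp : 0 < √(s ^ 2 + τ ^ 2) := Real.sqrt_pos.2 (by positivity)
  have h1 : HasDerivAt (fun s => √(s ^ 2 + τ ^ 2)) (s / √(s ^ 2 + τ ^ 2)) s := by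
    simpa using (hasDerivAt_sqrt_sq_add hτ s).add_const τ
  convert! (hasDerivAt_id s).div h1 hp.ne' using 1
  have : √(s ^ 2 + τ ^ 2) ^ 2 = s ^ 2 + τ ^ 2 := Real.sq_sqrt (by positivity)
  simp only [id]
  field_simp
  linear_combination -this

theorem abs_div_sqrt_le_one (s : ℝ) : |s / √(s ^ 2 + τ ^ 2)| ≤ 1 := by
  rw [abs_div, abs_of_nonneg (Real.sqrt_nonneg _)]
  refine div_le_one_of_le₀ ?_ (Real.sqrt_nonneg _)
  rw [← Real.sqrt_sq_eq_abs]
  exact Real.sqrt_le_sqrt (by nlinarith [sq_nonneg τ])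

theorem sq_div_sqrt_cube_le (hτ : 0 < τ) (s : ℝ) : τ ^ 2 / √(s ^ 2 + τ ^ 2) ^ 3 ≤ 1 / τ := by
  have : τ ≤ √(s ^ 2 + τ ^ 2) := Real.le_sqrt_of_sq_le (by nlinarith [sq_nonneg s])
  rw [div_le_div_iff₀ (by positivity) hτ]
  have := pow_le_pow_left₀ hτ.le this 3
  linarith [show τ ^ 2 * τ = τ ^ 3 by ring]

theorem abs_sqrt_sub_sqrt_le (hτ : 0 < τ) (s t : ℝ) :
    |(√(s ^ 2 + τ ^ 2) - τ) - (√(t ^ 2 + τ ^ 2) - τ)| ≤ |s - t| := by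
  have := Convex.norm_image_sub_le_of_norm_hasDerivWithin_le (f := fun s => √(s ^ 2 + τ ^ 2) - τ)
    (C := 1) (s := univ) (x := t) (y := s)
    (fun x _ => (hasDerivAt_sqrt_sq_add hτ x).hasDerivWithinAt)
    (fun x _ => by rw [Real.norm_eq_abs]; exact abs_div_sqrt_le_one x) convex_univ
    (mem_univ _) (mem_univ _)
  simpa using this

theorem contDiff_sqrt_sq_add (hτ : 0 < τ) : ContDiff ℝ ∞ fun s : ℝ => √(s ^ 2 + τ ^ 2) :=
  ContDiff.sqrt (by fun_prop) fun s => by positivity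

end Smoothing

theorem exists_bound_on_bounded (hb : Bornology.IsBounded Ω) {f : E3 → ℝ} (hf : Continuous f) :
    ∃ A, 0 ≤ A ∧ ∀ x ∈ Ω, |f x| ≤ A := by
  obtain ⟨A, hA⟩ := hb.isCompact_closure.exists_bound_of_continuousOn hf.continuousOn
  exact ⟨max A 0, le_max_right _ _, fun x hx => (hA x (subset_closure hx)).trans (le_max_left _ _)⟩

/-- Kato's inequality for the real part of a function in the domain of the Dirichlet Laplacian. -/
theorem DirGradLap.kato (hΩ : IsOpen Ω) (hb : Bornology.IsBounded Ω) {u l : L2 Ω}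
    {d : Fin 3 → L2 Ω} (h : DirGradLap Ω u d l) {θ : E3 → ℝ} (hθ : ContDiff ℝ ∞ θ)
    (hθ0 : ∀ x, 0 ≤ θ x) {τ : ℝ} (hτ : 0 < τ) :
    ∫ x in Ω, -(∑ i, partialDeriv i (partialDeriv i θ) x) * (√((u x).re ^ 2 + τ ^ 2) - τ)
      ≤ ∫ x in Ω, θ x * ‖l x‖ := by
  have : Fact (Bornology.IsBounded Ω) := ⟨hb⟩
  obtain ⟨⟨φ, hφ, h1, h2⟩, w, hw, rfl⟩ := h
  set β : ℝ → ℝ := fun s => √(s ^ 2 + τ ^ 2) - τ with hβ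
  set β' : ℝ → ℝ := fun s => s / √(s ^ 2 + τ ^ 2) with hβ'
  set β'' : ℝ → ℝ := fun s => τ ^ 2 / √(s ^ 2 + τ ^ 2) ^ 3 with hβ''
  have hβ''0 : ∀ s, 0 ≤ β'' s := fun s => by positivity
  set a : ℕ → E3 → ℝ := fun n x => (φ n x).re
  have ha : ∀ n, IsTestFunction Ω (a n) := fun n => (hφ n).clm Complex.reCLM
  have hsm := contDiff_sqrt_sq_add hτ
  have hb' : ∀ n, IsTestFunction Ω (fun x => β (a n x)) := fun n =>
    (ha n).comp_left (g := β) (hsm.sub contDiff_const) (by simp [hβ, Real.sqrt_sq hτ.le])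
  have hβ's : ContDiff ℝ ∞ β' := contDiff_id.div hsm fun s => by positivity
  have hχ : ∀ n, IsTestFunction Ω (fun x => θ x * β' (a n x)) := fun n =>
    ((ha n).comp_left (g := β') hβ's (by simp [hβ'])).mul_left hθ
  set χ : ℕ → E3 → ℝ := fun n x => θ x * β' (a n x)
  have hdχ : ∀ n i x, partialDeriv i (χ n) x
      = partialDeriv i θ x * β' (a n x) + θ x * (β'' (a n x) * partialDeriv i (a n) x) := by
    intro n i x
    have e := partialDeriv_mul hθ (hβ's.comp (ha n).contDiff) i x
    have e' := partialDeriv_comp (ha n).contDiff (hasDerivAt_div_sqrt_sq_add hτ) i x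
    exact e.trans (congrArg₂ _ rfl (congrArg _ e'))
  have hda : ∀ n i x, partialDeriv i (a n) x = (partialDeriv i (φ n) x).re := by
    intro n i x
    exact congrFun (partialDeriv_clm (hφ n).contDiff Complex.reCLM i) x
  -- the complex test function
  have hc : ∀ n, IsTestFunction Ω (fun x => ((χ n x : ℝ) : ℂ)) := fun n =>
    (hχ n).clm Complex.ofRealCLM
  have hdc : ∀ n i x, partialDeriv i (fun x => ((χ n x : ℝ) : ℂ)) x = ((partialDeriv i (χ n) x : ℝ) : ℂ) :=
    fun n i x => congrFun (partialDeriv_clm (hχ n).contDiff Complex.ofRealCLM i) x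
  -- The Laplacians of the approximants `φ n` are not controlled. The gradient pairing of χ with `φ
  -- n` therefore differs from −⟨χ, Δu⟩ by pairings with `d i` minus the gradient of `φ n`, which
  -- `err n` bounds.
  set err : ℕ → ℝ := fun n => ∑ i, ‖((hc n).partialDeriv i).toL2‖ *
    ‖d i - ((hφ n).partialDeriv i).toL2‖ with herr
  have herr0 : Tendsto err atTop (𝓝 0) := by
    rw [show (0 : ℝ) = ∑ i : Fin 3, (0 : ℝ) by simp]
    refine tendsto_finsetSum _ fun i _ => ?_
    obtain ⟨A₁, hA₁0, hA₁⟩ := exists_bound_on_bounded hb (contDiff_partialDeriv hθ i).continuous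
    obtain ⟨A₂, hA₂0, hA₂⟩ := exists_bound_on_bounded hb hθ.continuous
    -- For fixed τ the bound 1/τ on β'' keeps the gradients of the test functions bounded in L², so
    -- `err` tends to 0.
    have hbd : ∀ n, ‖((hc n).partialDeriv i).toL2‖ ≤
        ‖((memLp_const (A₁ : ℂ)).toLp (fun _ => (A₁ : ℂ)) : L2 Ω)‖
          + (A₂ / τ) * ‖((hφ n).partialDeriv i).toL2‖ := by
      intro n
      simp only [IsTestFunction.toL2, Lp.norm_toLp]
      have e1 : eLpNorm (partialDeriv i (fun x => ((χ n x : ℝ) : ℂ))) 2 (vol Ω)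
          ≤ eLpNorm (fun _ : E3 => (A₁ : ℂ)) 2 (vol Ω)
            + eLpNorm (fun x => ((A₂ / τ : ℝ) : ℂ) * partialDeriv i (φ n) x) 2 (vol Ω) := by
        have e3 : eLpNorm (partialDeriv i (fun x => ((χ n x : ℝ) : ℂ))) 2 (vol Ω)
            ≤ eLpNorm ((fun x => ‖(A₁ : ℂ)‖) +
              fun x => ‖((A₂ / τ : ℝ) : ℂ) * partialDeriv i (φ n) x‖) 2 (vol Ω) := by
          refine eLpNorm_mono_ae ?_
          filter_upwards [ae_restrict_mem hΩ.measurableSet] with x hx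
          have er : ‖((fun _ : E3 => ‖(A₁ : ℂ)‖) +
              (fun x : E3 => ‖((A₂ / τ : ℝ) : ℂ) * partialDeriv i (φ n) x‖) : E3 → ℝ) x‖
              = A₁ + A₂ / τ * ‖partialDeriv i (φ n) x‖ := by
            rw [Pi.add_apply, Real.norm_of_nonneg (by positivity), norm_mul, Complex.norm_real,
              Complex.norm_real, Real.norm_of_nonneg hA₁0,
              Real.norm_of_nonneg (show 0 ≤ A₂ / τ by positivity)]
          rw [er, hdc, hdχ, Complex.norm_real, Real.norm_eq_abs, hda]
          refine (abs_add_le _ _).trans (add_le_add ?_ ?_)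
          · rw [abs_mul]
            exact (mul_le_mul (hA₁ x hx) (abs_div_sqrt_le_one _) (abs_nonneg _) hA₁0).trans
              (by rw [mul_one])
          · rw [abs_mul, abs_mul, abs_of_nonneg (hβ''0 _), div_eq_mul_one_div, mul_assoc]
            have := sq_div_sqrt_cube_le hτ (a n x)
            exact mul_le_mul (hA₂ x hx) (mul_le_mul this (Complex.abs_re_le_norm _)
              (abs_nonneg _) (by positivity)) (mul_nonneg (hβ''0 _) (abs_nonneg _)) hA₂0
        refine e3.trans ((eLpNorm_add_le aestronglyMeasurable_const ?_ one_le_two).trans ?_)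
        · exact (((hφ n).partialDeriv i).continuous.const_mul _).norm.aestronglyMeasurable
        · rw [eLpNorm_norm (fun x => ((A₂ / τ : ℝ) : ℂ) * partialDeriv i (φ n) x)]
          exact add_le_add (le_of_eq (eLpNorm_norm (fun _ : E3 => (A₁ : ℂ)))) le_rfl
      have e2 : eLpNorm (fun x => ((A₂ / τ : ℝ) : ℂ) * partialDeriv i (φ n) x) 2 (vol Ω)
          = ENNReal.ofReal (A₂ / τ) * eLpNorm (partialDeriv i (φ n)) 2 (vol Ω) := by
        have := eLpNorm_const_smul (((A₂ / τ : ℝ) : ℂ)) (partialDeriv i (φ n)) 2 (vol Ω)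
        rw [show (fun x => ((A₂ / τ : ℝ) : ℂ) * partialDeriv i (φ n) x)
          = (((A₂ / τ : ℝ) : ℂ)) • partialDeriv i (φ n) from rfl, this, ← ofReal_norm,
          Complex.norm_real, Real.norm_of_nonneg (by positivity)]
      rw [e2] at e1
      have f1 : eLpNorm (fun _ : E3 => (A₁ : ℂ)) 2 (vol Ω) ≠ ⊤ := (memLp_const (A₁ : ℂ)).2.ne
      have f2 := (((hφ n).partialDeriv i).memLp 2).2.ne
      refine (ENNReal.toReal_mono (by finiteness) e1).trans (le_of_eq ?_)
      rw [ENNReal.toReal_add f1 (by finiteness), ENNReal.toReal_mul,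
        ENNReal.toReal_ofReal (by positivity)]
    have hlim1 : Tendsto (fun n => ‖d i - ((hφ n).partialDeriv i).toL2‖) atTop (𝓝 0) := by
      have := (tendsto_const_nhds (x := d i)).sub (h2 i)
      simpa using this.norm
    have hlim2 := ((((h2 i).norm).const_mul (A₂ / τ)).const_add
      ‖((memLp_const (A₁ : ℂ)).toLp (fun _ => (A₁ : ℂ)) : L2 Ω)‖).mul hlim1
    rw [mul_zero] at hlim2
    exact squeeze_zero (fun n => by positivity)
      (fun n => mul_le_mul_of_nonneg_right (hbd n) (norm_nonneg _)) hlim2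
  have key : ∀ n, ∫ x in Ω, -(∑ i, partialDeriv i (partialDeriv i θ) x) * β (a n x)
      ≤ (∫ x in Ω, θ x * ‖(∑ i, w i : L2 Ω) x‖) + err n := by
    intro n
    have hre : ∀ i, (inner ℂ ((hc n).partialDeriv i).toL2 ((hφ n).partialDeriv i).toL2).re
        = ∫ x in Ω, partialDeriv i (χ n) x * partialDeriv i (a n) x := by
      intro i
      have hint : Integrable (fun x => inner ℂ (((hc n).partialDeriv i).toL2 x)
        (((hφ n).partialDeriv i).toL2 x)) (vol Ω) := L2.integrable_inner _ _
      rw [L2.inner_def, ← RCLike.re_eq_complex_re, ← integral_re hint]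
      refine integral_congr_ae ?_
      filter_upwards [(((hφ n).partialDeriv i).memLp 2).coeFn_toLp,
        (((hc n).partialDeriv i).memLp 2).coeFn_toLp] with x e1 e2
      rw [IsTestFunction.toL2, IsTestFunction.toL2, e1, e2, hdc, hda]
      simp [mul_comm]
    have hmul : ∀ {f g : E3 → ℝ}, ContDiff ℝ ∞ f → IsTestFunction Ω g →
        Integrable (fun x => f x * g x) (vol Ω) := fun {f g} hf hg =>
      ((hf.continuous.mul hg.continuous).integrable_of_hasCompactSupport
        hg.hasCompactSupport.mul_left).integrableOn
    -- Convexity enters here: θ β''(a) (∂ᵢa)² is nonnegative and is dropped. What is left is ∂ᵢθ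
    -- ∂ᵢβ(a), and both derivatives are moved onto θ because β(a) has compact support in Ω.
    have hge : ∀ i, ∫ x in Ω, -(partialDeriv i (partialDeriv i θ) x) * β (a n x) ≤
        ∫ x in Ω, partialDeriv i (χ n) x * partialDeriv i (a n) x := by
      intro i
      simp only [neg_mul]
      rw [integral_neg, ← integral_partialDeriv_mul_eq_neg (contDiff_partialDeriv hθ i) (hb' n)]
      refine integral_mono (hmul (contDiff_partialDeriv hθ i) ((hb' n).partialDeriv i))
        (hmul ((hχ n).partialDeriv i).contDiff ((ha n).partialDeriv i)) fun x => ?_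
      simp only
      rw [partialDeriv_comp (ha n).contDiff (hasDerivAt_sqrt_sq_add hτ), hdχ]
      have := mul_nonneg (mul_nonneg (hθ0 x) (hβ''0 (a n x))) (sq_nonneg (partialDeriv i (a n) x))
      nlinarith
    have hsum : ∑ i, inner ℂ ((hc n).partialDeriv i).toL2 ((hφ n).partialDeriv i).toL2
        = - inner ℂ (hc n).toL2 (∑ i, w i)
          - ∑ i, inner ℂ ((hc n).partialDeriv i).toL2 (d i - ((hφ n).partialDeriv i).toL2) := by
      rw [inner_sum]
      simp only [inner_sub_right, Finset.sum_sub_distrib]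
      rw [Finset.sum_congr rfl fun i _ => (hw i).inner_toL2 (hc n), Finset.sum_neg_distrib]
      ring
    have h3 : ∫ x in Ω, -(∑ i, partialDeriv i (partialDeriv i θ) x) * β (a n x)
        = ∑ i, ∫ x in Ω, -(partialDeriv i (partialDeriv i θ) x) * β (a n x) := by
      rw [← integral_finsetSum _ fun i _ =>
        hmul (contDiff_partialDeriv (contDiff_partialDeriv hθ i) i).neg (hb' n)]
      simp only [← Finset.sum_mul, Finset.sum_neg_distrib]
    have h4 : ‖inner ℂ (hc n).toL2 (∑ i, w i)‖ ≤ ∫ x in Ω, θ x * ‖(∑ i, w i : L2 Ω) x‖ := by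
      rw [L2.inner_def]
      obtain ⟨A₂, hA₂0, hA₂⟩ := exists_bound_on_bounded hb hθ.continuous
      refine norm_integral_le_of_norm_le ?_ ?_
      · refine Integrable.mono' (((Lp.memLp (∑ i, w i : L2 Ω)).integrable one_le_two).norm.const_mul A₂)
          (hθ.continuous.aestronglyMeasurable.mul (Lp.aestronglyMeasurable _).norm) ?_
        filter_upwards [ae_restrict_mem hΩ.measurableSet] with x hx
        rw [norm_mul, norm_norm]
        exact mul_le_mul_of_nonneg_right (hA₂ x hx) (norm_nonneg _)
      · filter_upwards [((hc n).memLp 2).coeFn_toLp] with x e1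
        rw [IsTestFunction.toL2, e1]
        refine (norm_inner_le_norm _ _).trans ?_
        refine mul_le_mul_of_nonneg_right ?_ (norm_nonneg _)
        rw [Complex.norm_real, Real.norm_eq_abs, abs_mul, abs_of_nonneg (hθ0 x)]
        exact (mul_le_mul_of_nonneg_left (abs_div_sqrt_le_one _) (hθ0 x)).trans (by rw [mul_one])
    have h5 : ‖∑ i, inner ℂ ((hc n).partialDeriv i).toL2 (d i - ((hφ n).partialDeriv i).toL2)‖
        ≤ err n := (norm_sum_le _ _).trans (Finset.sum_le_sum fun i _ => norm_inner_le_norm _ _)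
    rw [h3]
    refine (Finset.sum_le_sum fun i _ => hge i).trans ?_
    rw [← Finset.sum_congr rfl fun i _ => hre i, ← Complex.re_sum, hsum, Complex.sub_re,
      Complex.neg_re]
    have a1 := neg_le_of_abs_le ((Complex.abs_re_le_norm _).trans h4)
    have a2 := neg_le_of_abs_le ((Complex.abs_re_le_norm _).trans h5)
    linarith
  have hcont : Continuous fun x => -(∑ i, partialDeriv i (partialDeriv i θ) x) :=
    (continuous_finsetSum _ fun i _ =>
      (contDiff_partialDeriv (contDiff_partialDeriv hθ i) i).continuous).neg
  obtain ⟨A, hA0, hA⟩ := exists_bound_on_bounded hb hcont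
  have hβL : ∀ {v : E3 → ℂ}, MemLp v 2 (vol Ω) → Integrable (fun x =>
      -(∑ i, partialDeriv i (partialDeriv i θ) x) * β (v x).re) (vol Ω) := by
    intro v hv
    refine Integrable.mono' ((hv.integrable one_le_two).norm.const_mul A)
      (hcont.aestronglyMeasurable.mul ((hsm.continuous.sub continuous_const).comp_aestronglyMeasurable
        (Complex.continuous_re.comp_aestronglyMeasurable hv.1))) ?_
    filter_upwards [ae_restrict_mem hΩ.measurableSet] with x hx
    rw [norm_mul]
    refine mul_le_mul (hA x hx) ?_ (norm_nonneg _) hA0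
    have := abs_sqrt_sub_sqrt_le hτ (v x).re 0
    rw [Real.norm_eq_abs]
    simp only [ne_eq, OfNat.ofNat_ne_zero, not_false_eq_true, zero_pow, zero_add,
      Real.sqrt_sq hτ.le, sub_self, sub_zero] at this
    exact this.trans (Complex.abs_re_le_norm _)
  have hL1 : Tendsto (fun n => ∫ x in Ω, -(∑ i, partialDeriv i (partialDeriv i θ) x) * β (a n x))
      atTop (𝓝 (∫ x in Ω, -(∑ i, partialDeriv i (partialDeriv i θ) x) * β (u x).re)) := by
    have hu1 : Tendsto (fun n => eLpNorm (fun x => φ n x - u x) 2 (vol Ω)) atTop (𝓝 0) := by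
      have := (Lp.tendsto_Lp_iff_tendsto_eLpNorm' _ _).1 h1
      refine this.congr fun n => eLpNorm_congr_ae ?_
      filter_upwards [((hφ n).memLp 2).coeFn_toLp] with x hx
      rw [Pi.sub_apply, IsTestFunction.toL2, hx]
    refine tendsto_integral_of_L1' _ (hβL (Lp.memLp u)).aestronglyMeasurable (Eventually.of_forall fun n =>
      hβL ((hφ n).memLp 2)) ?_
    have hle : ∀ n, eLpNorm ((fun x => -(∑ i, partialDeriv i (partialDeriv i θ) x) * β (a n x))
        - fun x => -(∑ i, partialDeriv i (partialDeriv i θ) x) * β (u x).re) 1 (vol Ω)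
        ≤ ENNReal.ofReal A * (eLpNorm (fun x => φ n x - u x) 2 (vol Ω)
          * (vol Ω) univ ^ (1 / (1 : ℝ≥0∞).toReal - 1 / (2 : ℝ≥0∞).toReal)) := by
      intro n
      have e1 := eLpNorm_le_mul_eLpNorm_of_ae_le_mul (μ := vol Ω) (p := 1) (c := A)
        (f := (fun x => -(∑ i, partialDeriv i (partialDeriv i θ) x) * β (a n x))
          - fun x => -(∑ i, partialDeriv i (partialDeriv i θ) x) * β (u x).re)
        (g := fun x => φ n x - u x) (by
          filter_upwards [ae_restrict_mem hΩ.measurableSet] with x hx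
          rw [Pi.sub_apply, ← mul_sub, norm_mul]
          refine mul_le_mul (hA x hx) ?_ (norm_nonneg _) hA0
          refine (abs_sqrt_sub_sqrt_le hτ _ _).trans ?_
          rw [← Complex.sub_re]
          exact Complex.abs_re_le_norm _)
      refine e1.trans (mul_le_mul' le_rfl ?_)
      exact eLpNorm_le_eLpNorm_mul_rpow_measure_univ one_le_two
        (((hφ n).continuous.aestronglyMeasurable).sub (Lp.aestronglyMeasurable u))
    have hz : Tendsto (fun n => ENNReal.ofReal A * (eLpNorm (fun x => φ n x - u x) 2 (vol Ω)
          * (vol Ω) univ ^ (1 / (1 : ℝ≥0∞).toReal - 1 / (2 : ℝ≥0∞).toReal))) atTop (𝓝 0) := by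
      have hfin : (vol Ω) univ ^ (1 / (1 : ℝ≥0∞).toReal - 1 / (2 : ℝ≥0∞).toReal) ≠ ⊤ :=
        ENNReal.rpow_ne_top_of_nonneg (by norm_num) (measure_ne_top _ _)
      have := ENNReal.Tendsto.const_mul (a := ENNReal.ofReal A)
        (ENNReal.Tendsto.mul_const hu1 (Or.inr hfin)) (Or.inr ENNReal.ofReal_ne_top)
      simpa using this
    exact tendsto_of_tendsto_of_tendsto_of_le_of_le tendsto_const_nhds hz
      (fun _ => bot_le) hle
  have hlim := (tendsto_const_nhds (x := ∫ x in Ω, θ x * ‖(∑ i, w i : L2 Ω) x‖)).add herr0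
  rw [add_zero] at hlim
  exact le_of_tendsto_of_tendsto' hL1 hlim key

end Hartree
end


/-! ### The radial comparison function and its Laplacian. -/

noncomputable section

namespace Hartree

variable {Ω : Set E3}

section Radial

variable {lam η : ℝ}

/-- The profile `q ↦ e^{-λ q} / √(q + η²)`. -/
def profile (lam η q : ℝ) : ℝ := Real.exp (-(lam * q)) / √(q + η ^ 2)

theorem hasDerivAt_profile {q : ℝ} (hq : 0 < q + η ^ 2) :
    HasDerivAt (profile lam η) (Real.exp (-(lam * q)) *
      (-(lam / √(q + η ^ 2)) - 1 / (2 * √(q + η ^ 2) ^ 3))) q := by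
  have hs : 0 < √(q + η ^ 2) := Real.sqrt_pos.2 hq
  have h1 : HasDerivAt (fun q => √(q + η ^ 2)) (1 / (2 * √(q + η ^ 2))) q :=
    ((hasDerivAt_id q).add_const _).sqrt hq.ne'
  have h2 : HasDerivAt (fun q => Real.exp (-(lam * q))) (Real.exp (-(lam * q)) * (-(lam * 1))) q :=
    (((hasDerivAt_id q).const_mul lam).neg).exp
  refine (h2.div h1 hs.ne').congr_deriv ?_
  field_simp

theorem hasDerivAt_deriv_profile {q : ℝ} (hq : 0 < q + η ^ 2) :
    HasDerivAt (fun q => Real.exp (-(lam * q)) *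
      (-(lam / √(q + η ^ 2)) - 1 / (2 * √(q + η ^ 2) ^ 3)))
      (Real.exp (-(lam * q)) * (lam ^ 2 / √(q + η ^ 2) + lam / √(q + η ^ 2) ^ 3
        + 3 / (4 * √(q + η ^ 2) ^ 5))) q := by
  have hs : 0 < √(q + η ^ 2) := Real.sqrt_pos.2 hq
  have h1 : HasDerivAt (fun q => √(q + η ^ 2)) (1 / (2 * √(q + η ^ 2))) q :=
    ((hasDerivAt_id q).add_const _).sqrt hq.ne'
  have h2 : HasDerivAt (fun q => Real.exp (-(lam * q))) (Real.exp (-(lam * q)) * (-(lam * 1))) q :=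
    (((hasDerivAt_id q).const_mul lam).neg).exp
  have h3 := (hasDerivAt_const q lam).div h1 hs.ne'
  have h4 := (hasDerivAt_const q (1 : ℝ)).div ((h1.pow 3).const_mul 2)
    (by simpa using hs.ne')
  refine (h2.mul (h3.neg.sub h4)).congr_deriv ?_
  simp only [Pi.neg_apply, Pi.sub_apply, Pi.div_apply, Pi.pow_apply]
  field_simp
  ring

theorem partialDeriv_comp_norm_sq {H : ℝ → ℝ} {x₀ x : E3} {H' : ℝ}
    (h : HasDerivAt H H' (‖x - x₀‖ ^ 2)) (i : Fin 3) :
    partialDeriv i (fun x => H (‖x - x₀‖ ^ 2)) x = H' * (2 * (x i - x₀ i)) := by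
  have h1 : HasFDerivAt (fun x : E3 => ‖x - x₀‖ ^ 2) (2 • (innerSL ℝ (x - x₀))) x := by
    have := ((hasFDerivAt_id x).sub_const x₀).norm_sq
    simpa using this
  have := h.comp_hasFDerivAt x h1
  simp only [partialDeriv]
  rw [show (fun x => H (‖x - x₀‖ ^ 2)) = H ∘ fun x => ‖x - x₀‖ ^ 2 from rfl, this.fderiv]
  simp [EuclideanSpace.inner_single_right]

theorem contDiff_profile (hη : 0 < η) (x₀ : E3) :
    ContDiff ℝ ∞ fun x : E3 => profile lam η (‖x - x₀‖ ^ 2) := by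
  have h1 : ContDiff ℝ ∞ fun x : E3 => ‖x - x₀‖ ^ 2 := (contDiff_id.sub contDiff_const).norm_sq ℝ
  exact ((h1.const_smul lam).neg.exp).div ((h1.add contDiff_const).sqrt fun x => by positivity)
    fun x => by positivity

/-- For λ ≥ 0 only the last term is negative, and it stays bounded on bounded sets as η → 0. The
term with the fifth power is, up to normalisation and the Gaussian factor, an approximate identity
at x₀. -/
theorem neg_laplacian_profile (hη : 0 < η) (x₀ x : E3) :
    -(∑ i, partialDeriv i (partialDeriv i fun x => profile lam η (‖x - x₀‖ ^ 2)) x)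
      = Real.exp (-(lam * ‖x - x₀‖ ^ 2)) * (3 * η ^ 2 / √(‖x - x₀‖ ^ 2 + η ^ 2) ^ 5
        + 4 * lam * η ^ 2 / √(‖x - x₀‖ ^ 2 + η ^ 2) ^ 3 + 2 * lam / √(‖x - x₀‖ ^ 2 + η ^ 2)
        - 4 * lam ^ 2 * ‖x - x₀‖ ^ 2 / √(‖x - x₀‖ ^ 2 + η ^ 2)) := by
  have hpos : ∀ x : E3, 0 < ‖x - x₀‖ ^ 2 + η ^ 2 := fun x => by positivity
  set H1 : ℝ → ℝ := fun q => Real.exp (-(lam * q)) *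
      (-(lam / √(q + η ^ 2)) - 1 / (2 * √(q + η ^ 2) ^ 3)) with hH1
  set H2 : ℝ → ℝ := fun q => Real.exp (-(lam * q)) * (lam ^ 2 / √(q + η ^ 2) + lam / √(q + η ^ 2) ^ 3
        + 3 / (4 * √(q + η ^ 2) ^ 5)) with hH2
  have e1 : ∀ i, partialDeriv i (fun x => profile lam η (‖x - x₀‖ ^ 2))
      = fun x => H1 (‖x - x₀‖ ^ 2) * (2 * (x i - x₀ i)) := fun i => by
    ext y; exact partialDeriv_comp_norm_sq (hasDerivAt_profile (hpos y)) i
  have e2 : ∀ i, partialDeriv i (partialDeriv i fun x => profile lam η (‖x - x₀‖ ^ 2)) x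
      = 4 * H2 (‖x - x₀‖ ^ 2) * (x i - x₀ i) ^ 2 + 2 * H1 (‖x - x₀‖ ^ 2) := fun i => by
    rw [e1]
    have hH : HasDerivAt H1 (H2 (‖x - x₀‖ ^ 2)) (‖x - x₀‖ ^ 2) := hasDerivAt_deriv_profile (hpos x)
    have h1 : HasFDerivAt (fun x : E3 => ‖x - x₀‖ ^ 2) (2 • (innerSL ℝ (x - x₀))) x := by
      have := ((hasFDerivAt_id x).sub_const x₀).norm_sq
      simpa using this
    have h2 : HasFDerivAt (fun x : E3 => 2 * (x i - x₀ i))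
        ((2 : ℝ) • (EuclideanSpace.proj i : E3 →L[ℝ] ℝ)) x :=
      (((EuclideanSpace.proj i : E3 →L[ℝ] ℝ).hasFDerivAt).sub_const _).const_mul 2
    have h3 := (hH.comp_hasFDerivAt x h1).mul h2
    have h4 : (fun x : E3 => H1 (‖x - x₀‖ ^ 2) * (2 * (x i - x₀ i)))
        = (H1 ∘ fun x : E3 => ‖x - x₀‖ ^ 2) * fun x : E3 => 2 * (x i - x₀ i) := rfl
    rw [h4, partialDeriv, h3.fderiv]
    simp [EuclideanSpace.inner_single_right]
    ring
  have hsum : ∑ i, (x i - x₀ i) ^ 2 = ‖x - x₀‖ ^ 2 := by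
    rw [EuclideanSpace.real_norm_sq_eq]; simp
  rw [Finset.sum_congr rfl fun i _ => e2 i, Finset.sum_add_distrib, ← Finset.mul_sum, hsum]
  simp only [Finset.sum_const, Finset.card_univ, Fintype.card_fin, nsmul_eq_mul, hH1, hH2]
  set q := ‖x - x₀‖ ^ 2
  have hs : 0 < √(q + η ^ 2) := Real.sqrt_pos.2 (hpos x)
  have hs2 : √(q + η ^ 2) ^ 2 = q + η ^ 2 := Real.sq_sqrt (hpos x).le
  set s := √(q + η ^ 2)
  have hq : q = s ^ 2 - η ^ 2 := by linarith
  rw [hq]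
  field_simp
  push_cast
  ring

end Radial

end Hartree
end


/-! ### Pointwise bounds for functions in the domain of the Dirichlet Laplacian. -/

noncomputable section

namespace Hartree

variable {Ω : Set E3}

theorem integral_mul_le_sqrt {α : Type*} [MeasurableSpace α] {μ : Measure α} {f g : α → ℝ}
    (hf0 : ∀ x, 0 ≤ f x) (hg0 : ∀ x, 0 ≤ g x) (hf : MemLp f 2 μ) (hg : MemLp g 2 μ) :
    ∫ x, f x * g x ∂μ ≤ √(∫ x, f x ^ 2 ∂μ) * √(∫ x, g x ^ 2 ∂μ) := by
  have := integral_mul_le_Lp_mul_Lq_of_nonneg (μ := μ) Real.HolderConjugate.two_two (f := f) (g := g)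
    (ae_of_all _ hf0) (ae_of_all _ hg0) (by simpa using hf) (by simpa using hg)
  simpa [Real.sqrt_eq_rpow] using this

theorem integrable_norm_sq (u : L2 Ω) : Integrable (fun x => ‖u x‖ ^ 2) (vol Ω) :=
  (Lp.memLp u).integrable_norm_pow two_ne_zero

theorem integral_norm_sq (u : L2 Ω) : ∫ x in Ω, ‖u x‖ ^ 2 = ‖u‖ ^ 2 := by
  rw [integral_eq_lintegral_of_nonneg_ae (ae_of_all _ fun _ => by positivity)
    (integrable_norm_sq u).aestronglyMeasurable]
  have : ∀ x, ENNReal.ofReal (‖u x‖ ^ 2) = ‖u x‖ₑ ^ 2 := fun x => by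
    rw [ENNReal.ofReal_pow (norm_nonneg _), ofReal_norm]
  simp only [this]
  rw [lintegral_enorm_sq_eq, ENNReal.toReal_ofReal (by positivity)]

theorem integral_mul_norm_le {f : E3 → ℝ} (hf0 : ∀ x, 0 ≤ f x) (hf : MemLp f 2 (vol Ω)) (u : L2 Ω) :
    ∫ x in Ω, f x * ‖u x‖ ≤ √(∫ x in Ω, f x ^ 2) * ‖u‖ := by
  have := integral_mul_le_sqrt hf0 (fun x => norm_nonneg (u x)) hf (Lp.memLp u).norm
  rwa [integral_norm_sq, Real.sqrt_sq (norm_nonneg _)] at this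

theorem integral_norm_le [IsFiniteMeasure (vol Ω)] (u : L2 Ω) :
    ∫ x in Ω, ‖u x‖ ≤ √((vol Ω).real univ) * ‖u‖ := by
  have := integral_mul_norm_le (f := fun _ => (1 : ℝ)) (fun _ => zero_le_one) (memLp_const 1) u
  simpa using this

/-- The square of the limit profile `e^{-λ |z|²} / |z|`. -/
def limitProfileSq (lam : ℝ) (z : E3) : ℝ := Real.exp (-(2 * lam * ‖z‖ ^ 2)) * ‖z‖ ^ (-2 : ℝ)

theorem integrableOn_norm_rpow_neg_two (r : ℝ) :
    IntegrableOn (fun z : E3 => ‖z‖ ^ (-2 : ℝ)) (Metric.ball 0 r) := by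
  refine integrableOn_ball_of_norm_le_rpow (C := 1) (α := 2) (by simp) (by simp; norm_num) ?_
    (by
      have : Measurable fun z : E3 => ‖z‖ ^ (-2 : ℝ) := by fun_prop
      exact this.aestronglyMeasurable)
  refine ae_of_all _ fun x => ?_
  rw [Real.norm_of_nonneg (by positivity), one_mul]

theorem measurable_limitProfileSq (lam : ℝ) : Measurable (limitProfileSq lam) := by
  unfold limitProfileSq; fun_prop

theorem limitProfileSq_le {lam : ℝ} (h : 0 ≤ lam) (z : E3) :
    ‖limitProfileSq lam z‖ ≤ ‖z‖ ^ (-2 : ℝ) := by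
  unfold limitProfileSq
  rw [Real.norm_of_nonneg (by positivity)]
  refine mul_le_of_le_one_left (by positivity) ?_
  rw [Real.exp_le_one_iff]
  have : 0 ≤ 2 * lam * ‖z‖ ^ 2 := by positivity
  linarith

/-- Dominated convergence, with |z|⁻² integrable near 0 in dimension three. The Gaussian factor is
present for the sake of this limit: it makes the coefficient of the Laplacian small. -/
theorem tendsto_integral_limitProfileSq (r : ℝ) :
    Tendsto (fun n : ℕ => ∫ z in Metric.ball 0 r, limitProfileSq n z) atTop (𝓝 0) := by
  have h0 : (0 : ℝ) = ∫ z in Metric.ball (0 : E3) r, (0 : ℝ) := by simp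
  rw [h0]
  refine tendsto_integral_of_dominated_convergence _
    (fun n => (measurable_limitProfileSq n).aestronglyMeasurable)
    (integrableOn_norm_rpow_neg_two r)
    (fun n => ae_of_all _ fun z => limitProfileSq_le (Nat.cast_nonneg n) z) ?_
  have hne : ∀ᵐ z : E3 ∂(volume.restrict (Metric.ball 0 r)), z ≠ 0 :=
    ae_restrict_of_ae (by simp [ae_iff])
  filter_upwards [hne] with z hz
  have hz' : 0 < 2 * ‖z‖ ^ 2 := by positivity
  unfold limitProfileSq
  have : Tendsto (fun n : ℕ => Real.exp (-(2 * (n : ℝ) * ‖z‖ ^ 2))) atTop (𝓝 0) := by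
    refine Real.tendsto_exp_neg_atTop_nhds_zero.comp ?_
    have := (tendsto_natCast_atTop_atTop (R := ℝ)).atTop_mul_const hz'
    refine this.congr fun n => by ring
  simpa using this.mul_const (‖z‖ ^ (-2 : ℝ))

theorem profile_sq_le {lam η : ℝ} {x₀ x : E3} (hx : x ≠ x₀) :
    profile lam η (‖x - x₀‖ ^ 2) ^ 2 ≤ limitProfileSq lam (x - x₀) := by
  have hpos : 0 < ‖x - x₀‖ := norm_pos_iff.2 (sub_ne_zero.2 hx)
  unfold profile limitProfileSq
  rw [div_pow, Real.sq_sqrt (by positivity), ← Real.exp_nat_mul, Real.rpow_neg hpos.le,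
    ← div_eq_mul_inv, Real.rpow_ofNat]
  have e : ((2 : ℕ) : ℝ) * -(lam * ‖x - x₀‖ ^ 2) = -(2 * lam * ‖x - x₀‖ ^ 2) := by push_cast; ring
  rw [e]
  gcongr
  nlinarith [sq_nonneg η]

/-- On the ball of radius η the square root s satisfies s² ≤ 2η², so s⁵ ≤ 6η⁵ and 3η²/s⁵ ≥ 1/(2η³).
The negative term is at most 4λ²R, since ‖x − x₀‖² ≤ R s. -/
theorem neg_laplacian_profile_ge {lam η R : ℝ} (hlam : 0 ≤ lam) (hη : 0 < η) {x₀ x : E3}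
    (hR : ‖x - x₀‖ ≤ R) :
    (Metric.closedBall x₀ η).indicator (fun _ => Real.exp (-(lam * η ^ 2)) / (2 * η ^ 3)) x
        - 4 * lam ^ 2 * R
      ≤ -(∑ i, partialDeriv i (partialDeriv i fun x => profile lam η (‖x - x₀‖ ^ 2)) x) := by
  rw [neg_laplacian_profile hη]
  set q := ‖x - x₀‖ ^ 2 with hq
  have hq0 : 0 ≤ q := by positivity
  have hs : 0 < √(q + η ^ 2) := Real.sqrt_pos.2 (by positivity)
  have hs2 : √(q + η ^ 2) ^ 2 = q + η ^ 2 := Real.sq_sqrt (by positivity)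
  set s := √(q + η ^ 2)
  have hxs : ‖x - x₀‖ ≤ s := Real.le_sqrt_of_sq_le (by rw [hq]; nlinarith [sq_nonneg η])
  have he1 : Real.exp (-(lam * q)) ≤ 1 := by
    rw [Real.exp_le_one_iff]
    have := mul_nonneg hlam hq0
    linarith
  have h1 : Real.exp (-(lam * q)) * (4 * lam ^ 2 * q / s) ≤ 4 * lam ^ 2 * R := by
    have h2 : q / s ≤ R := by
      rw [div_le_iff₀ hs, hq, sq]
      exact mul_le_mul hR hxs (norm_nonneg _) ((norm_nonneg _).trans hR)
    have h3 : 4 * lam ^ 2 * q / s ≤ 4 * lam ^ 2 * R := by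
      rw [mul_div_assoc]; gcongr
    exact (mul_le_of_le_one_left (by positivity) he1).trans h3
  have h2 : (Metric.closedBall x₀ η).indicator (fun _ => Real.exp (-(lam * η ^ 2)) / (2 * η ^ 3)) x
      ≤ Real.exp (-(lam * q)) * (3 * η ^ 2 / s ^ 5) := by
    by_cases hx : x ∈ Metric.closedBall x₀ η
    · rw [indicator_of_mem hx]
      rw [Metric.mem_closedBall, dist_eq_norm] at hx
      have hqη : q ≤ η ^ 2 := by rw [hq]; gcongr
      have hs5 : s ^ 5 ≤ 6 * η ^ 5 := by
        refine (pow_le_pow_iff_left₀ (by positivity) (by positivity) two_ne_zero).1 ?_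
        calc (s ^ 5) ^ 2 = (s ^ 2) ^ 5 := by ring
          _ ≤ (2 * η ^ 2) ^ 5 := by rw [hs2]; gcongr; linarith
          _ ≤ (6 * η ^ 5) ^ 2 := by nlinarith [pow_pos hη 10]
      rw [div_eq_mul_one_div]
      refine mul_le_mul (Real.exp_le_exp.2 (by nlinarith)) ?_ (by positivity) (Real.exp_pos _).le
      rw [div_le_div_iff₀ (by positivity) (by positivity)]
      nlinarith
    · rw [indicator_of_notMem hx]; positivity
  have h3 : 0 ≤ Real.exp (-(lam * q)) * (4 * lam * η ^ 2 / s ^ 3 + 2 * lam / s) := by positivity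
  nlinarith

theorem abs_sub_le_sqrt {τ : ℝ} (s : ℝ) : |s| - τ ≤ √(s ^ 2 + τ ^ 2) - τ := by
  have : |s| ≤ √(s ^ 2 + τ ^ 2) := Real.abs_le_sqrt (by nlinarith [sq_nonneg τ])
  linarith

theorem sqrt_sub_le_abs {τ : ℝ} (hτ : 0 ≤ τ) (s : ℝ) : √(s ^ 2 + τ ^ 2) - τ ≤ |s| := by
  have : √(s ^ 2 + τ ^ 2) ≤ |s| + τ := by
    refine Real.sqrt_le_iff.2 ⟨by positivity, ?_⟩
    rw [add_sq, sq_abs]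
    have := mul_nonneg (abs_nonneg s) hτ
    linarith
  linarith

/-- The ball means of `|Re u|` are bounded in terms of `Δu` and `u`. -/
theorem DirGradLap.integral_closedBall_le (hΩ : IsOpen Ω) (hb : Bornology.IsBounded Ω) {R : ℝ}
    (hR : ∀ x ∈ Ω, ∀ y ∈ Ω, ‖x - y‖ < R) {lam : ℝ} (hlam : 0 ≤ lam) {u l : L2 Ω}
    {d : Fin 3 → L2 Ω} (h : DirGradLap Ω u d l) {x₀ : E3} (hx₀ : x₀ ∈ Ω) {η : ℝ} (hη : 0 < η)
    (hB : Metric.closedBall x₀ η ⊆ Ω) :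
    Real.exp (-(lam * η ^ 2)) / (2 * η ^ 3) * ∫ x in Metric.closedBall x₀ η, |(u x).re|
      ≤ √(∫ z in Metric.ball 0 R, limitProfileSq lam z) * ‖l‖
        + 4 * lam ^ 2 * R * (√((vol Ω).real univ) * ‖u‖) := by
  have : Fact (Bornology.IsBounded Ω) := ⟨hb⟩
  set θ : E3 → ℝ := fun x => profile lam η (‖x - x₀‖ ^ 2) with hθ
  have hθs : ContDiff ℝ ∞ θ := contDiff_profile hη x₀
  have hθ0 : ∀ x, 0 ≤ θ x := fun x => by simp only [hθ, profile]; positivity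
  set P := Real.exp (-(lam * η ^ 2)) / (2 * η ^ 3)
  have hP : 0 ≤ P := by positivity
  set B := Metric.closedBall x₀ η
  have hR0 : 0 < R := by simpa using hR x₀ hx₀ x₀ hx₀
  have hui : Integrable (fun x => ‖u x‖) (vol Ω) := ((Lp.memLp u).integrable one_le_two).norm
  have hrei : Integrable (fun x => |(u x).re|) (vol Ω) :=
    ((Lp.memLp u).integrable one_le_two).re.abs
  -- the right hand side
  have hrhs : ∫ x in Ω, θ x * ‖l x‖ ≤ √(∫ z in Metric.ball 0 R, limitProfileSq lam z) * ‖l‖ := by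
    obtain ⟨A, -, hA⟩ := exists_bound_on_bounded hb hθs.continuous
    have hm : MemLp θ 2 (vol Ω) := MemLp.of_bound hθs.continuous.aestronglyMeasurable A (by
      filter_upwards [ae_restrict_mem hΩ.measurableSet] with x hx using hA x hx)
    refine (integral_mul_norm_le hθ0 hm l).trans
      (mul_le_mul_of_nonneg_right (Real.sqrt_le_sqrt ?_) (norm_nonneg _))
    have hG : Integrable ((Metric.ball 0 R).indicator (limitProfileSq lam)) :=
      (integrable_indicator_iff Metric.isOpen_ball.measurableSet).2
        ((integrableOn_norm_rpow_neg_two R).mono' (measurable_limitProfileSq lam).aestronglyMeasurable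
          (ae_of_all _ fun z => limitProfileSq_le hlam z))
    have hne : ∀ᵐ x ∂(vol Ω), x ≠ x₀ := ae_restrict_of_ae (by simp [ae_iff])
    calc ∫ x in Ω, θ x ^ 2
        ≤ ∫ x in Ω, (Metric.ball 0 R).indicator (limitProfileSq lam) (x - x₀) := by
          refine integral_mono_ae hm.integrable_sq (hG.comp_sub_right x₀).integrableOn ?_
          filter_upwards [hne, ae_restrict_mem hΩ.measurableSet] with x hx hxΩ
          rw [indicator_of_mem (by simpa using hR x hxΩ x₀ hx₀)]
          exact profile_sq_le hx
      _ ≤ ∫ x, (Metric.ball 0 R).indicator (limitProfileSq lam) (x - x₀) :=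
          setIntegral_le_integral (hG.comp_sub_right x₀) (ae_of_all _ fun x =>
            indicator_nonneg (fun z _ => by unfold limitProfileSq; positivity) _)
      _ = ∫ z in Metric.ball 0 R, limitProfileSq lam z := by
          rw [integral_sub_right_eq_self, integral_indicator Metric.isOpen_ball.measurableSet]
  -- Replacing |s| by its smoothing costs τ times the mass of the lower bound on the ball; for fixed
  -- η this vanishes as τ → 0.
  have hτ : ∀ τ : ℝ, 0 < τ → P * ∫ x in B, |(u x).re| ≤
      √(∫ z in Metric.ball 0 R, limitProfileSq lam z) * ‖l‖
        + 4 * lam ^ 2 * R * (√((vol Ω).real univ) * ‖u‖) + τ * (P * volume.real B) := by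
    intro τ hτ
    have hk := (h.kato hΩ hb hθs hθ0 hτ).trans hrhs
    have hBm : MeasurableSet B := Metric.isClosed_closedBall.measurableSet
    have hBi : IntegrableOn (fun x => |(u x).re| - τ) B (vol Ω) :=
      (hrei.sub (integrable_const τ)).integrableOn
    have hlow : ∫ x in Ω, (B.indicator (fun x => P * (|(u x).re| - τ)) x - 4 * lam ^ 2 * R * ‖u x‖)
        ≤ ∫ x in Ω, -(∑ i, partialDeriv i (partialDeriv i θ) x) * (√((u x).re ^ 2 + τ ^ 2) - τ) := by
      obtain ⟨A, hA0, hA⟩ := exists_bound_on_bounded hb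
        (f := fun x => -(∑ i, partialDeriv i (partialDeriv i θ) x))
        (continuous_finsetSum _ fun i _ =>
          (contDiff_partialDeriv (contDiff_partialDeriv hθs i) i).continuous).neg
      have hβ0 : ∀ s : ℝ, 0 ≤ √(s ^ 2 + τ ^ 2) - τ := fun s => by
        have : τ ≤ √(s ^ 2 + τ ^ 2) := Real.le_sqrt_of_sq_le (by nlinarith [sq_nonneg s])
        linarith
      refine integral_mono_ae ?_ ?_ ?_
      · exact (((integrable_indicator_iff hBm).2 (hBi.const_mul P))).sub (hui.const_mul _)
      · refine Integrable.mono' (hrei.const_mul A) ?_ ?_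
        · refine (Continuous.aestronglyMeasurable ?_).mul ?_
          · exact (continuous_finsetSum _ fun i _ =>
              (contDiff_partialDeriv (contDiff_partialDeriv hθs i) i).continuous).neg
          · exact ((contDiff_sqrt_sq_add hτ).continuous.sub continuous_const).comp_aestronglyMeasurable
              (Complex.continuous_re.comp_aestronglyMeasurable (Lp.aestronglyMeasurable u))
        · filter_upwards [ae_restrict_mem hΩ.measurableSet] with x hx
          rw [norm_mul, Real.norm_of_nonneg (hβ0 _)]
          exact mul_le_mul (hA x hx) (sqrt_sub_le_abs hτ.le _) (hβ0 _) hA0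
      · filter_upwards [ae_restrict_mem hΩ.measurableSet] with x hx
        have h1 := neg_laplacian_profile_ge (lam := lam) hlam hη (hR x hx x₀ hx₀).le
        have h2 := mul_le_mul_of_nonneg_right h1 (hβ0 (u x).re)
        refine le_trans ?_ h2
        rw [sub_mul]
        refine sub_le_sub ?_ ?_
        · by_cases hxB : x ∈ B
          · rw [indicator_of_mem hxB, indicator_of_mem hxB]
            exact mul_le_mul_of_nonneg_left (abs_sub_le_sqrt _) hP
          · rw [indicator_of_notMem hxB, indicator_of_notMem hxB, zero_mul]
        · refine mul_le_mul_of_nonneg_left ?_ (by positivity)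
          exact (sqrt_sub_le_abs hτ.le _).trans (Complex.abs_re_le_norm _)
    have hi1 : Integrable (fun x => |(u x).re|) (volume.restrict B) := by
      have := hrei.integrableOn (s := B)
      rwa [IntegrableOn, Measure.restrict_restrict hBm, inter_eq_left.2 hB] at this
    have hi2 : Integrable (fun _ => τ) (volume.restrict B) :=
      integrableOn_const Metric.isBounded_closedBall.measure_lt_top.ne
    rw [integral_sub ((integrable_indicator_iff hBm).2 (hBi.const_mul P)) (hui.const_mul _),
      integral_indicator hBm, Measure.restrict_restrict hBm, inter_eq_left.2 hB,
      integral_const_mul, integral_const_mul, integral_sub hi1 hi2] at hlow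
    simp only [integral_const, smul_eq_mul, measureReal_restrict_apply_univ] at hlow
    have := mul_le_mul_of_nonneg_left (integral_norm_le u) (show 0 ≤ 4 * lam ^ 2 * R by positivity)
    nlinarith
  refine le_of_forall_pos_le_add fun δ hδ => ?_
  have hK : 0 ≤ P * volume.real B := mul_nonneg hP measureReal_nonneg
  refine (hτ (δ / (P * volume.real B + 1)) (by positivity)).trans ?_
  gcongr
  rw [div_mul_eq_mul_div, div_le_iff₀ (by positivity)]
  nlinarith

theorem DirGrad.const_smul {u : L2 Ω} {d : Fin 3 → L2 Ω} (h : DirGrad Ω u d) (c : ℂ) :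
    DirGrad Ω (c • u) (fun i => c • d i) := by
  obtain ⟨φ, hφ, h1, h2⟩ := h
  set L : ℂ →L[ℝ] ℂ := c • ContinuousLinearMap.id ℝ ℂ
  refine ⟨fun n x => L (φ n x), fun n => (hφ n).clm L, ?_, fun i => ?_⟩
  · exact h1.const_smul c
  · refine ((h2 i).const_smul c).congr fun n => ?_
    simp only [IsTestFunction.toL2]
    rw [← MemLp.toLp_const_smul]
    congr 1
    exact (partialDeriv_clm (hφ n).contDiff L i).symm

theorem DirLap.const_smul {u l : L2 Ω} (h : DirLap Ω u l) (c : ℂ) : DirLap Ω (c • u) (c • l) := by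
  obtain ⟨d, h1, w, h2, rfl⟩ := h
  refine ⟨_, h1.const_smul c, fun i => c • w i, fun i => ?_, by rw [Finset.smul_sum]⟩
  have : HasWeakPartial Ω i (fun x => c * d i x) (fun x => c * w i x) := by
    intro φ hφ
    have e : ∀ (a : ℝ) (b : ℂ), a • (c * b) = c * (a • b) := fun a b => by
      simp only [Complex.real_smul]; ring
    simp only [e]
    rw [integral_const_mul, integral_const_mul, h2 i φ hφ, mul_neg]
  exact this.congr (Lp.coeFn_smul c (d i)).symm (Lp.coeFn_smul c (w i)).symm

/-- At a Lebesgue point the averages over shrinking balls converge to the value. The volume (4π/3)η³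
exceeds the 2η³ left by the lower bound on the ball, and the factor e^{λη²} tends to 1. -/
theorem DirLap.ae_abs_re_le (hΩ : IsOpen Ω) (hb : Bornology.IsBounded Ω) {R : ℝ}
    (hR : ∀ x ∈ Ω, ∀ y ∈ Ω, ‖x - y‖ < R) {lam : ℝ} (hlam : 0 ≤ lam) {u l : L2 Ω}
    (h : DirLap Ω u l) : ∀ᵐ x ∂(vol Ω), |(u x).re| ≤
      √(∫ z in Metric.ball 0 R, limitProfileSq lam z) * ‖l‖
        + 4 * lam ^ 2 * R * (√((vol Ω).real univ) * ‖u‖) := by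
  have : Fact (Bornology.IsBounded Ω) := ⟨hb⟩
  obtain ⟨d, h⟩ := h
  set f : E3 → ℝ := Ω.indicator fun x => |(u x).re|
  have hf : Integrable f := (integrable_indicator_iff hΩ.measurableSet).2
    ((Lp.memLp u).integrable one_le_two).re.abs
  rw [ae_restrict_iff' hΩ.measurableSet]
  filter_upwards [IsUnifLocDoublingMeasure.ae_tendsto_average (μ := volume) hf.locallyIntegrable 1]
    with x₀ hx hx₀
  set m := √(∫ z in Metric.ball 0 R, limitProfileSq lam z) * ‖l‖
        + 4 * lam ^ 2 * R * (√((vol Ω).real univ) * ‖u‖)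
  have hR0 : 0 < R := by simpa using hR x₀ hx₀ x₀ hx₀
  have hm : 0 ≤ m := by positivity
  have hlim := hx (l := 𝓝[>] (0 : ℝ)) (fun _ => x₀) id tendsto_id (by
    filter_upwards [self_mem_nhdsWithin] with η hη
    simp [le_of_lt (mem_Ioi.1 hη)])
  rw [show f x₀ = |(u x₀).re| from indicator_of_mem hx₀ _] at hlim
  have hexp : Tendsto (fun η : ℝ => m * Real.exp (lam * η ^ 2)) (𝓝[>] 0) (𝓝 m) := by
    have : ContinuousAt (fun η : ℝ => m * Real.exp (lam * η ^ 2)) 0 := by fun_prop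
    have h2 := this.tendsto.mono_left (nhdsWithin_le_nhds (s := Ioi 0))
    simpa using h2
  refine le_of_tendsto_of_tendsto hlim hexp ?_
  obtain ⟨r, hr, hball⟩ := Metric.isOpen_iff.1 hΩ x₀ hx₀
  filter_upwards [Ioo_mem_nhdsGT hr] with η hη
  have hB : Metric.closedBall x₀ η ⊆ Ω := (Metric.closedBall_subset_ball hη.2).trans hball
  have key := h.integral_closedBall_le hΩ hb hR hlam hx₀ hη.1 hB
  have hfe : ∫ x in Metric.closedBall x₀ η, f x = ∫ x in Metric.closedBall x₀ η, |(u x).re| :=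
    setIntegral_congr_fun Metric.isClosed_closedBall.measurableSet fun x hx =>
      indicator_of_mem (hB hx) _
  have hv : volume.real (Metric.closedBall x₀ η) = η ^ 3 * (Real.pi * 4 / 3) := by
    rw [measureReal_def, EuclideanSpace.volume_closedBall_fin_three, ENNReal.toReal_mul,
      ENNReal.toReal_pow, ENNReal.toReal_ofReal hη.1.le, ENNReal.toReal_ofReal (by positivity)]
  simp only [id]
  rw [setAverage_eq, hfe, hv, smul_eq_mul]
  set J := ∫ x in Metric.closedBall x₀ η, |(u x).re|
  have hJ : 0 ≤ J := integral_nonneg fun _ => abs_nonneg _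
  have hη3 : 0 < η ^ 3 := pow_pos hη.1 3
  rw [Real.exp_neg, inv_eq_one_div, div_div, div_mul_eq_mul_div, one_mul,
    div_le_iff₀ (by positivity)] at key
  rw [inv_mul_le_iff₀ (by positivity)]
  refine key.trans ?_
  have hpi : (2 : ℝ) ≤ Real.pi * 4 / 3 := by linarith [Real.pi_gt_three]
  have := mul_le_mul_of_nonneg_left hpi
    (show 0 ≤ m * Real.exp (lam * η ^ 2) * η ^ 3 by positivity)
  linarith

/-- Functions in the domain of the Dirichlet Laplacian are bounded, with an arbitrarily small
contribution of the Laplacian. -/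
theorem exists_ae_norm_le (hΩ : IsOpen Ω) (hb : Bornology.IsBounded Ω) {ε : ℝ} (hε : 0 < ε) :
    ∃ C : ℝ, 0 ≤ C ∧ ∀ u l : L2 Ω, DirLap Ω u l →
      ∀ᵐ x ∂(vol Ω), ‖u x‖ ≤ ε * ‖l‖ + C * ‖u‖ := by
  obtain ⟨R, hR0, hR⟩ : ∃ R : ℝ, 0 < R ∧ ∀ x ∈ Ω, ∀ y ∈ Ω, ‖x - y‖ < R := by
    obtain ⟨C, hC⟩ := hb.exists_norm_le
    refine ⟨2 * |C| + 1, by positivity, fun x hx y hy => ?_⟩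
    have := norm_sub_le x y
    linarith [hC x hx, hC y hy, le_abs_self C]
  have hlim := (tendsto_integral_limitProfileSq R).sqrt
  rw [Real.sqrt_zero] at hlim
  -- Half of ε is reserved for each of the real and imaginary parts; the latter is the real part of
  -- −iu.
  obtain ⟨n, hn⟩ := (hlim.eventually_le_const (show 0 < ε / 2 by positivity)).exists
  refine ⟨2 * (4 * (n : ℝ) ^ 2 * R * √((vol Ω).real univ)), by positivity, fun u l h => ?_⟩
  have h' := h.const_smul (-Complex.I)
  filter_upwards [h.ae_abs_re_le hΩ hb hR n.cast_nonneg, h'.ae_abs_re_le hΩ hb hR n.cast_nonneg,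
    Lp.coeFn_smul (-Complex.I) u] with x h1 h2 h3
  have hI : ‖-Complex.I‖ = 1 := by simp
  rw [h3, norm_smul, norm_smul, hI, one_mul, one_mul] at h2
  have e : ((-Complex.I • (u : E3 → ℂ)) x).re = (u x).im := by simp
  rw [e] at h2
  have h4 := Complex.norm_le_abs_re_add_abs_im (u x)
  have h5 := mul_le_mul_of_nonneg_right hn (norm_nonneg l)
  linarith

end Hartree
end


/-! ### Self-consistent potentials and the dissipation estimate. -/

noncomputable section

namespace Hartree

variable {Ω : Set E3}

theorem measurable_coe (u : L2 Ω) : Measurable u := (Lp.stronglyMeasurable u).measurable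

theorem lintegral_enorm_mul_le (w : L2 Ω) {g : E3 → ℝ≥0∞} (hg : AEMeasurable g (vol Ω)) {G : ℝ}
    (hG0 : 0 ≤ G) (hG : ∫⁻ x in Ω, g x ^ 2 ≤ ENNReal.ofReal (G ^ 2)) :
    ∫⁻ x in Ω, ‖w x‖ₑ * g x ≤ ENNReal.ofReal (‖w‖ * G) := by
  have h := ENNReal.lintegral_mul_le_Lp_mul_Lq (vol Ω) Real.HolderConjugate.two_two
    (Lp.aestronglyMeasurable w).enorm hg
  simp only [Pi.mul_apply, ENNReal.rpow_ofNat] at h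
  rw [lintegral_enorm_sq_eq] at h
  refine h.trans ((mul_le_mul' le_rfl (ENNReal.rpow_le_rpow hG (by norm_num))).trans (le_of_eq ?_))
  rw [ENNReal.ofReal_rpow_of_nonneg (by positivity) (by norm_num),
    ENNReal.ofReal_rpow_of_nonneg (by positivity) (by norm_num), ← ENNReal.ofReal_mul (by positivity),
    ← Real.sqrt_eq_rpow, ← Real.sqrt_eq_rpow, Real.sqrt_sq (norm_nonneg _), Real.sqrt_sq hG0]

/-- The potential of the density `v²` with respect to the kernels `|f|` and `|f(-·)|` is bounded by
`Q` on `Ω`. -/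
structure PotBound (Ω : Set E3) (f : E3 → ℝ) (v : E3 → ℝ≥0∞) (Q : ℝ) : Prop where
  nonneg : 0 ≤ Q
  left : ∀ x ∈ Ω, ∫⁻ y in Ω, ‖f (x - y)‖ₑ * v y ^ 2 ≤ ENNReal.ofReal Q
  right : ∀ x ∈ Ω, ∫⁻ y in Ω, ‖f (y - x)‖ₑ * v y ^ 2 ≤ ENNReal.ofReal Q

theorem PotBound.add {f : E3 → ℝ} (hf : Measurable f) {v w : E3 → ℝ≥0∞} (hv : Measurable v)
    {Q : ℝ} (h : PotBound Ω f v Q) (k : PotBound Ω f w Q) :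
    PotBound Ω f (fun x => v x + w x) (4 * Q) := by
  have hsq : ∀ a b : ℝ≥0∞, (a + b) ^ 2 ≤ 2 * a ^ 2 + 2 * b ^ 2 := fun a b => by
    have := ENNReal.rpow_add_le_mul_rpow_add_rpow a b (p := 2) (by norm_num)
    simp only [ENNReal.rpow_ofNat] at this
    refine this.trans (le_of_eq ?_)
    norm_num
    ring
  have key : ∀ (g : E3 → E3) (_ : Measurable g),
      ∫⁻ y in Ω, ‖f (g y)‖ₑ * v y ^ 2 ≤ ENNReal.ofReal Q →
      ∫⁻ y in Ω, ‖f (g y)‖ₑ * w y ^ 2 ≤ ENNReal.ofReal Q →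
      ∫⁻ y in Ω, ‖f (g y)‖ₑ * (v y + w y) ^ 2 ≤ ENNReal.ofReal (4 * Q) := by
    intro g hg h1 h2
    have hm : Measurable fun y => ‖f (g y)‖ₑ * v y ^ 2 :=
      (hf.comp hg).enorm.mul (hv.pow_const 2)
    calc ∫⁻ y in Ω, ‖f (g y)‖ₑ * (v y + w y) ^ 2
        ≤ ∫⁻ y in Ω, (2 * (‖f (g y)‖ₑ * v y ^ 2) + 2 * (‖f (g y)‖ₑ * w y ^ 2)) := by
          refine lintegral_mono fun y => ?_
          refine (mul_le_mul' le_rfl (hsq _ _)).trans (le_of_eq ?_)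
          ring
      _ = 2 * (∫⁻ y in Ω, ‖f (g y)‖ₑ * v y ^ 2) + 2 * ∫⁻ y in Ω, ‖f (g y)‖ₑ * w y ^ 2 := by
          rw [lintegral_add_left (hm.const_mul 2), lintegral_const_mul' _ _ (by simp),
            lintegral_const_mul' _ _ (by simp)]
      _ ≤ 2 * ENNReal.ofReal Q + 2 * ENNReal.ofReal Q := by gcongr
      _ = ENNReal.ofReal (4 * Q) := by
          rw [ENNReal.ofReal_mul (by norm_num)]
          norm_num
          ring
  exact ⟨by linarith [h.nonneg], fun x hx => key _ (by fun_prop) (h.left x hx) (k.left x hx),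
    fun x hx => key _ (by fun_prop) (h.right x hx) (k.right x hx)⟩

/-- A Schur test: b(x)v(x)b(y)v(y) ≤ (v(x)b(y))² + (v(y)b(x))², and in each term the variable
carrying v² is integrated first. The bound uses v only through the potential of v², which keeps
pointwise bounds of the solution out of the Grönwall exponent. -/
theorem PotBound.lintegral_form_le (hΩ : IsOpen Ω) {f : E3 → ℝ} (hf : Measurable f)
    {v b : E3 → ℝ≥0∞} (hv : Measurable v) (hb : Measurable b) {Q : ℝ} (h : PotBound Ω f v Q) :
    ∫⁻ x in Ω, b x * v x * ∫⁻ y in Ω, ‖f (x - y)‖ₑ * (b y * v y)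
      ≤ 2 * ENNReal.ofReal Q * ∫⁻ x in Ω, b x ^ 2 := by
  have hmul : ∀ a b : ℝ≥0∞, a * b ≤ a ^ 2 + b ^ 2 := fun a b => by
    rcases le_total a b with h | h
    · exact (mul_le_mul' h le_rfl).trans (by rw [sq b]; exact le_add_self)
    · exact (mul_le_mul' le_rfl h).trans (by rw [sq a]; exact le_self_add)
  have hfm : Measurable fun z : E3 × E3 => ‖f (z.1 - z.2)‖ₑ :=
    (hf.comp (measurable_fst.sub measurable_snd)).enorm
  have m1 : Measurable fun z : E3 × E3 => ‖f (z.1 - z.2)‖ₑ * (v z.1 ^ 2 * b z.2 ^ 2) :=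
    hfm.mul (((hv.comp measurable_fst).pow_const 2).mul ((hb.comp measurable_snd).pow_const 2))
  have e1 : ∫⁻ x in Ω, ∫⁻ y in Ω, ‖f (x - y)‖ₑ * (v x ^ 2 * b y ^ 2)
      ≤ ENNReal.ofReal Q * ∫⁻ x in Ω, b x ^ 2 := by
    rw [lintegral_lintegral_swap m1.aemeasurable, ← lintegral_const_mul _ (hb.pow_const 2)]
    refine setLIntegral_mono' hΩ.measurableSet fun y hy => ?_
    calc ∫⁻ x in Ω, ‖f (x - y)‖ₑ * (v x ^ 2 * b y ^ 2)
        = (∫⁻ x in Ω, ‖f (x - y)‖ₑ * v x ^ 2) * b y ^ 2 := by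
          rw [← lintegral_mul_const _ (by
            exact (hf.comp (measurable_id.sub_const y)).enorm.mul (hv.pow_const 2))]
          simp only [mul_assoc]
      _ ≤ _ := mul_le_mul' (h.right y hy) le_rfl
  have e2 : ∫⁻ x in Ω, ∫⁻ y in Ω, ‖f (x - y)‖ₑ * (v y ^ 2 * b x ^ 2)
      ≤ ENNReal.ofReal Q * ∫⁻ x in Ω, b x ^ 2 := by
    rw [← lintegral_const_mul _ (hb.pow_const 2)]
    refine setLIntegral_mono' hΩ.measurableSet fun x hx => ?_
    calc ∫⁻ y in Ω, ‖f (x - y)‖ₑ * (v y ^ 2 * b x ^ 2)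
        = (∫⁻ y in Ω, ‖f (x - y)‖ₑ * v y ^ 2) * b x ^ 2 := by
          rw [← lintegral_mul_const _ (by
            exact (hf.comp (measurable_const.sub measurable_id)).enorm.mul (hv.pow_const 2))]
          simp only [mul_assoc]
      _ ≤ _ := mul_le_mul' (h.left x hx) le_rfl
  calc ∫⁻ x in Ω, b x * v x * ∫⁻ y in Ω, ‖f (x - y)‖ₑ * (b y * v y)
      ≤ ∫⁻ x in Ω, ((∫⁻ y in Ω, ‖f (x - y)‖ₑ * (v x ^ 2 * b y ^ 2))
          + ∫⁻ y in Ω, ‖f (x - y)‖ₑ * (v y ^ 2 * b x ^ 2)) := by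
        refine lintegral_mono fun x => ?_
        have my : Measurable fun y => ‖f (x - y)‖ₑ :=
          (hf.comp (measurable_const.sub measurable_id)).enorm
        have m2 : Measurable fun y => ‖f (x - y)‖ₑ * (b y * v y) := my.mul (hb.mul hv)
        have m3 : Measurable fun y => ‖f (x - y)‖ₑ * (v x ^ 2 * b y ^ 2) :=
          my.mul ((hb.pow_const 2).const_mul _)
        simp only
        rw [← lintegral_const_mul _ m2, ← lintegral_add_left m3]
        refine lintegral_mono fun y => ?_
        rw [← mul_add]
        calc b x * v x * (‖f (x - y)‖ₑ * (b y * v y))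
            = ‖f (x - y)‖ₑ * ((v x * b y) * (v y * b x)) := by ring
          _ ≤ ‖f (x - y)‖ₑ * ((v x * b y) ^ 2 + (v y * b x) ^ 2) := by gcongr; exact hmul _ _
          _ = _ := by rw [mul_pow, mul_pow]
    _ = (∫⁻ x in Ω, ∫⁻ y in Ω, ‖f (x - y)‖ₑ * (v x ^ 2 * b y ^ 2))
          + ∫⁻ x in Ω, ∫⁻ y in Ω, ‖f (x - y)‖ₑ * (v y ^ 2 * b x ^ 2) :=
        lintegral_add_left m1.lintegral_prod_right' _
    _ ≤ _ := by
        refine (add_le_add e1 e2).trans (le_of_eq ?_)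
        ring

section HartreePotential

variable {f : E3 → ℝ} {u : L2 Ω} {Q : ℝ}

theorem PotBound.integrable (hf : Measurable f) (h : PotBound Ω f (fun x => ‖u x‖ₑ) Q) {x : E3}
    (hx : x ∈ Ω) : Integrable (fun y => f (x - y) * ‖u y‖ ^ 2) (vol Ω) := by
  refine ⟨((hf.comp (measurable_const.sub measurable_id)).mul
    ((measurable_coe u).norm.pow_const 2)).aestronglyMeasurable, ?_⟩
  refine lt_of_le_of_lt ?_ (lt_of_le_of_lt (h.left x hx) ENNReal.ofReal_lt_top)
  refine lintegral_mono fun y => ?_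
  simp [enorm_mul, enorm_pow]

theorem PotBound.abs_hartreePotential_le (h : PotBound Ω f (fun x => ‖u x‖ₑ) Q) {x : E3}
    (hx : x ∈ Ω) : |hartreePotential Ω f u x| ≤ Q := by
  have h1 : ‖hartreePotential Ω f u x‖ₑ ≤ ENNReal.ofReal Q := by
    refine (enorm_integral_le_lintegral_enorm _).trans (le_trans ?_ (h.left x hx))
    refine lintegral_mono fun y => ?_
    simp [enorm_mul, enorm_pow]
  rw [← ofReal_norm, Real.norm_eq_abs] at h1
  exact (ENNReal.ofReal_le_ofReal_iff h.nonneg).1 h1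

theorem enorm_hartreePotential_sub_le {g : E3 → ℝ} {v : L2 Ω} {Q' : ℝ} (hf : Measurable f)
    (hg : Measurable g) (h : PotBound Ω f (fun x => ‖u x‖ₑ) Q)
    (k : PotBound Ω g (fun x => ‖v x‖ₑ) Q') {x : E3} (hx : x ∈ Ω) :
    ‖hartreePotential Ω f u x - hartreePotential Ω g v x‖ₑ ≤
      (∫⁻ y in Ω, ‖f (x - y) - g (x - y)‖ₑ * ‖u y‖ₑ ^ 2)
        + ∫⁻ y in Ω, ‖g (x - y)‖ₑ * (‖u y - v y‖ₑ * (‖u y‖ₑ + ‖v y‖ₑ)) := by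
  unfold hartreePotential
  rw [← integral_sub (h.integrable hf hx) (k.integrable hg hx)]
  refine (enorm_integral_le_lintegral_enorm _).trans ?_
  have mx : ∀ {f : E3 → ℝ}, Measurable f → Measurable fun y => f (x - y) := fun hf =>
    hf.comp (measurable_const.sub measurable_id)
  have m4 : Measurable fun y => ‖f (x - y) - g (x - y)‖ₑ * ‖u y‖ₑ ^ 2 :=
    ((mx hf).sub (mx hg)).enorm.mul ((measurable_coe u).enorm.pow_const 2)
  rw [← lintegral_add_left m4]
  refine lintegral_mono fun y => ?_
  have e : f (x - y) * ‖u y‖ ^ 2 - g (x - y) * ‖v y‖ ^ 2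
      = (f (x - y) - g (x - y)) * ‖u y‖ ^ 2 + g (x - y) * (‖u y‖ ^ 2 - ‖v y‖ ^ 2) := by ring
  simp only
  rw [e]
  refine (enorm_add_le _ _).trans (add_le_add ?_ ?_)
  · simp [enorm_mul, enorm_pow]
  · rw [enorm_mul]
    refine mul_le_mul' le_rfl ?_
    rw [sq_sub_sq, mul_comm, enorm_mul]
    refine mul_le_mul' ?_ ?_
    · rw [← ofReal_norm, ← ofReal_norm]
      exact ENNReal.ofReal_le_ofReal (abs_norm_sub_norm_le _ _)
    · refine (enorm_add_le _ _).trans ?_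
      simp

end HartreePotential

/-- The dissipation estimate: the real potentials and the Laplacian do not contribute to the growth
of the difference of two states, except through the difference of the potentials. -/
theorem ofReal_abs_re_inner_le {u₁ u₂ l₁ l₂ d₁ d₂ : L2 Ω} {P₁ P₂ : E3 → ℝ} (h₁ : DirLap Ω u₁ l₁)
    (h₂ : DirLap Ω u₂ l₂) (e₁ : ⇑(Complex.I • d₁ + l₁) =ᵐ[vol Ω] fun x => (P₁ x : ℂ) * u₁ x)
    (e₂ : ⇑(Complex.I • d₂ + l₂) =ᵐ[vol Ω] fun x => (P₂ x : ℂ) * u₂ x) :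
    ENNReal.ofReal |(inner ℂ (u₁ - u₂) (d₁ - d₂)).re|
      ≤ ∫⁻ x in Ω, ‖u₁ x - u₂ x‖ₑ * (‖P₁ x - P₂ x‖ₑ * ‖u₂ x‖ₑ) := by
  set p := (Complex.I • d₁ + l₁) - (Complex.I • d₂ + l₂) with hp
  -- Multiplication by i turns the real part into an imaginary part, in which the difference of the
  -- Laplacians contributes a real number.
  have h3 : (inner ℂ (u₁ - u₂) (d₁ - d₂)).re = (inner ℂ (u₁ - u₂) p).im := by
    have hd : Complex.I • (d₁ - d₂) = p - (l₁ - l₂) := by rw [hp, smul_sub]; abel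
    have h4 : Complex.I * inner ℂ (u₁ - u₂) (d₁ - d₂)
        = inner ℂ (u₁ - u₂) p - inner ℂ (u₁ - u₂) (l₁ - l₂) := by
      rw [← inner_smul_right, hd, inner_sub_right]
    have h5 := congrArg Complex.im h4
    rw [Complex.sub_im, (h₁.sub h₂).inner_self_im] at h5
    simpa using h5
  rw [h3, L2.inner_def, ← RCLike.im_eq_complex_im, ← integral_im (L2.integrable_inner _ _)]
  rw [← Real.norm_eq_abs, ofReal_norm]
  refine (enorm_integral_le_lintegral_enorm _).trans (lintegral_mono_ae ?_)
  filter_upwards [e₁, e₂, Lp.coeFn_sub (Complex.I • d₁ + l₁) (Complex.I • d₂ + l₂),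
    Lp.coeFn_sub u₁ u₂] with x a1 a2 a3 a4
  have hpx : p x = (P₁ x : ℂ) * u₁ x - (P₂ x : ℂ) * u₂ x := by
    rw [hp, a3, Pi.sub_apply, a1, a2]
  rw [a4, Pi.sub_apply, hpx]
  -- Writing P₁u₁ − P₂u₂ = P₁(u₁ − u₂) + (P₁ − P₂)u₂ isolates a term with real multiplier P₁, whose
  -- pairing with u₁ − u₂ is real.
  have e : (RCLike.im (inner ℂ (u₁ x - u₂ x) ((P₁ x : ℂ) * u₁ x - (P₂ x : ℂ) * u₂ x)) : ℝ)
      = (RCLike.im (inner ℂ (u₁ x - u₂ x) (((P₁ x - P₂ x : ℝ) : ℂ) * u₂ x)) : ℝ) := by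
    have : (P₁ x : ℂ) * u₁ x - (P₂ x : ℂ) * u₂ x
        = (P₁ x : ℂ) * (u₁ x - u₂ x) + ((P₁ x - P₂ x : ℝ) : ℂ) * u₂ x := by push_cast; ring
    rw [this, inner_add_right, map_add]
    have h0 : (RCLike.im (inner ℂ (u₁ x - u₂ x) ((P₁ x : ℂ) * (u₁ x - u₂ x))) : ℝ) = 0 := by
      simp; ring
    rw [h0, zero_add]
  rw [e]
  refine (enorm_le_iff_norm_le.2 (RCLike.norm_im_le_norm _)).trans ?_
  refine (enorm_le_iff_norm_le.2 (?_ : _ ≤ ‖‖u₁ x - u₂ x‖ * (‖P₁ x - P₂ x‖ * ‖u₂ x‖)‖)).trans ?_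
  · rw [Real.norm_of_nonneg (by positivity)]
    refine (norm_inner_le_norm _ _).trans (le_of_eq ?_)
    rw [norm_mul, Complex.norm_real]
  · simp [enorm_mul]

end Hartree
end


/-! ### Estimates for solutions in terms of a bound on the potential. -/

noncomputable section

namespace Hartree

variable {Ω : Set E3}

section Potential

variable {P V : E3 → ℝ} {u w : L2 Ω} {N m nV : ℝ}

/-- V is only square integrable and is paired with the pointwise bound m of u; the bounded remainder
of the potential is paired with the L² norm of u. -/
theorem lintegral_mul_potential_le (hV : AEMeasurable V (vol Ω)) (hnV0 : 0 ≤ nV)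
    (hnV : ∫⁻ x in Ω, ‖V x‖ₑ ^ 2 ≤ ENNReal.ofReal (nV ^ 2)) (hN : 0 ≤ N) (hm : 0 ≤ m)
    (hP : ∀ᵐ x ∂vol Ω, |P x| ≤ |V x| + N) (hu : ∀ᵐ x ∂vol Ω, ‖u x‖ ≤ m) (w : L2 Ω) :
    ∫⁻ x in Ω, ‖w x‖ₑ * (‖P x‖ₑ * ‖u x‖ₑ) ≤ ENNReal.ofReal (‖w‖ * (nV * m + N * ‖u‖)) := by
  have h1 := lintegral_enorm_mul_le w (g := fun x => ENNReal.ofReal m * ‖V x‖ₑ)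
    (hV.enorm.const_mul _) (G := m * nV) (by positivity) (by
      simp only [mul_pow]
      rw [lintegral_const_mul' _ _ (by simp), ENNReal.ofReal_mul (by positivity),
        ENNReal.ofReal_pow hm]
      gcongr)
  have h2 := lintegral_enorm_mul_le w (g := fun x => ENNReal.ofReal N * ‖u x‖ₑ)
    ((measurable_coe u).enorm.aemeasurable.const_mul _) (G := N * ‖u‖) (by positivity) (by
      simp only [mul_pow]
      rw [lintegral_const_mul' _ _ (by simp), ENNReal.ofReal_mul (by positivity),
        ENNReal.ofReal_pow hN, lintegral_enorm_sq_eq])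
  rw [mul_add, ENNReal.ofReal_add (by positivity) (by positivity), mul_comm nV]
  refine le_trans ?_ (add_le_add h1 h2)
  have m1 : AEMeasurable (fun x => ‖w x‖ₑ * (ENNReal.ofReal m * ‖V x‖ₑ)) (vol Ω) :=
    (measurable_coe w).enorm.aemeasurable.mul (hV.enorm.const_mul _)
  rw [← lintegral_add_left' m1]
  refine lintegral_mono_ae ?_
  filter_upwards [hP, hu] with x hx hux
  rw [← mul_add]
  refine mul_le_mul' le_rfl ?_
  have e1 : ‖P x‖ₑ ≤ ‖V x‖ₑ + ENNReal.ofReal N := by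
    rw [← ofReal_norm, ← ofReal_norm, ← ENNReal.ofReal_add (norm_nonneg _) hN]
    exact ENNReal.ofReal_le_ofReal hx
  have e2 : ‖u x‖ₑ ≤ ENNReal.ofReal m := by
    rw [← ofReal_norm]; exact ENNReal.ofReal_le_ofReal hux
  calc ‖P x‖ₑ * ‖u x‖ₑ ≤ (‖V x‖ₑ + ENNReal.ofReal N) * ‖u x‖ₑ := by gcongr
    _ = ‖u x‖ₑ * ‖V x‖ₑ + ENNReal.ofReal N * ‖u x‖ₑ := by ring
    _ ≤ _ := by gcongr

theorem norm_le_of_ae_eq_mul (hV : AEMeasurable V (vol Ω)) (hnV0 : 0 ≤ nV)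
    (hnV : ∫⁻ x in Ω, ‖V x‖ₑ ^ 2 ≤ ENNReal.ofReal (nV ^ 2)) (hN : 0 ≤ N) (hm : 0 ≤ m)
    (hP : ∀ᵐ x ∂vol Ω, |P x| ≤ |V x| + N) (hu : ∀ᵐ x ∂vol Ω, ‖u x‖ ≤ m)
    (hw : w =ᵐ[vol Ω] fun x => (P x : ℂ) * u x) : ‖w‖ ≤ nV * m + N * ‖u‖ := by
  have h := lintegral_mul_potential_le hV hnV0 hnV hN hm hP hu w
  have e : ∫⁻ x in Ω, ‖w x‖ₑ * (‖P x‖ₑ * ‖u x‖ₑ) = ENNReal.ofReal (‖w‖ ^ 2) := by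
    rw [← lintegral_enorm_sq_eq]
    refine lintegral_congr_ae ?_
    filter_upwards [hw] with x hx
    have : ‖w x‖ₑ = ‖P x‖ₑ * ‖u x‖ₑ := by
      rw [hx, enorm_mul]
      congr 1
      rw [← ofReal_norm, ← ofReal_norm, Complex.norm_real]
    rw [← this, sq]
  have hr : 0 ≤ nV * m + N * ‖u‖ := by positivity
  rw [e, ENNReal.ofReal_le_ofReal_iff (by positivity)] at h
  rcases (norm_nonneg w).eq_or_lt with h0 | h0
  · rw [← h0]; exact hr
  · rw [sq] at h; exact le_of_mul_le_mul_left h h0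

end Potential

theorem ae_coe_zero (Ω : Set E3) : ∀ᵐ x ∂vol Ω, (0 : L2 Ω) x = 0 :=
  Lp.coeFn_zero ℂ 2 (vol Ω)

theorem DirLap.zero {u l : L2 Ω} (h : DirLap Ω u l) : DirLap Ω 0 0 := by
  simpa using h.sub h

/-- The standing assumptions on the domain, the potentials and the control, with the constants on
which the estimates depend. -/
structure Setting (Ω : Set E3) (T : ℝ) (V Vcon : E3 → ℝ) (c : ℝ → ℝ) (S : Finset ℝ)
    (K B Kc nV : ℝ) : Prop where
  isOpen : IsOpen Ω
  isBounded : Bornology.IsBounded Ω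
  pos : 0 < T
  aemeasurable : AEMeasurable V (vol Ω)
  aemeasurable_con : AEMeasurable Vcon (vol Ω)
  norm_nonneg : 0 ≤ nV
  lintegral_le : ∫⁻ x in Ω, ‖V x‖ₑ ^ 2 ≤ ENNReal.ofReal (nV ^ 2)
  con_nonneg : 0 ≤ Kc
  con_le : ∀ᵐ x ∂vol Ω, |Vcon x| ≤ Kc
  control : ControlBound T c S K B

/-- `χ` is a solution with kernel `f`, time derivative `χ'` and Laplacian `l`. -/
structure Flow (Ω : Set E3) (T : ℝ) (V Vcon : E3 → ℝ) (c : ℝ → ℝ) (f : E3 → ℝ)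
    (φ₀ l₀ : L2 Ω) (χ χ' l : ℝ → L2 Ω) : Prop where
  measurable : Measurable f
  prim : IsPrim 0 T χ χ'
  initial : χ 0 = φ₀
  dirLap_initial : DirLap Ω φ₀ l₀
  dirLap : ∀ᵐ t ∂volume.restrict (Ioo 0 T), DirLap Ω (χ t) (l t)
  equation : ∀ᵐ t ∂volume.restrict (Ioo 0 T), ⇑(Complex.I • χ' t + l t) =ᵐ[vol Ω]
    fun x => ((V x + c t * Vcon x + hartreePotential Ω f (χ t) x : ℝ) : ℂ) * χ t x
  bounded : ∃ B, 0 ≤ B ∧ ∀ᵐ t ∂volume.restrict (Ioo 0 T), ‖l t‖ ≤ B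

theorem abs_potential_le {V Vcon : E3 → ℝ} {K Kc Q ct : ℝ} {f : E3 → ℝ} {u : L2 Ω}
    (hΩ : IsOpen Ω) (hcon : ∀ᵐ x ∂vol Ω, |Vcon x| ≤ Kc) (hct : |ct| ≤ K)
    (hQ : PotBound Ω f (fun x => ‖u x‖ₑ) Q) :
    ∀ᵐ x ∂vol Ω, |V x + ct * Vcon x + hartreePotential Ω f u x| ≤ |V x| + (K * Kc + Q) := by
  filter_upwards [hcon, ae_restrict_mem hΩ.measurableSet] with x h1 hx
  have h2 := hQ.abs_hartreePotential_le hx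
  have h3 : |ct * Vcon x| ≤ K * Kc := by
    rw [abs_mul]
    exact mul_le_mul hct h1 (abs_nonneg _) ((abs_nonneg _).trans hct)
  have := abs_add_three (V x) (ct * Vcon x) (hartreePotential Ω f u x)
  linarith

/-- The dissipation estimate for two states of Hartree type. -/
theorem abs_re_inner_le_of_hartree (hΩ : IsOpen Ω) {V Vcon : E3 → ℝ} {Kc : ℝ}
    (hcon : ∀ᵐ x ∂vol Ω, |Vcon x| ≤ Kc) (hKc : 0 ≤ Kc) {f g : E3 → ℝ} (hf : Measurable f)
    (hg : Measurable g) {u₁ u₂ l₁ l₂ d₁ d₂ : L2 Ω} {a₁ a₂ Q Q' R : ℝ}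
    (h₁ : DirLap Ω u₁ l₁) (h₂ : DirLap Ω u₂ l₂)
    (e₁ : ⇑(Complex.I • d₁ + l₁) =ᵐ[vol Ω] fun x =>
      ((V x + a₁ * Vcon x + hartreePotential Ω f u₁ x : ℝ) : ℂ) * u₁ x)
    (e₂ : ⇑(Complex.I • d₂ + l₂) =ᵐ[vol Ω] fun x =>
      ((V x + a₂ * Vcon x + hartreePotential Ω g u₂ x : ℝ) : ℂ) * u₂ x)
    (q : PotBound Ω f (fun x => ‖u₁ x‖ₑ) Q') (q₁ : PotBound Ω g (fun x => ‖u₁ x‖ₑ) Q)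
    (q₂ : PotBound Ω g (fun x => ‖u₂ x‖ₑ) Q) (hR0 : 0 ≤ R)
    (hR : ∫⁻ x in Ω, ‖u₁ x - u₂ x‖ₑ * ‖u₂ x‖ₑ * ∫⁻ y in Ω, ‖f (x - y) - g (x - y)‖ₑ * ‖u₁ y‖ₑ ^ 2
      ≤ ENNReal.ofReal R) :
    |(inner ℂ (u₁ - u₂) (d₁ - d₂)).re|
      ≤ |a₁ - a₂| * Kc * ‖u₂‖ * ‖u₁ - u₂‖ + 8 * Q * ‖u₁ - u₂‖ ^ 2 + R := by
  have hQ := q₁.nonneg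
  set b : E3 → ℝ≥0∞ := fun x => ‖u₁ x - u₂ x‖ₑ with hb
  have mb : Measurable b := ((measurable_coe u₁).sub (measurable_coe u₂)).enorm
  set v : E3 → ℝ≥0∞ := fun x => ‖u₁ x‖ₑ + ‖u₂ x‖ₑ with hv
  have mv : Measurable v := (measurable_coe u₁).enorm.add (measurable_coe u₂).enorm
  have hbsq : ∫⁻ x in Ω, b x ^ 2 = ENNReal.ofReal (‖u₁ - u₂‖ ^ 2) := by
    rw [← lintegral_enorm_sq_eq]
    refine lintegral_congr_ae ?_
    filter_upwards [Lp.coeFn_sub u₁ u₂] with x hx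
    rw [hx, Pi.sub_apply]
  -- The final coefficient 8Q is the product of the 4 from the potential of (|u₁| + |u₂|)² and the 2
  -- of the Schur test.
  have hform := (q₁.add hg (measurable_coe u₁).enorm q₂).lintegral_form_le hΩ hg mv mb
  rw [hbsq] at hform
  have hctl : ∫⁻ x in Ω, b x * (ENNReal.ofReal (|a₁ - a₂| * Kc) * ‖u₂ x‖ₑ)
      ≤ ENNReal.ofReal (|a₁ - a₂| * Kc * ‖u₂‖ * ‖u₁ - u₂‖) := by
    have := lintegral_enorm_mul_le (u₁ - u₂)
      (g := fun x => ENNReal.ofReal (|a₁ - a₂| * Kc) * ‖u₂ x‖ₑ)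
      ((measurable_coe u₂).enorm.aemeasurable.const_mul _) (G := |a₁ - a₂| * Kc * ‖u₂‖)
      (by positivity) (by
        simp only [mul_pow (ENNReal.ofReal (|a₁ - a₂| * Kc))]
        rw [lintegral_const_mul' _ _ (ENNReal.pow_ne_top ENNReal.ofReal_ne_top),
          lintegral_enorm_sq_eq, ← ENNReal.ofReal_pow (by positivity),
          ← ENNReal.ofReal_mul (by positivity), ← mul_pow])
    rw [mul_comm ‖u₁ - u₂‖] at this
    refine le_trans (le_of_eq ?_) this
    refine lintegral_congr_ae ?_
    filter_upwards [Lp.coeFn_sub u₁ u₂] with x hx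
    rw [hx, Pi.sub_apply]
  have hmain := ofReal_abs_re_inner_le h₁ h₂ e₁ e₂
  rw [← ENNReal.ofReal_le_ofReal_iff (by positivity), ENNReal.ofReal_add (by positivity) hR0,
    ENNReal.ofReal_add (by positivity) (by positivity)]
  refine hmain.trans ?_
  have e8 : ENNReal.ofReal (8 * Q * ‖u₁ - u₂‖ ^ 2)
      = 2 * ENNReal.ofReal (4 * Q) * ENNReal.ofReal (‖u₁ - u₂‖ ^ 2) := by
    have e2 : (2 : ℝ≥0∞) * ENNReal.ofReal (4 * Q) = ENNReal.ofReal (8 * Q) := by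
      rw [← ENNReal.ofReal_ofNat, ← ENNReal.ofReal_mul (by norm_num)]
      congr 1; ring
    rw [e2, ← ENNReal.ofReal_mul (by positivity)]
  rw [e8]
  refine le_trans ?_ (add_le_add (add_le_add hctl hform) hR)
  have mfd : Measurable fun z : E3 × E3 => ‖g (z.1 - z.2)‖ₑ * (b z.2 * v z.2) :=
    (hg.comp (measurable_fst.sub measurable_snd)).enorm.mul
      ((mb.comp measurable_snd).mul (mv.comp measurable_snd))
  have m1 : Measurable fun x => b x * (ENNReal.ofReal (|a₁ - a₂| * Kc) * ‖u₂ x‖ₑ) :=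
    mb.mul ((measurable_coe u₂).enorm.const_mul _)
  have m2 : Measurable fun x => b x * v x * ∫⁻ y in Ω, ‖g (x - y)‖ₑ * (b y * v y) :=
    (mb.mul mv).mul mfd.lintegral_prod_right'
  have m3 : Measurable fun x => b x * (ENNReal.ofReal (|a₁ - a₂| * Kc) * ‖u₂ x‖ₑ)
      + b x * v x * ∫⁻ y in Ω, ‖g (x - y)‖ₑ * (b y * v y) := m1.add m2
  rw [← lintegral_add_left m1, ← lintegral_add_left m3]
  refine lintegral_mono_ae ?_
  filter_upwards [hcon, ae_restrict_mem hΩ.measurableSet] with x hx hxΩ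
  have hH := enorm_hartreePotential_sub_le hf hg q q₂ hxΩ
  set X := ∫⁻ y in Ω, ‖f (x - y) - g (x - y)‖ₑ * ‖u₁ y‖ₑ ^ 2
  set Y := ∫⁻ y in Ω, ‖g (x - y)‖ₑ * (b y * v y)
  have hd : ‖(V x + a₁ * Vcon x + hartreePotential Ω f u₁ x)
      - (V x + a₂ * Vcon x + hartreePotential Ω g u₂ x)‖ₑ
      ≤ ENNReal.ofReal (|a₁ - a₂| * Kc) + (X + Y) := by
    rw [show (V x + a₁ * Vcon x + hartreePotential Ω f u₁ x)
      - (V x + a₂ * Vcon x + hartreePotential Ω g u₂ x)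
      = (a₁ - a₂) * Vcon x + (hartreePotential Ω f u₁ x - hartreePotential Ω g u₂ x) by ring]
    refine (enorm_add_le _ _).trans (add_le_add ?_ hH)
    rw [← ofReal_norm, Real.norm_eq_abs, abs_mul]
    exact ENNReal.ofReal_le_ofReal (mul_le_mul_of_nonneg_left hx (abs_nonneg _))
  calc b x * (‖(V x + a₁ * Vcon x + hartreePotential Ω f u₁ x)
      - (V x + a₂ * Vcon x + hartreePotential Ω g u₂ x)‖ₑ * ‖u₂ x‖ₑ)
      ≤ b x * ((ENNReal.ofReal (|a₁ - a₂| * Kc) + (X + Y)) * ‖u₂ x‖ₑ) := by gcongr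
    _ = b x * (ENNReal.ofReal (|a₁ - a₂| * Kc) * ‖u₂ x‖ₑ) + b x * ‖u₂ x‖ₑ * Y
        + b x * ‖u₂ x‖ₑ * X := by ring
    _ ≤ _ := by
      gcongr
      exact le_add_self

theorem ae_restrict_Ioo_shift {p : ℝ → Prop} {τ h : ℝ} (hh : 0 ≤ h)
    (hp : ∀ᵐ t ∂volume.restrict (Ioo 0 τ), p t) :
    ∀ᵐ t ∂volume.restrict (Ioo 0 (τ - h)), p (t + h) := by
  rw [ae_restrict_iff' measurableSet_Ioo] at hp ⊢
  have := (measurePreserving_add_right (volume : Measure ℝ) h).quasiMeasurePreserving.ae hp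
  filter_upwards [this] with t ht hmem
  exact ht ⟨by linarith [hmem.1], by linarith [hmem.2]⟩

theorem ae_restrict_Ioo_mono {p : ℝ → Prop} {τ τ' : ℝ} (hh : τ' ≤ τ)
    (hp : ∀ᵐ t ∂volume.restrict (Ioo 0 τ), p t) :
    ∀ᵐ t ∂volume.restrict (Ioo 0 τ'), p t :=
  ae_restrict_of_ae_restrict_of_subset (Ioo_subset_Ioo le_rfl hh) hp

theorem ae_notMem_finset (S : Finset ℝ) (μ : Measure ℝ) [NullSingletonClass μ] : ∀ᵐ t ∂μ, t ∉ S := by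
  have := S.finite_toSet.measure_zero μ
  exact measure_eq_zero_iff_ae_notMem.1 this

section Regularity

variable {T : ℝ} {V Vcon : E3 → ℝ} {c : ℝ → ℝ} {S : Finset ℝ} {K B Kc nV : ℝ}
  {f : E3 → ℝ} {φ₀ l₀ : L2 Ω} {χ χ' l : ℝ → L2 Ω}

/-- Comparison with the zero state, for which the dissipation estimate has no remainder. -/
theorem Flow.norm_le (F : Flow Ω T V Vcon c f φ₀ l₀ χ χ' l) {t : ℝ} (ht : t ∈ Icc 0 T) :
    ‖χ t‖ ≤ ‖φ₀‖ := by
  have := F.prim.norm_le_gronwall (ℓ := fun _ => 0) (Λ := 0) le_rfl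
    intervalIntegrable_const (fun _ => le_rfl) (by
      filter_upwards [F.dirLap, F.equation] with s h1 h2
      have e : ⇑(Complex.I • (0 : L2 Ω) + 0) =ᵐ[vol Ω] fun x => ((0 : ℝ) : ℂ) * (0 : L2 Ω) x := by
        rw [smul_zero, add_zero]
        filter_upwards [ae_coe_zero Ω] with x hx
        rw [hx, mul_zero]
      have h3 := ofReal_abs_re_inner_le h1 h1.zero h2 e
      have h4 : ∫⁻ x in Ω, ‖χ s x - (0 : L2 Ω) x‖ₑ * (‖(V x + c s * Vcon x
          + hartreePotential Ω f (χ s) x) - 0‖ₑ * ‖(0 : L2 Ω) x‖ₑ) = 0 := by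
        rw [lintegral_congr_ae (g := fun _ => 0), lintegral_zero]
        filter_upwards [ae_coe_zero Ω] with x hx
        rw [hx, enorm_zero, mul_zero, mul_zero]
      rw [h4, nonpos_iff_eq_zero, ENNReal.ofReal_eq_zero, sub_zero, sub_zero] at h3
      have := (le_abs_self _).trans h3
      linarith) ht
  simpa [F.initial] using this

/-- The constant state φ₀ is paired with the fictitious derivative il₀, since i(il₀) + l₀ = 0 is the
equation with zero potential. Its true derivative is 0, which costs ‖l₀‖; the remaining potential
acts on φ₀ only, whose pointwise bound is known. -/
theorem Flow.norm_sub_initial_le (St : Setting Ω T V Vcon c S K B Kc nV)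
    (F : Flow Ω T V Vcon c f φ₀ l₀ χ χ' l) {τ Q m : ℝ} (hτT : τ ≤ T) (hm : 0 ≤ m)
    (hφ : ∀ᵐ x ∂vol Ω, ‖φ₀ x‖ ≤ m) (hQ0 : 0 ≤ Q)
    (hQ : ∀ᵐ t ∂volume.restrict (Ioo 0 τ), PotBound Ω f (fun x => ‖χ t x‖ₑ) Q)
    {t : ℝ} (ht : t ∈ Icc 0 τ) :
    ‖χ t - φ₀‖ ≤ 2 * (‖l₀‖ + (nV * m + (K * Kc + Q) * ‖φ₀‖)) * t := by
  have hK := St.control.nonneg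
  have hKc := St.con_nonneg
  have hnV := St.norm_nonneg
  set D := ‖l₀‖ + (nV * m + (K * Kc + Q) * ‖φ₀‖) with hD
  have hD0 : 0 ≤ D := by positivity
  have hp := (F.prim.mono le_rfl ht.1 (ht.2.trans hτT)).sub (IsPrim.const ht.1 φ₀)
  have := hp.norm_le_gronwall (ℓ := fun _ => D) (Λ := 0) le_rfl
    intervalIntegrable_const (fun _ => hD0) (by
      have htT := ht.2.trans hτT
      filter_upwards [ae_restrict_Ioo_mono htT F.dirLap, ae_restrict_Ioo_mono htT F.equation,
        ae_restrict_Ioo_mono ht.2 hQ, ae_notMem_finset S _, ae_restrict_mem measurableSet_Ioo]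
        with s h1 h2 h3 h4 h5
      have e : ⇑(Complex.I • (Complex.I • l₀) + l₀) =ᵐ[vol Ω] fun x => ((0 : ℝ) : ℂ) * φ₀ x := by
        rw [smul_smul, Complex.I_mul_I, neg_one_smul, neg_add_cancel]
        filter_upwards [ae_coe_zero Ω] with x hx
        rw [hx, Complex.ofReal_zero, zero_mul]
      have h6 := ofReal_abs_re_inner_le h1 F.dirLap_initial h2 e
      have hb := St.control.bound s ⟨h5.1, h5.2.trans_le htT⟩ h4
      have h7 := lintegral_mul_potential_le St.aemeasurable hnV St.lintegral_le
        (N := K * Kc + Q) (by positivity) hm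
        (abs_potential_le (V := V) St.isOpen St.con_le hb h3) hφ (χ s - φ₀)
      have h8 : ∫⁻ x in Ω, ‖χ s x - φ₀ x‖ₑ * (‖(V x + c s * Vcon x
          + hartreePotential Ω f (χ s) x) - 0‖ₑ * ‖φ₀ x‖ₑ)
          = ∫⁻ x in Ω, ‖(χ s - φ₀) x‖ₑ * (‖V x + c s * Vcon x
          + hartreePotential Ω f (χ s) x‖ₑ * ‖φ₀ x‖ₑ) := by
        refine lintegral_congr_ae ?_
        filter_upwards [Lp.coeFn_sub (χ s) φ₀] with x hx
        rw [hx, Pi.sub_apply, sub_zero]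
      rw [h8] at h6
      have h9 := (ENNReal.ofReal_le_ofReal_iff (by positivity)).1 (h6.trans h7)
      have h10 : (inner ℂ (χ s - φ₀) (χ' s - 0)).re
          = (inner ℂ (χ s - φ₀) (χ' s - Complex.I • l₀)).re
            + (inner ℂ (χ s - φ₀) (Complex.I • l₀)).re := by
        rw [← Complex.add_re, ← inner_add_right, sub_add_cancel, sub_zero]
      have h11 : (inner ℂ (χ s - φ₀) (Complex.I • l₀)).re ≤ ‖χ s - φ₀‖ * ‖l₀‖ := by
        refine (Complex.re_le_norm _).trans ((norm_inner_le_norm _ _).trans ?_)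
        rw [norm_smul, Complex.norm_I, one_mul]
      rw [h10]
      have := (le_abs_self _).trans h9
      rw [hD]
      linarith) (right_mem_Icc.2 ht.1)
  rw [F.initial] at this
  simp at this
  linarith

/-- The translate solves the same equation with a translated control, so V cancels in the difference
of the potentials. The control contributes the integral of its increments, which is at most hB, and
the initial difference is O(h) by the preceding estimate. -/
theorem Flow.norm_shift_sub_le (St : Setting Ω T V Vcon c S K B Kc nV)
    (F : Flow Ω T V Vcon c f φ₀ l₀ χ χ' l) {τ Q m : ℝ} (hτT : τ ≤ T) (hm : 0 ≤ m)
    (hφ : ∀ᵐ x ∂vol Ω, ‖φ₀ x‖ ≤ m) (hQ0 : 0 ≤ Q)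
    (hQ : ∀ᵐ t ∂volume.restrict (Ioo 0 τ), PotBound Ω f (fun x => ‖χ t x‖ₑ) Q)
    {t h : ℝ} (ht : 0 ≤ t) (hh : 0 < h) (hth : t + h ≤ τ) :
    ‖χ (t + h) - χ t‖ ≤ Real.exp (16 * Q * T) *
      (2 * (‖l₀‖ + (nV * m + (K * Kc + Q) * ‖φ₀‖)) + 2 * B * Kc * ‖φ₀‖) * h := by
  have hK := St.control.nonneg
  have hB := St.control.nonneg'
  have hKc := St.con_nonneg
  have hnV := St.norm_nonneg
  obtain ⟨ℓ, hℓ0, hℓ1, hℓ2⟩ := St.control.variation h hh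
  have hp := (F.prim.shift h).mono (c := 0) (d := τ - h) (by linarith) (by linarith) (by linarith)
  have hp := hp.sub (F.prim.mono le_rfl (by linarith : 0 ≤ τ - h) (by linarith))
  obtain ⟨i1, i2⟩ := hℓ1 (τ - h) (by linarith)
  have := hp.norm_le_gronwall (ℓ := fun s => ℓ s * (Kc * ‖φ₀‖)) (Λ := 8 * Q) (by positivity)
    (i1.mul_const _) (fun s => mul_nonneg (hℓ0 s) (by positivity)) (by
      have hτ' : τ - h ≤ T := by linarith
      filter_upwards [ae_restrict_Ioo_mono hτ' F.dirLap, ae_restrict_Ioo_mono hτ' F.equation,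
        ae_restrict_Ioo_mono (by linarith : τ - h ≤ τ) hQ,
        ae_restrict_Ioo_shift hh.le (ae_restrict_Ioo_mono hτT F.dirLap),
        ae_restrict_Ioo_shift hh.le (ae_restrict_Ioo_mono hτT F.equation),
        ae_restrict_Ioo_shift hh.le hQ,
        ae_notMem_finset S _, ae_restrict_Ioo_shift (τ := τ) hh.le (ae_notMem_finset S _),
        ae_restrict_mem measurableSet_Ioo] with s a1 a2 a3 b1 b2 b3 c1 c2 hs
      have h1 := abs_re_inner_le_of_hartree (R := 0) St.isOpen St.con_le hKc F.measurable
        F.measurable b1 a1 b2 a2 b3 b3 a3 le_rfl (by simp)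
      have h2 := hℓ2 s hs.1 (by linarith [hs.2]) c1 c2
      have h3 := F.norm_le (t := s) ⟨hs.1.le, by linarith [hs.2]⟩
      refine (le_abs_self _).trans (h1.trans ?_)
      have h4 : |c (s + h) - c s| * Kc * ‖χ s‖ ≤ ℓ s * (Kc * ‖φ₀‖) := by
        rw [mul_assoc]
        have := hℓ0 s
        gcongr
      have := mul_le_mul_of_nonneg_right h4 (norm_nonneg (χ (s + h) - χ s))
      linarith) (t := t) ⟨ht, by linarith⟩
  refine this.trans ?_
  have h0 := F.norm_sub_initial_le St hτT hm hφ hQ0 hQ (t := h) ⟨hh.le, by linarith⟩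
  rw [zero_add, F.initial, intervalIntegral.integral_mul_const, sub_zero]
  have he : Real.exp (2 * (8 * Q) * (τ - h)) ≤ Real.exp (16 * Q * T) := by
    apply Real.exp_le_exp.2
    have : Q * (τ - h) ≤ Q * T := mul_le_mul_of_nonneg_left (by linarith) hQ0
    linarith
  have h5 : (∫ s in (0 : ℝ)..(τ - h), ℓ s) * (Kc * ‖φ₀‖) ≤ h * B * (Kc * ‖φ₀‖) :=
    mul_le_mul_of_nonneg_right i2 (by positivity)
  have h6 : 0 ≤ ∫ s in (0 : ℝ)..(τ - h), ℓ s :=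
    intervalIntegral.integral_nonneg (by linarith) fun s _ => hℓ0 s
  rw [mul_assoc (Real.exp (16 * Q * T))]
  refine mul_le_mul he ?_ (by positivity) (Real.exp_pos _).le
  linarith

end Regularity

end Hartree
end


/-! ### Kernels on the difference set, and regularity from a potential bound. -/

noncomputable section

namespace Hartree

variable {Ω : Set E3}

section Kernel

theorem lintegral_sub_left_le (hΩ : MeasurableSet Ω) (hd : MeasurableSet (Ω - Ω)) (g : E3 → ℝ≥0∞)
    {x : E3} (hx : x ∈ Ω) : ∫⁻ y in Ω, g (x - y) ≤ ∫⁻ z in Ω - Ω, g z := by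
  rw [← lintegral_indicator hΩ, ← lintegral_indicator hd,
    ← lintegral_sub_left_eq_self ((Ω - Ω).indicator g) x]
  refine lintegral_mono fun y => ?_
  by_cases hy : y ∈ Ω
  · rw [indicator_of_mem hy, indicator_of_mem (sub_mem_sub hx hy)]
  · rw [indicator_of_notMem hy]
    exact zero_le

theorem lintegral_sub_right_le (hΩ : MeasurableSet Ω) (hd : MeasurableSet (Ω - Ω)) (g : E3 → ℝ≥0∞)
    {x : E3} (hx : x ∈ Ω) : ∫⁻ y in Ω, g (y - x) ≤ ∫⁻ z in Ω - Ω, g z := by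
  rw [← lintegral_indicator hΩ, ← lintegral_indicator hd,
    ← lintegral_sub_right_eq_self ((Ω - Ω).indicator g) x]
  refine lintegral_mono fun y => ?_
  by_cases hy : y ∈ Ω
  · rw [indicator_of_mem hy, indicator_of_mem (sub_mem_sub hy hx)]
  · rw [indicator_of_notMem hy]
    exact zero_le

theorem PotBound.mono {f : E3 → ℝ} {v : E3 → ℝ≥0∞} {Q Q' : ℝ} (h : PotBound Ω f v Q)
    (hQ : Q ≤ Q') : PotBound Ω f v Q' :=
  ⟨h.nonneg.trans hQ, fun x hx => (h.left x hx).trans (ENNReal.ofReal_le_ofReal hQ),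
    fun x hx => (h.right x hx).trans (ENNReal.ofReal_le_ofReal hQ)⟩

theorem PotBound.of_ae_norm_le (hΩ : IsOpen Ω) {f : E3 → ℝ} {F m : ℝ} (hF0 : 0 ≤ F)
    (hF : ∫⁻ z in Ω - Ω, ‖f z‖ₑ ≤ ENNReal.ofReal F) {u : L2 Ω} (hm : 0 ≤ m)
    (hu : ∀ᵐ x ∂vol Ω, ‖u x‖ ≤ m) : PotBound Ω f (fun x => ‖u x‖ₑ) (F * m ^ 2) := by
  have hd : MeasurableSet (Ω - Ω) := (hΩ.sub_right).measurableSet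
  have key : ∀ g : E3 → E3, ∫⁻ y in Ω, ‖f (g y)‖ₑ ≤ ENNReal.ofReal F →
      ∫⁻ y in Ω, ‖f (g y)‖ₑ * ‖u y‖ₑ ^ 2 ≤ ENNReal.ofReal (F * m ^ 2) := fun g hg => by
    calc ∫⁻ y in Ω, ‖f (g y)‖ₑ * ‖u y‖ₑ ^ 2
        ≤ ∫⁻ y in Ω, ‖f (g y)‖ₑ * ENNReal.ofReal m ^ 2 := by
          refine lintegral_mono_ae ?_
          filter_upwards [hu] with y hy
          rw [← ofReal_norm (u y)]
          gcongr
      _ = (∫⁻ y in Ω, ‖f (g y)‖ₑ) * ENNReal.ofReal m ^ 2 := lintegral_mul_const' _ _ (by simp)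
      _ ≤ ENNReal.ofReal F * ENNReal.ofReal m ^ 2 := by gcongr
      _ = _ := by rw [ENNReal.ofReal_mul hF0, ENNReal.ofReal_pow hm]
  exact ⟨by positivity,
    fun x hx => key _ ((lintegral_sub_left_le hΩ.measurableSet hd (fun z => ‖f z‖ₑ) hx).trans hF),
    fun x hx => key _ ((lintegral_sub_right_le hΩ.measurableSet hd (fun z => ‖f z‖ₑ) hx).trans hF)⟩

theorem PotBound.of_lintegral_pow_four_le (hΩ : IsOpen Ω) {f : E3 → ℝ} (hf : Measurable f)
    {F G : ℝ} (hF0 : 0 ≤ F) (hF : ∫⁻ z in Ω - Ω, ‖f z‖ₑ ^ 2 ≤ ENNReal.ofReal (F ^ 2)) {u : L2 Ω}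
    (hG : 0 ≤ G) (hu : ∫⁻ x in Ω, ‖u x‖ₑ ^ 4 ≤ ENNReal.ofReal (G ^ 2)) :
    PotBound Ω f (fun x => ‖u x‖ₑ) (F * G) := by
  have hd : MeasurableSet (Ω - Ω) := (hΩ.sub_right).measurableSet
  have key : ∀ g : E3 → E3, Measurable g → ∫⁻ y in Ω, ‖f (g y)‖ₑ ^ 2 ≤ ENNReal.ofReal (F ^ 2) →
      ∫⁻ y in Ω, ‖f (g y)‖ₑ * ‖u y‖ₑ ^ 2 ≤ ENNReal.ofReal (F * G) := fun g mg hg => by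
    have h := ENNReal.lintegral_mul_le_Lp_mul_Lq (vol Ω) Real.HolderConjugate.two_two
      (hf.comp mg).enorm.aemeasurable ((measurable_coe u).enorm.pow_const 2).aemeasurable
    simp only [Pi.mul_apply, ENNReal.rpow_ofNat, Function.comp_apply] at h
    refine h.trans ?_
    have e : ∀ y, (‖u y‖ₑ ^ 2) ^ 2 = ‖u y‖ₑ ^ 4 := fun y => by rw [← pow_mul]
    simp only [e]
    refine (mul_le_mul' (ENNReal.rpow_le_rpow hg (by norm_num))
      (ENNReal.rpow_le_rpow hu (by norm_num))).trans (le_of_eq ?_)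
    rw [ENNReal.ofReal_rpow_of_nonneg (by positivity) (by norm_num),
      ENNReal.ofReal_rpow_of_nonneg (by positivity) (by norm_num),
      ← ENNReal.ofReal_mul (by positivity), ← Real.sqrt_eq_rpow, ← Real.sqrt_eq_rpow,
      Real.sqrt_sq hF0, Real.sqrt_sq hG]
  exact ⟨by positivity,
    fun x hx => key _ (by fun_prop)
      ((lintegral_sub_left_le hΩ.measurableSet hd (fun z => ‖f z‖ₑ ^ 2) hx).trans hF),
    fun x hx => key _ (by fun_prop)
      ((lintegral_sub_right_le hΩ.measurableSet hd (fun z => ‖f z‖ₑ ^ 2) hx).trans hF)⟩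

theorem measurable_coulomb : Measurable coulomb := by unfold coulomb; fun_prop

theorem coulomb_neg (x : E3) : coulomb (-x) = coulomb x := by simp [coulomb]

theorem coulomb_nonneg (x : E3) : 0 ≤ coulomb x := by unfold coulomb; positivity

theorem memLp_coulomb {D : Set E3} (hD : Bornology.IsBounded D) : MemLp coulomb 2 (vol D) := by
  obtain ⟨R, hR⟩ := hD.subset_ball 0
  rw [memLp_two_iff_integrable_sq_norm measurable_coulomb.aestronglyMeasurable]
  refine ((integrableOn_norm_rpow_neg_two R).mono_set hR).congr (ae_of_all _ fun x => ?_)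
  simp only [coulomb]
  rw [Real.rpow_neg (norm_nonneg _), Real.rpow_ofNat, norm_div, norm_one, norm_norm, div_pow,
    one_pow, one_div]

theorem lintegral_enorm_sq_eq_of_memLp {μ : Measure E3} {g : E3 → ℝ} (h : MemLp g 2 μ) :
    ∫⁻ x, ‖g x‖ₑ ^ 2 ∂μ = ENNReal.ofReal ((eLpNorm g 2 μ).toReal ^ 2) := by
  rw [ENNReal.ofReal_pow (by positivity), ENNReal.ofReal_toReal h.2.ne,
    eLpNorm_eq_lintegral_rpow_enorm_toReal two_ne_zero ENNReal.ofNat_ne_top,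
    ← ENNReal.rpow_natCast, ← ENNReal.rpow_mul]
  simp

theorem isBounded_sub_self (hb : Bornology.IsBounded Ω) : Bornology.IsBounded (Ω - Ω) := hb.sub hb

theorem exists_lintegral_coulomb_le (hb : Bornology.IsBounded Ω) : ∃ F₁ F₂ : ℝ, 0 ≤ F₁ ∧ 0 ≤ F₂ ∧
    ∫⁻ z in Ω - Ω, ‖coulomb z‖ₑ ≤ ENNReal.ofReal F₁ ∧
    ∫⁻ z in Ω - Ω, ‖coulomb z‖ₑ ^ 2 ≤ ENNReal.ofReal (F₂ ^ 2) := by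
  have hd := isBounded_sub_self hb
  have : Fact (Bornology.IsBounded (Ω - Ω)) := ⟨hd⟩
  have h2 := memLp_coulomb hd
  have h1 : MemLp coulomb 1 (vol (Ω - Ω)) := h2.mono_exponent (by norm_num)
  refine ⟨(eLpNorm coulomb 1 (vol (Ω - Ω))).toReal, (eLpNorm coulomb 2 (vol (Ω - Ω))).toReal,
    by positivity, by positivity, ?_, (lintegral_enorm_sq_eq_of_memLp h2).le⟩
  rw [ENNReal.ofReal_toReal h1.2.ne, eLpNorm_one_eq_lintegral_enorm]

end Kernel

section Regularity

variable {T : ℝ} {V Vcon : E3 → ℝ} {c : ℝ → ℝ} {S : Finset ℝ} {K B Kc nV : ℝ}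

/-- A bound of the self-consistent potential controls the Laplacian of the solution and makes the
solution Lipschitz in time. -/
theorem Setting.exists_regularity (St : Setting Ω T V Vcon c S K B Kc nV) {A Q : ℝ} (hA : 0 ≤ A)
    (hQ0 : 0 ≤ Q) : ∃ D K' R : ℝ, 0 ≤ D ∧ 0 ≤ K' ∧ 0 ≤ R ∧
      ∀ {f : E3 → ℝ} {φ₀ l₀ : L2 Ω} {χ χ' l : ℝ → L2 Ω}, Flow Ω T V Vcon c f φ₀ l₀ χ χ' l →
      ‖φ₀‖ ≤ A → ‖l₀‖ ≤ A → ∀ {τ : ℝ}, τ ≤ T →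
      (∀ᵐ t ∂volume.restrict (Ioo 0 τ), PotBound Ω f (fun x => ‖χ t x‖ₑ) Q) →
      (∀ s ∈ Icc 0 τ, ∀ t ∈ Icc 0 τ, ‖χ t - χ s‖ ≤ D * |t - s|) ∧
      ∀ᵐ t ∂volume.restrict (Ioo 0 τ), ‖l t‖ ≤ K' ∧ ∀ᵐ x ∂vol Ω, ‖χ t x‖ ≤ R := by
  have hK := St.control.nonneg
  have hB := St.control.nonneg'
  have hKc := St.con_nonneg
  have hnV := St.norm_nonneg
  obtain ⟨C₁, hC₁, hsup₁⟩ := exists_ae_norm_le St.isOpen St.isBounded one_pos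
  -- The pointwise bound is multiplied by nV when the singular potential acts on χ; this choice of ε
  -- makes the Laplacian's share at most half of ‖l t‖, to be absorbed.
  obtain ⟨C₂, hC₂, hsup₂⟩ := exists_ae_norm_le St.isOpen St.isBounded
    (show 0 < 1 / (2 * (nV + 1)) by positivity)
  set m := A + C₁ * A with hm
  have hm0 : 0 ≤ m := by positivity
  set D := Real.exp (16 * Q * T) *
      (2 * (A + (nV * m + (K * Kc + Q) * A)) + 2 * B * Kc * A) with hD
  have hD0 : 0 ≤ D := by positivity
  set K' := 2 * (D + nV * (C₂ * A) + (K * Kc + Q) * A) with hK'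
  have hK'0 : 0 ≤ K' := by positivity
  refine ⟨D, K', K' + C₁ * A, hD0, hK'0, by positivity, ?_⟩
  intro f φ₀ l₀ χ χ' l F hφ hl τ hτ hQ
  have hsupφ : ∀ᵐ x ∂vol Ω, ‖φ₀ x‖ ≤ m := by
    filter_upwards [hsup₁ _ _ F.dirLap_initial] with x hx
    refine hx.trans ?_
    rw [one_mul, hm]
    gcongr
  have hstep : ∀ s h, 0 ≤ s → 0 < h → s + h ≤ τ → ‖χ (s + h) - χ s‖ ≤ D * h := by
    intro s h hs hh hsh
    refine (F.norm_shift_sub_le St hτ hm0 hsupφ hQ0 hQ hs hh hsh).trans ?_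
    rw [hD]
    gcongr
  have hlip : ∀ s ∈ Icc 0 τ, ∀ t ∈ Icc 0 τ, s < t → ‖χ t - χ s‖ ≤ D * |t - s| := by
    intro s hs t ht hst
    have := hstep s (t - s) hs.1 (by linarith) (by linarith [ht.2])
    rwa [add_sub_cancel, ← abs_of_pos (sub_pos.2 hst)] at this
  have hlip' : ∀ s ∈ Icc 0 τ, ∀ t ∈ Icc 0 τ, ‖χ t - χ s‖ ≤ D * |t - s| := by
    intro s hs t ht
    rcases lt_trichotomy s t with h | h | h
    · exact hlip s hs t ht h
    · simp [h]
    · rw [norm_sub_rev, abs_sub_comm]; exact hlip t ht s hs h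
  refine ⟨hlip', ?_⟩
  filter_upwards [ae_restrict_Ioo_mono hτ F.dirLap, ae_restrict_Ioo_mono hτ F.equation, hQ,
    ae_restrict_Ioo_mono hτ F.prim.ae_hasDerivAt, ae_notMem_finset S _,
    ae_restrict_mem measurableSet_Ioo] with t h1 h2 h3 h4 h5 h6
  have hχ := F.norm_le (t := t) ⟨h6.1.le, h6.2.le.trans hτ⟩
  have hχA := hχ.trans hφ
  -- The Lipschitz bound passes to the derivative wherever it exists; the equation then expresses
  -- the Laplacian by χ' and the potential terms.
  have hd : ‖χ' t‖ ≤ D := by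
    refine h4.le_of_lip' hD0 ?_
    filter_upwards [Ioo_mem_nhds h6.1 h6.2] with s hs
    exact hlip' t (Ioo_subset_Icc_self h6) s (Ioo_subset_Icc_self hs)
  have hb := St.control.bound t ⟨h6.1, h6.2.trans_le hτ⟩ h5
  have hl : ‖l t‖ ≤ K' := by
    have hp := norm_le_of_ae_eq_mul St.aemeasurable hnV St.lintegral_le
      (N := K * Kc + Q) (m := 1 / (2 * (nV + 1)) * ‖l t‖ + C₂ * ‖χ t‖) (by positivity)
      (by positivity) (abs_potential_le St.isOpen St.con_le hb h3) (hsup₂ _ _ h1) h2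
    have e : ‖l t‖ ≤ ‖Complex.I • χ' t + l t‖ + ‖χ' t‖ := by
      have := norm_sub_le (Complex.I • χ' t + l t) (Complex.I • χ' t)
      rwa [add_sub_cancel_left, norm_smul, Complex.norm_I, one_mul] at this
    have e2 : nV * (1 / (2 * (nV + 1)) * ‖l t‖) ≤ ‖l t‖ / 2 := by
      rw [← mul_assoc, mul_one_div, div_mul_eq_mul_div, div_le_div_iff₀ (by positivity) two_pos]
      nlinarith [_root_.norm_nonneg (l t)]
    have e3 : nV * (C₂ * ‖χ t‖) ≤ nV * (C₂ * A) := by gcongr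
    have e4 : (K * Kc + Q) * ‖χ t‖ ≤ (K * Kc + Q) * A := by gcongr
    rw [hK']
    linarith
  refine ⟨hl, ?_⟩
  filter_upwards [hsup₁ _ _ h1] with x hx
  refine hx.trans ?_
  rw [one_mul]
  gcongr

end Regularity

end Hartree
end


/-! ### The energy inequality by finite differences. -/

noncomputable section

namespace Hartree

variable {Ω : Set E3}

section Calculus

variable {H : Type*} [NormedAddCommGroup H] [InnerProductSpace ℂ H]

theorem IsPrim.const_smul {E : Type*} [NormedAddCommGroup E] [NormedSpace ℂ E] [NormedSpace ℝ E]
    [SMulCommClass ℝ ℂ E] {a b : ℝ} {w w' : ℝ → E} (h : IsPrim a b w w') (z : ℂ) :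
    IsPrim a b (fun t => z • w t) (fun t => z • w' t) where
  le := h.le
  integrable := h.integrable.smul z
  eq t ht := by rw [intervalIntegral.integral_smul, h.eq t ht, smul_add]

theorem re_inner_I_smul_comm (x y : H) :
    (inner ℂ x (Complex.I • y)).re = -(inner ℂ y (Complex.I • x)).re := by
  rw [inner_smul_right, inner_smul_right, ← inner_conj_symm x y]
  simp [-inner_conj_symm]

theorem re_inner_I_smul_self (x : H) : (inner ℂ x (Complex.I • x)).re = 0 := by
  have := re_inner_I_smul_comm x x
  linarith

theorem nonneg_of_hasDerivAt_of_nonneg {Φ : ℝ → ℝ} {d δ : ℝ} (h : HasDerivAt Φ d 0) (h0 : Φ 0 = 0)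
    (hδ : 0 < δ) (hΦ : ∀ h ∈ Ioo 0 δ, 0 ≤ Φ h) : 0 ≤ d := by
  have := (hasDerivAt_iff_tendsto_slope.1 h).mono_left
    (nhdsWithin_mono 0 (fun x (hx : 0 < x) => hx.ne') : 𝓝[>] (0 : ℝ) ≤ 𝓝[≠] 0)
  refine ge_of_tendsto this ?_
  filter_upwards [Ioo_mem_nhdsGT hδ] with x hx
  rw [slope_def_field, h0, sub_zero, sub_zero]
  exact div_nonneg (hΦ x hx) hx.1.le

/-- In the application e is twice the self-interaction energy and Re⟨ψ, iψ'⟩ is the quadratic form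
of the full Hamiltonian, in which the self-interaction is counted twice. Subtracting e/2 leaves the
energy, C₁ bounds it initially and B bounds the work of the control. Only first order in h survives,
so q and C₂ do not enter the conclusion. -/
theorem IsPrim.ae_re_inner_le [NormedSpace ℝ H] [CompleteSpace H] [SMulCommClass ℝ ℂ H] {T : ℝ} {ψ ψ' : ℝ → H}
    (hp : IsPrim 0 T ψ ψ') {e : ℝ → ℝ} (he : Continuous e) (he0 : ∀ t ∈ Icc 0 T, 0 ≤ e t)
    {B q C₁ C₂ : ℝ} (hq : 0 ≤ q)
    (hstep : ∀ h, 0 < h → h < T → ∃ ℓ : ℝ → ℝ, (∀ τ, 0 ≤ τ → IntervalIntegrable ℓ volume 0 τ ∧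
      ∫ t in (0 : ℝ)..τ, ℓ t ≤ h * B) ∧ ∀ᵐ s ∂volume.restrict (Ioo 0 (T - h)),
      -ℓ s + (e s - e (s + h)) / 2 - q * h ^ 2 ≤ (inner ℂ (ψ' (s + h)) (Complex.I • ψ s)).re
        + (inner ℂ (ψ (s + h)) (Complex.I • ψ' s)).re)
    (hinit : ∀ h, 0 < h → h < T → -C₁ * h - C₂ * h ^ 2 ≤ (inner ℂ (ψ h) (Complex.I • ψ 0)).re) :
    ∀ᵐ t ∂volume.restrict (Ioo 0 T),
      (inner ℂ (ψ t) (Complex.I • ψ' t)).re ≤ C₁ + B + e t / 2 := by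
  filter_upwards [hp.ae_hasDerivAt, ae_restrict_mem measurableSet_Ioo] with b hb hbT
  have hei : ∀ x y, IntervalIntegrable e volume x y := fun x y => he.intervalIntegrable x y
  -- The pairing of ψ(b + h) with iψ(b) has derivative −Re⟨ψ(b), iψ'(b)⟩ at h = 0. The added terms
  -- make Φ nonnegative for small h > 0, and Φ(0) = 0 then gives the sign of the derivative.
  set Φ : ℝ → ℝ := fun h => (inner ℂ (ψ (b + h)) (Complex.I • ψ b)).re
    + (∫ s in b..(b + h), e s) / 2 + (C₁ + B) * h + (C₂ + q * T) * h ^ 2 with hΦdef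
  have hd : HasDerivAt Φ ((inner ℂ (ψ' b) (Complex.I • ψ b)).re + e b / 2 + (C₁ + B) * 1
      + (C₂ + q * T) * ((2 : ℕ) * (0 : ℝ) ^ (2 - 1) * 1)) 0 := by
    have h0 : HasDerivAt (fun h : ℝ => b + h) 1 0 := (hasDerivAt_id (0 : ℝ)).const_add b
    have h1 : HasDerivAt (fun h => ψ (b + h)) (ψ' b) 0 := by
      have : HasDerivAt ψ (ψ' b) (b + 0) := by rwa [add_zero]
      have := HasDerivAt.scomp (0 : ℝ) this h0
      simpa [Function.comp_def] using this
    have h2 : HasDerivAt (fun h => (inner ℂ (ψ (b + h)) (Complex.I • ψ b)).re)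
        (inner ℂ (ψ' b) (Complex.I • ψ b)).re 0 := by
      have h3 := h1.inner ℂ (hasDerivAt_const (0 : ℝ) (Complex.I • ψ b))
      have h4 := Complex.reCLM.hasFDerivAt.comp_hasDerivAt (0 : ℝ) h3
      have h5 : Complex.reCLM (inner ℂ (ψ (b + 0)) 0 + inner ℂ (ψ' b) (Complex.I • ψ b))
          = (inner ℂ (ψ' b) (Complex.I • ψ b)).re := by rw [inner_zero_right, zero_add]; rfl
      exact h5 ▸ h4
    have h3 : HasDerivAt (fun h => ∫ s in b..(b + h), e s) (e b) 0 := by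
      have : HasDerivAt (fun x => ∫ s in b..x, e s) (e b) (b + 0) := by
        rw [add_zero]
        exact intervalIntegral.integral_hasDerivAt_right (hei b b)
          (he.stronglyMeasurableAtFilter _ _) he.continuousAt
      have := HasDerivAt.scomp (0 : ℝ) this h0
      simpa [Function.comp_def] using this
    exact ((h2.add (h3.div_const 2)).add ((hasDerivAt_id (0 : ℝ)).const_mul (C₁ + B))).add
      (((hasDerivAt_id (0 : ℝ)).pow 2).const_mul (C₂ + q * T))
  have hΦ0 : Φ 0 = 0 := by
    simp only [hΦdef, add_zero, re_inner_I_smul_self, intervalIntegral.integral_same]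
    ring
  have key : ∀ h ∈ Ioo 0 (T - b), 0 ≤ Φ h := by
    intro h hh
    have hhT : h < T := by linarith [hh.2, hbT.1]
    obtain ⟨ℓ, hℓ, hle⟩ := hstep h hh.1 hhT
    obtain ⟨hℓi, hℓB⟩ := hℓ b hbT.1.le
    have p1 := (hp.shift h).mono (c := 0) (d := b) (by linarith [hh.1]) hbT.1.le
      (by linarith [hh.2])
    have p2 := (hp.mono le_rfl hbT.1.le hbT.2.le).const_smul Complex.I
    have hid := p1.re_inner_sub_eq p2
    have i1 := (p1.intervalIntegrable_re_inner_left p2).add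
      (p1.intervalIntegrable_re_inner_right p2)
    have ie : IntervalIntegrable (fun s => e (s + h)) volume 0 b :=
      (he.comp (continuous_add_const h)).intervalIntegrable 0 b
    have iℓ : IntervalIntegrable (fun s => -ℓ s) volume 0 b := hℓi.neg
    have ide : IntervalIntegrable (fun s => (e s - e (s + h)) / 2) volume 0 b :=
      ((hei 0 b).sub ie).div_const 2
    have i2 : IntervalIntegrable (fun s => -ℓ s + (e s - e (s + h)) / 2) volume 0 b :=
      iℓ.add ide
    have hmono : ∫ s in (0 : ℝ)..b, (-ℓ s + (e s - e (s + h)) / 2 - q * h ^ 2)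
        ≤ ∫ s in (0 : ℝ)..b, ((inner ℂ (ψ' (s + h)) (Complex.I • ψ s)).re
          + (inner ℂ (ψ (s + h)) (Complex.I • ψ' s)).re) := by
      refine intervalIntegral.integral_mono_ae_restrict hbT.1.le
        (i2.sub intervalIntegrable_const) i1 ?_
      rw [← restrict_Ioo_eq_restrict_Icc]
      exact ae_restrict_Ioo_mono (by linarith [hh.2]) hle
    rw [← hid, intervalIntegral.integral_sub i2 intervalIntegrable_const,
      intervalIntegral.integral_add iℓ ide,
      intervalIntegral.integral_neg, intervalIntegral.integral_div,
      intervalIntegral.integral_sub (hei 0 b) ie, intervalIntegral.integral_comp_add_right,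
      intervalIntegral.integral_const] at hmono
    simp only [zero_add, sub_zero, smul_eq_mul] at hmono
    -- Telescoping leaves an integral over [0, h], dropped by positivity of e, and one over [b, b +
    -- h], which is the integral included in Φ.
    have e1 : (∫ s in (0 : ℝ)..b, e s) - ∫ s in h..(b + h), e s
        = (∫ s in (0 : ℝ)..h, e s) - ∫ s in b..(b + h), e s := by
      rw [← intervalIntegral.integral_add_adjacent_intervals (hei 0 h) (hei h b),
        ← intervalIntegral.integral_add_adjacent_intervals (hei h b) (hei b (b + h))]
      ring
    have e2 : 0 ≤ ∫ s in (0 : ℝ)..h, e s :=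
      intervalIntegral.integral_nonneg hh.1.le fun s hs => he0 s ⟨hs.1, hs.2.trans hhT.le⟩
    have e3 := hinit h hh.1 hhT
    have e4 : b * (q * h ^ 2) ≤ q * T * h ^ 2 := by
      have : b * (q * h ^ 2) ≤ T * (q * h ^ 2) :=
        mul_le_mul_of_nonneg_right hbT.2.le (by positivity)
      linarith
    rw [e1] at hmono
    simp only [hΦdef]
    linarith
  have := nonneg_of_hasDerivAt_of_nonneg hd hΦ0 (sub_pos.2 hbT.2) key
  rw [re_inner_I_smul_comm] at this
  norm_num at this
  rw [inner_smul_right]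
  simp at this ⊢
  linarith

end Calculus

section Integrals

theorem integrable_re_inner (u v : L2 Ω) :
    Integrable (fun x => (inner ℂ (u x) (v x)).re) (vol Ω) :=
  (L2.integrable_inner (𝕜 := ℂ) u v).re

theorem re_inner_eq_integral (u v : L2 Ω) :
    (inner ℂ u v).re = ∫ x in Ω, (inner ℂ (u x) (v x)).re := by
  rw [L2.inner_def]
  exact (integral_re (L2.integrable_inner (𝕜 := ℂ) u v)).symm

theorem integral_norm_mul_norm_le (u v : L2 Ω) : ∫ x in Ω, ‖u x‖ * ‖v x‖ ≤ ‖u‖ * ‖v‖ := by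
  have := integral_mul_norm_le (fun x => norm_nonneg (u x)) (Lp.memLp u).norm v
  rwa [integral_norm_sq, Real.sqrt_sq (norm_nonneg _)] at this

theorem integrable_norm_mul_norm (u v : L2 Ω) : Integrable (fun x => ‖u x‖ * ‖v x‖) (vol Ω) :=
  (Lp.memLp u).norm.integrable_mul (Lp.memLp v).norm

theorem abs_integral_mul_le {α : Type*} [MeasurableSpace α] {μ : Measure α} {a g G : α → ℝ} {N : ℝ}
    (hN : 0 ≤ N) (ha : ∀ᵐ x ∂μ, |a x| ≤ N) (hG : Integrable G μ) (hg : ∀ᵐ x ∂μ, |g x| ≤ G x) :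
    |∫ x, a x * g x ∂μ| ≤ N * ∫ x, G x ∂μ := by
  rw [← integral_const_mul, ← Real.norm_eq_abs]
  refine norm_integral_le_of_norm_le (hG.const_mul N) ?_
  filter_upwards [ha, hg] with x h1 h2
  rw [Real.norm_eq_abs, abs_mul]
  exact mul_le_mul h1 h2 (abs_nonneg _) hN

theorem abs_re_inner_le (a b : ℂ) : |(inner ℂ a b).re| ≤ ‖a‖ * ‖b‖ :=
  (Complex.abs_re_le_norm _).trans (norm_inner_le_norm (𝕜 := ℂ) a b)

theorem measurable_hartreePotential {k : E3 → ℝ} (hk : Measurable k) (u : L2 Ω) :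
    Measurable (hartreePotential Ω k u) := by
  have : Measurable fun z : E3 × E3 => k (z.1 - z.2) * ‖u z.2‖ ^ 2 :=
    (hk.comp (measurable_fst.sub measurable_snd)).mul
      (((measurable_coe u).comp measurable_snd).norm.pow_const 2)
  exact this.stronglyMeasurable.integral_prod_right.measurable

end Integrals

section Symmetric

variable {k : E3 → ℝ} {u v u₁ u₂ : L2 Ω} {Q : ℝ}

theorem PotBound.ae_abs_le (hΩ : IsOpen Ω) (q : PotBound Ω k (fun x => ‖u x‖ₑ) Q) :
    ∀ᵐ x ∂vol Ω, |hartreePotential Ω k u x| ≤ Q := by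
  filter_upwards [ae_restrict_mem hΩ.measurableSet] with x hx
  exact q.abs_hartreePotential_le hx

theorem PotBound.integrable_mul (hΩ : IsOpen Ω) (hk : Measurable k)
    (q : PotBound Ω k (fun x => ‖u x‖ₑ) Q) {g : E3 → ℝ} (hg : Integrable g (vol Ω)) :
    Integrable (fun x => hartreePotential Ω k u x * g x) (vol Ω) :=
  hg.bdd_mul (c := Q) (measurable_hartreePotential hk u).aestronglyMeasurable (q.ae_abs_le hΩ)

theorem PotBound.integral_comm (hΩ : IsOpen Ω) (hk : Measurable k) (hs : ∀ x, k (-x) = k x)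
    (q : PotBound Ω k (fun x => ‖u x‖ₑ) Q) :
    ∫ x in Ω, hartreePotential Ω k u x * ‖v x‖ ^ 2
      = ∫ x in Ω, hartreePotential Ω k v x * ‖u x‖ ^ 2 := by
  simp only [hartreePotential, ← integral_mul_const]
  have hm : Measurable fun z : E3 × E3 => k (z.1 - z.2) * ‖u z.2‖ ^ 2 * ‖v z.1‖ ^ 2 :=
    ((hk.comp (measurable_fst.sub measurable_snd)).mul
      (((measurable_coe u).comp measurable_snd).norm.pow_const 2)).mul
      (((measurable_coe v).comp measurable_fst).norm.pow_const 2)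
  rw [integral_integral_swap]
  · refine integral_congr_ae (ae_of_all _ fun y => integral_congr_ae (ae_of_all _ fun x => ?_))
    simp only
    rw [← hs, neg_sub]
    ring
  · refine ⟨hm.aestronglyMeasurable, ?_⟩
    unfold HasFiniteIntegral
    rw [lintegral_prod _ (by exact hm.enorm.aemeasurable)]
    refine lt_of_le_of_lt (b := ENNReal.ofReal Q * ENNReal.ofReal (‖v‖ ^ 2)) ?_
      (ENNReal.mul_lt_top ENNReal.ofReal_lt_top ENNReal.ofReal_lt_top)
    rw [← lintegral_enorm_sq_eq, ← lintegral_const_mul' _ _ ENNReal.ofReal_ne_top]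
    refine setLIntegral_mono' hΩ.measurableSet fun x hx => ?_
    have : ∀ y, ‖Function.uncurry (fun x y => k (x - y) * ‖u y‖ ^ 2 * ‖v x‖ ^ 2) (x, y)‖ₑ
        = (‖k (x - y)‖ₑ * ‖u y‖ₑ ^ 2) * ‖v x‖ₑ ^ 2 := fun y => by
      simp [Function.uncurry, enorm_mul, enorm_pow]
    simp only [this]
    rw [lintegral_mul_const' _ _ (by simp)]
    gcongr
    exact q.left x hx

/-- Twice the self-interaction energy. -/
def selfEnergy (Ω : Set E3) (k : E3 → ℝ) (u : L2 Ω) : ℝ :=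
  ∫ x in Ω, hartreePotential Ω k u x * ‖u x‖ ^ 2

theorem hartreePotential_nonneg (h0 : ∀ x, 0 ≤ k x) (u : E3 → ℂ) (x : E3) :
    0 ≤ hartreePotential Ω k u x :=
  integral_nonneg fun _ => mul_nonneg (h0 _) (sq_nonneg _)

theorem selfEnergy_nonneg (h0 : ∀ x, 0 ≤ k x) (u : L2 Ω) : 0 ≤ selfEnergy Ω k u :=
  integral_nonneg fun _ => mul_nonneg (hartreePotential_nonneg h0 _ _) (sq_nonneg _)

/-- The evenness of the kernel makes the mixed terms equal, so the difference is the integral of (A₁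
+ A₂)(|u₁|² − |u₂|²), with A₁ and A₂ the potentials of the two states. -/
theorem abs_selfEnergy_sub_le (hΩ : IsOpen Ω) (hk : Measurable k) (hs : ∀ x, k (-x) = k x)
    (q₁ : PotBound Ω k (fun x => ‖u₁ x‖ₑ) Q) (q₂ : PotBound Ω k (fun x => ‖u₂ x‖ₑ) Q) :
    |selfEnergy Ω k u₁ - selfEnergy Ω k u₂| ≤ 2 * Q * (‖u₁ - u₂‖ * (‖u₁‖ + ‖u₂‖)) := by
  have hQ := q₁.nonneg
  have i : ∀ {u : L2 Ω}, PotBound Ω k (fun x => ‖u x‖ₑ) Q → ∀ v : L2 Ω,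
      Integrable (fun x => hartreePotential Ω k u x * ‖v x‖ ^ 2) (vol Ω) := fun q v =>
    q.integrable_mul hΩ hk (integrable_norm_sq v)
  have hG : Integrable (fun x => ‖(u₁ - u₂) x‖ * ‖u₁ x‖ + ‖(u₁ - u₂) x‖ * ‖u₂ x‖) (vol Ω) :=
    (integrable_norm_mul_norm _ _).add (integrable_norm_mul_norm _ _)
  have e : selfEnergy Ω k u₁ - selfEnergy Ω k u₂ = ∫ x in Ω, (hartreePotential Ω k u₁ x
      + hartreePotential Ω k u₂ x) * (‖u₁ x‖ ^ 2 - ‖u₂ x‖ ^ 2) := by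
    have h1 := q₁.integral_comm (v := u₂) hΩ hk hs
    have h2 : ∀ x, (hartreePotential Ω k u₁ x + hartreePotential Ω k u₂ x)
        * (‖u₁ x‖ ^ 2 - ‖u₂ x‖ ^ 2) = (hartreePotential Ω k u₁ x * ‖u₁ x‖ ^ 2
          - hartreePotential Ω k u₁ x * ‖u₂ x‖ ^ 2) + (hartreePotential Ω k u₂ x * ‖u₁ x‖ ^ 2
          - hartreePotential Ω k u₂ x * ‖u₂ x‖ ^ 2) := fun x => by ring
    simp only [h2]
    have j : ∀ {u : L2 Ω}, PotBound Ω k (fun x => ‖u x‖ₑ) Q → Integrable (fun x =>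
        hartreePotential Ω k u x * ‖u₁ x‖ ^ 2 - hartreePotential Ω k u x * ‖u₂ x‖ ^ 2) (vol Ω) :=
      fun q => (i q u₁).sub (i q u₂)
    rw [integral_add (j q₁) (j q₂),
      integral_sub (i q₁ u₁) (i q₁ u₂), integral_sub (i q₂ u₁) (i q₂ u₂), h1]
    unfold selfEnergy
    ring
  rw [e]
  refine (abs_integral_mul_le (N := 2 * Q) (by positivity) ?_ hG ?_).trans ?_
  · filter_upwards [q₁.ae_abs_le hΩ, q₂.ae_abs_le hΩ] with x h1 h2
    exact (abs_add_le _ _).trans (by linarith)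
  · filter_upwards [Lp.coeFn_sub u₁ u₂] with x hx
    rw [sq_sub_sq, abs_mul, hx, Pi.sub_apply, ← mul_add, mul_comm, abs_of_nonneg (show 0 ≤ ‖u₁ x‖ + ‖u₂ x‖ by positivity)]
    exact mul_le_mul_of_nonneg_right (abs_norm_sub_norm_le _ _) (by positivity)
  · rw [integral_add (integrable_norm_mul_norm _ _) (integrable_norm_mul_norm _ _), mul_add ‖u₁ - u₂‖]
    have := integral_norm_mul_norm_le (u₁ - u₂) u₁
    have := integral_norm_mul_norm_le (u₁ - u₂) u₂
    gcongr

end Symmetric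

end Hartree
end


/-! ### Commutator identities for two states. -/

noncomputable section

namespace Hartree

variable {Ω : Set E3}

section Commutator

variable {u₁ u₂ l₁ l₂ d₁ d₂ : L2 Ω}

theorem integrable_mul_re_inner {P : E3 → ℝ} {p u v : L2 Ω}
    (hp : p =ᵐ[vol Ω] fun x => (P x : ℂ) * u x) :
    Integrable (fun x => P x * (inner ℂ (u x) (v x)).re) (vol Ω) := by
  refine (integrable_re_inner p v).congr ?_
  filter_upwards [hp] with x hx
  rw [hx, ← smul_eq_mul, inner_smul_left, Complex.conj_ofReal, Complex.re_ofReal_mul]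

theorem re_inner_eq_integral_mul {P : E3 → ℝ} {p u v : L2 Ω}
    (hp : p =ᵐ[vol Ω] fun x => (P x : ℂ) * u x) :
    (inner ℂ p v).re = ∫ x in Ω, P x * (inner ℂ (u x) (v x)).re := by
  rw [re_inner_eq_integral]
  refine integral_congr_ae ?_
  filter_upwards [hp] with x hx
  rw [hx, ← smul_eq_mul, inner_smul_left, Complex.conj_ofReal, Complex.re_ofReal_mul]

theorem re_inner_comm' (a b : ℂ) : (inner ℂ a b).re = (inner ℂ b a).re :=
  (inner_re_symm (𝕜 := ℂ) a b)

/-- The two Laplacian terms cancel by symmetry. With u₁ and u₂ the states at times s + h and s, the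
left side is the derivative in s of their pairing; no derivative of the potential is needed. -/
theorem re_inner_commutator {P₁ P₂ : E3 → ℝ} (h₁ : DirLap Ω u₁ l₁)
    (h₂ : DirLap Ω u₂ l₂) (e₁ : ⇑(Complex.I • d₁ + l₁) =ᵐ[vol Ω] fun x => (P₁ x : ℂ) * u₁ x)
    (e₂ : ⇑(Complex.I • d₂ + l₂) =ᵐ[vol Ω] fun x => (P₂ x : ℂ) * u₂ x) :
    (inner ℂ d₁ (Complex.I • u₂)).re + (inner ℂ u₁ (Complex.I • d₂)).re
      = ∫ x in Ω, (P₂ x - P₁ x) * (inner ℂ (u₁ x) (u₂ x)).re := by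
  set p₁ := Complex.I • d₁ + l₁ with hp₁
  set p₂ := Complex.I • d₂ + l₂ with hp₂
  have i1 := integrable_mul_re_inner (v := u₂) e₁
  have i2 := integrable_mul_re_inner (v := u₁) e₂
  have s1 := re_inner_eq_integral_mul (v := u₂) e₁
  have s2 := re_inner_eq_integral_mul (v := u₁) e₂
  simp only [re_inner_comm' (u₂ _) (u₁ _)] at i2 s2
  simp only [sub_mul]
  rw [integral_sub i2 i1, ← s1, ← s2]
  have hc := congrArg Complex.re (h₁.inner_comm h₂)
  have hc2 : (inner ℂ p₂ u₁).re = (inner ℂ u₁ p₂).re := inner_re_symm (𝕜 := ℂ) _ _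
  have e3 : inner ℂ u₁ (Complex.I • d₂) = inner ℂ u₁ p₂ - inner ℂ u₁ l₂ := by
    rw [← inner_sub_right, hp₂, add_sub_cancel_right]
  have e4 : inner ℂ d₁ (Complex.I • u₂) = -(inner ℂ p₁ u₂ - inner ℂ l₁ u₂) := by
    rw [← inner_sub_left, hp₁, add_sub_cancel_right, inner_smul_left, inner_smul_right]
    simp
  rw [e3, e4, hc2]
  simp only [Complex.neg_re, Complex.sub_re]
  linarith

theorem re_inner_eq_half (a b : ℂ) :
    (inner ℂ a b).re = (‖a‖ ^ 2 + ‖b‖ ^ 2 - ‖a - b‖ ^ 2) / 2 := by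
  have := norm_sub_sq (𝕜 := ℂ) a b
  simp only [RCLike.re_eq_complex_re] at this
  linarith

variable {k : E3 → ℝ} {V Vcon : E3 → ℝ} {Kc Q a₁ a₂ : ℝ}

/-- The identity 2 Re⟨a, b⟩ = |a|² + |b|² − |a − b|² splits the self-consistent part into half the
difference of the self-energies, two mixed terms that cancel for an even kernel, and a remainder
quadratic in u₁ − u₂. -/
theorem re_inner_commutator_ge (hΩ : IsOpen Ω) (hcon : ∀ᵐ x ∂vol Ω, |Vcon x| ≤ Kc) (hKc : 0 ≤ Kc)
    (mcon : AEMeasurable Vcon (vol Ω)) (hk : Measurable k) (hs : ∀ x, k (-x) = k x)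
    (h₁ : DirLap Ω u₁ l₁) (h₂ : DirLap Ω u₂ l₂)
    (e₁ : ⇑(Complex.I • d₁ + l₁) =ᵐ[vol Ω] fun x =>
      ((V x + a₁ * Vcon x + hartreePotential Ω k u₁ x : ℝ) : ℂ) * u₁ x)
    (e₂ : ⇑(Complex.I • d₂ + l₂) =ᵐ[vol Ω] fun x =>
      ((V x + a₂ * Vcon x + hartreePotential Ω k u₂ x : ℝ) : ℂ) * u₂ x)
    (q₁ : PotBound Ω k (fun x => ‖u₁ x‖ₑ) Q) (q₂ : PotBound Ω k (fun x => ‖u₂ x‖ₑ) Q) :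
    -(|a₁ - a₂| * Kc * (‖u₁‖ * ‖u₂‖)) + (selfEnergy Ω k u₂ - selfEnergy Ω k u₁) / 2
        - Q * ‖u₁ - u₂‖ ^ 2
      ≤ (inner ℂ d₁ (Complex.I • u₂)).re + (inner ℂ u₁ (Complex.I • d₂)).re := by
  have hQ := q₁.nonneg
  rw [re_inner_commutator h₁ h₂ e₁ e₂]
  set A₁ := hartreePotential Ω k u₁
  set A₂ := hartreePotential Ω k u₂
  have i : ∀ {u : L2 Ω}, PotBound Ω k (fun x => ‖u x‖ₑ) Q → ∀ v : L2 Ω,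
      Integrable (fun x => hartreePotential Ω k u x * ‖v x‖ ^ 2) (vol Ω) := fun q v =>
    q.integrable_mul hΩ hk (integrable_norm_sq v)
  have e : ∀ᵐ x ∂vol Ω, (V x + a₂ * Vcon x + A₂ x - (V x + a₁ * Vcon x + A₁ x))
      * (inner ℂ (u₁ x) (u₂ x)).re = ((a₂ - a₁) * Vcon x) * (inner ℂ (u₁ x) (u₂ x)).re
      + (((A₂ x * ‖u₂ x‖ ^ 2 - A₁ x * ‖u₁ x‖ ^ 2) + (A₂ x * ‖u₁ x‖ ^ 2 - A₁ x * ‖u₂ x‖ ^ 2)) / 2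
        + ((A₁ x - A₂ x) / 2) * ‖(u₁ - u₂) x‖ ^ 2) := by
    filter_upwards [Lp.coeFn_sub u₁ u₂] with x hx
    rw [hx, Pi.sub_apply, re_inner_eq_half]
    ring
  rw [integral_congr_ae e]
  have hVb : ∀ᵐ x ∂vol Ω, |(a₂ - a₁) * Vcon x| ≤ |a₁ - a₂| * Kc := by
    filter_upwards [hcon] with x hx
    rw [abs_mul, abs_sub_comm]
    exact mul_le_mul_of_nonneg_left hx (abs_nonneg _)
  have hAb : ∀ᵐ x ∂vol Ω, |(A₁ x - A₂ x) / 2| ≤ Q := by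
    filter_upwards [q₁.ae_abs_le hΩ, q₂.ae_abs_le hΩ] with x y1 y2
    rw [abs_le] at y1 y2 ⊢
    constructor <;> linarith [y1.1, y1.2, y2.1, y2.2]
  have j1 : Integrable (fun x => ((a₂ - a₁) * Vcon x) * (inner ℂ (u₁ x) (u₂ x)).re) (vol Ω) :=
    (integrable_re_inner u₁ u₂).bdd_mul (mcon.const_mul _).aestronglyMeasurable hVb
  have j2 : Integrable (fun x => A₂ x * ‖u₂ x‖ ^ 2 - A₁ x * ‖u₁ x‖ ^ 2) (vol Ω) :=
    (i q₂ u₂).sub (i q₁ u₁)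
  have j3 : Integrable (fun x => A₂ x * ‖u₁ x‖ ^ 2 - A₁ x * ‖u₂ x‖ ^ 2) (vol Ω) :=
    (i q₂ u₁).sub (i q₁ u₂)
  have j4 : Integrable (fun x => ((A₁ x - A₂ x) / 2) * ‖(u₁ - u₂) x‖ ^ 2) (vol Ω) :=
    (integrable_norm_sq _).bdd_mul (((measurable_hartreePotential hk u₁).sub
      (measurable_hartreePotential hk u₂)).div_const 2).aestronglyMeasurable hAb
  have j5 : Integrable (fun x => ((A₂ x * ‖u₂ x‖ ^ 2 - A₁ x * ‖u₁ x‖ ^ 2)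
      + (A₂ x * ‖u₁ x‖ ^ 2 - A₁ x * ‖u₂ x‖ ^ 2)) / 2) (vol Ω) := (j2.add j3).div_const 2
  have j6 : Integrable (fun x => ((A₂ x * ‖u₂ x‖ ^ 2 - A₁ x * ‖u₁ x‖ ^ 2)
      + (A₂ x * ‖u₁ x‖ ^ 2 - A₁ x * ‖u₂ x‖ ^ 2)) / 2
        + ((A₁ x - A₂ x) / 2) * ‖(u₁ - u₂) x‖ ^ 2) (vol Ω) := j5.add j4
  rw [integral_add j1 j6, integral_add j5 j4, integral_div, integral_add j2 j3,
    integral_sub (i q₂ u₂) (i q₁ u₁), integral_sub (i q₂ u₁) (i q₁ u₂),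
    q₁.integral_comm (v := u₂) hΩ hk hs, sub_self, add_zero]
  have b1 := abs_integral_mul_le (by positivity) hVb (integrable_norm_mul_norm u₁ u₂)
    (ae_of_all _ fun x => abs_re_inner_le (u₁ x) (u₂ x))
  have b2 := abs_integral_mul_le hQ hAb (integrable_norm_sq (u₁ - u₂))
    (ae_of_all _ fun x => (abs_of_nonneg (sq_nonneg ‖(u₁ - u₂) x‖)).le)
  rw [integral_norm_sq] at b2
  have b3 : |a₁ - a₂| * Kc * ∫ x in Ω, ‖u₁ x‖ * ‖u₂ x‖ ≤ |a₁ - a₂| * Kc * (‖u₁‖ * ‖u₂‖) :=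
    mul_le_mul_of_nonneg_left (integral_norm_mul_norm_le u₁ u₂) (by positivity)
  have c1 := neg_abs_le (∫ x in Ω, ((a₂ - a₁) * Vcon x) * (inner ℂ (u₁ x) (u₂ x)).re)
  have c2 := neg_abs_le (∫ x in Ω, ((A₁ x - A₂ x) / 2) * ‖(u₁ - u₂) x‖ ^ 2)
  unfold selfEnergy
  linarith

/-- Writing u₁ = u₂ + (u₁ − u₂) and exchanging the roles of the densities replaces the potential of
u₁ by that of the initial state u₂, bounded by Q₀. The bound Q of the later state multiplies only
‖u₁ − u₂‖, which is of order h in the application. -/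
theorem re_inner_initial_ge (hΩ : IsOpen Ω) {K nV m Q₀ : ℝ} (hV : AEMeasurable V (vol Ω))
    (hnV0 : 0 ≤ nV) (hnV : ∫⁻ x in Ω, ‖V x‖ₑ ^ 2 ≤ ENNReal.ofReal (nV ^ 2))
    (hcon : ∀ᵐ x ∂vol Ω, |Vcon x| ≤ Kc) (hKc : 0 ≤ Kc) (hK : 0 ≤ K) (ha : |a₁| ≤ K)
    (mcon : AEMeasurable Vcon (vol Ω)) (hk : Measurable k) (hs : ∀ x, k (-x) = k x) (hm : 0 ≤ m)
    (hu : ∀ᵐ x ∂vol Ω, ‖u₂ x‖ ≤ m) (h₁ : DirLap Ω u₁ l₁) (h₂ : DirLap Ω u₂ l₂)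
    (e₁ : ⇑(Complex.I • d₁ + l₁) =ᵐ[vol Ω] fun x =>
      ((V x + a₁ * Vcon x + hartreePotential Ω k u₁ x : ℝ) : ℂ) * u₁ x)
    (q₁ : PotBound Ω k (fun x => ‖u₁ x‖ₑ) Q) (q₂ : PotBound Ω k (fun x => ‖u₂ x‖ₑ) Q₀) :
    -(‖u₁‖ * ‖l₂‖ + ‖u₁‖ * (nV * m + K * Kc * ‖u₂‖) + Q₀ * ‖u₁‖ ^ 2 + Q * (‖u₁ - u₂‖ * ‖u₂‖))
      ≤ (inner ℂ d₁ (Complex.I • u₂)).re := by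
  have hQ := q₁.nonneg
  have e₂ : ⇑(Complex.I • (Complex.I • l₂) + l₂) =ᵐ[vol Ω] fun x => ((0 : ℝ) : ℂ) * u₂ x := by
    rw [smul_smul, Complex.I_mul_I, neg_one_smul, neg_add_cancel]
    filter_upwards [ae_coe_zero Ω] with x hx
    rw [hx, Complex.ofReal_zero, zero_mul]
  have key := re_inner_commutator h₁ h₂ e₁ e₂
  set A₁ := hartreePotential Ω k u₁
  set W : E3 → ℝ := fun x => V x + a₁ * Vcon x with hW
  have mW : AEMeasurable W (vol Ω) := hV.add (mcon.const_mul _)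
  have hWle : ∀ᵐ x ∂vol Ω, |W x| ≤ |V x| + K * Kc := by
    filter_upwards [hcon] with x hx
    refine (abs_add_le _ _).trans (add_le_add le_rfl ?_)
    rw [abs_mul]
    exact mul_le_mul ha hx (abs_nonneg _) hK
  have hlin := lintegral_mul_potential_le hV hnV0 hnV (by positivity) hm hWle hu u₁
  have mg : AEStronglyMeasurable (fun x => W x * (inner ℂ (u₁ x) (u₂ x)).re) (vol Ω) :=
    mW.aestronglyMeasurable.mul (integrable_re_inner u₁ u₂).aestronglyMeasurable
  have hle : ∫⁻ x in Ω, ‖W x * (inner ℂ (u₁ x) (u₂ x)).re‖ₑ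
      ≤ ENNReal.ofReal (‖u₁‖ * (nV * m + K * Kc * ‖u₂‖)) := by
    refine le_trans (lintegral_mono fun x => ?_) hlin
    rw [enorm_mul]
    have : ‖(inner ℂ (u₁ x) (u₂ x)).re‖ₑ ≤ ‖u₁ x‖ₑ * ‖u₂ x‖ₑ := by
      rw [← ofReal_norm, ← ofReal_norm, ← ofReal_norm, ← ENNReal.ofReal_mul (norm_nonneg _)]
      exact ENNReal.ofReal_le_ofReal (abs_re_inner_le _ _)
    refine (mul_le_mul' le_rfl this).trans (le_of_eq ?_)
    ring
  have jW : Integrable (fun x => W x * (inner ℂ (u₁ x) (u₂ x)).re) (vol Ω) :=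
    ⟨mg, lt_of_le_of_lt hle ENNReal.ofReal_lt_top⟩
  have bW : |∫ x in Ω, W x * (inner ℂ (u₁ x) (u₂ x)).re|
      ≤ ‖u₁‖ * (nV * m + K * Kc * ‖u₂‖) := by
    rw [← ENNReal.ofReal_le_ofReal_iff (by positivity), ← Real.norm_eq_abs, ofReal_norm]
    exact (enorm_integral_le_lintegral_enorm _).trans hle
  have j1 : Integrable (fun x => A₁ x * ‖u₂ x‖ ^ 2) (vol Ω) :=
    q₁.integrable_mul hΩ hk (integrable_norm_sq u₂)
  have j2 : Integrable (fun x => A₁ x * (inner ℂ ((u₁ - u₂) x) (u₂ x)).re) (vol Ω) :=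
    q₁.integrable_mul hΩ hk (integrable_re_inner (u₁ - u₂) u₂)
  have j3 : Integrable (fun x => A₁ x * ‖u₂ x‖ ^ 2
      + A₁ x * (inner ℂ ((u₁ - u₂) x) (u₂ x)).re) (vol Ω) := j1.add j2
  have e : ∀ᵐ x ∂vol Ω, (0 - (V x + a₁ * Vcon x + A₁ x)) * (inner ℂ (u₁ x) (u₂ x)).re
      = -(W x * (inner ℂ (u₁ x) (u₂ x)).re + (A₁ x * ‖u₂ x‖ ^ 2
        + A₁ x * (inner ℂ ((u₁ - u₂) x) (u₂ x)).re)) := by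
    filter_upwards [Lp.coeFn_sub u₁ u₂] with x hx
    have : (inner ℂ (u₂ x) (u₂ x)).re = ‖u₂ x‖ ^ 2 := inner_self_eq_norm_sq (𝕜 := ℂ) (u₂ x)
    rw [hx, Pi.sub_apply, inner_sub_left, Complex.sub_re, this, hW]
    ring
  rw [integral_congr_ae e, integral_neg, integral_add jW j3, integral_add j1 j2,
    q₁.integral_comm (v := u₂) hΩ hk hs] at key
  have b1 := abs_integral_mul_le q₂.nonneg (q₂.ae_abs_le hΩ) (integrable_norm_sq u₁)
    (ae_of_all _ fun x => (abs_of_nonneg (sq_nonneg ‖u₁ x‖)).le)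
  rw [integral_norm_sq] at b1
  have b2 := abs_integral_mul_le hQ (q₁.ae_abs_le hΩ) (integrable_norm_mul_norm (u₁ - u₂) u₂)
    (ae_of_all _ fun x => abs_re_inner_le ((u₁ - u₂) x) (u₂ x))
  have b3 : Q * ∫ x in Ω, ‖(u₁ - u₂) x‖ * ‖u₂ x‖ ≤ Q * (‖u₁ - u₂‖ * ‖u₂‖) :=
    mul_le_mul_of_nonneg_left (integral_norm_mul_norm_le _ _) hQ
  have b4 : (inner ℂ u₁ (Complex.I • Complex.I • l₂)).re ≤ ‖u₁‖ * ‖l₂‖ := by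
    refine (Complex.re_le_norm _).trans ((norm_inner_le_norm _ _).trans ?_)
    rw [norm_smul, norm_smul, Complex.norm_I, one_mul, one_mul]
  have c1 := (abs_le.1 bW).2
  have c2 := (abs_le.1 b1).2
  have c3 := (abs_le.1 b2).2
  linarith

end Commutator

end Hartree
end


/-! ### The energy bound for Coulomb solutions. -/

noncomputable section

namespace Hartree

variable {Ω : Set E3}

section Energy

variable {T : ℝ} {V Vcon : E3 → ℝ} {c : ℝ → ℝ} {S : Finset ℝ} {K B Kc nV : ℝ}

/-- The equation is paired with u; the singular potential is handled by the Cauchy–Schwarz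
inequality between V and |u|², which calls for the L⁴ norm. -/
theorem kinetic_le {k : E3 → ℝ} {u l d : L2 Ω} {a Q J : ℝ} (hΩ : IsOpen Ω)
    (hV : AEMeasurable V (vol Ω)) (hnV0 : 0 ≤ nV)
    (hnV : ∫⁻ x in Ω, ‖V x‖ₑ ^ 2 ≤ ENNReal.ofReal (nV ^ 2))
    (hcon : ∀ᵐ x ∂vol Ω, |Vcon x| ≤ Kc) (hK : 0 ≤ K) (ha : |a| ≤ K)
    (hk : Measurable k)
    (e : ⇑(Complex.I • d + l) =ᵐ[vol Ω] fun x =>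
      ((V x + a * Vcon x + hartreePotential Ω k u x : ℝ) : ℂ) * u x)
    (q : PotBound Ω k (fun x => ‖u x‖ₑ) Q) (hJ0 : 0 ≤ J)
    (hJ : ∫⁻ x in Ω, ‖u x‖ₑ ^ 4 ≤ ENNReal.ofReal (J ^ 2)) :
    -(inner ℂ u l).re ≤ (inner ℂ u (Complex.I • d)).re - selfEnergy Ω k u
      + (nV * J + K * Kc * ‖u‖ ^ 2) := by
  set p := Complex.I • d + l with hp
  have h1 := integrable_mul_re_inner (v := u) e
  have h2 := re_inner_eq_integral_mul (v := u) e
  have h3 : ∀ x, (inner ℂ (u x) (u x)).re = ‖u x‖ ^ 2 := fun x =>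
    inner_self_eq_norm_sq (𝕜 := ℂ) (u x)
  simp only [h3] at h1 h2
  have h4 : (inner ℂ p u).re = (inner ℂ u p).re := inner_re_symm (𝕜 := ℂ) _ _
  have h5 : inner ℂ u l = inner ℂ u p - inner ℂ u (Complex.I • d) := by
    rw [← inner_sub_right, hp, add_sub_cancel_left]
  have j1 : Integrable (fun x => hartreePotential Ω k u x * ‖u x‖ ^ 2) (vol Ω) :=
    q.integrable_mul hΩ hk (integrable_norm_sq u)
  have hVJ : ∫⁻ x in Ω, ‖V x * ‖u x‖ ^ 2‖ₑ ≤ ENNReal.ofReal (nV * J) := by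
    have h := ENNReal.lintegral_mul_le_Lp_mul_Lq (vol Ω) Real.HolderConjugate.two_two
      hV.enorm ((measurable_coe u).enorm.pow_const 2).aemeasurable
    simp only [Pi.mul_apply, ENNReal.rpow_ofNat] at h
    have e1 : ∀ x, ‖V x * ‖u x‖ ^ 2‖ₑ = ‖V x‖ₑ * ‖u x‖ₑ ^ 2 := fun x => by
      simp [enorm_mul, enorm_pow]
    have e2 : ∀ y, (‖u y‖ₑ ^ 2) ^ 2 = ‖u y‖ₑ ^ 4 := fun y => by rw [← pow_mul]
    simp only [e1]
    simp only [e2] at h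
    refine h.trans ((mul_le_mul' (ENNReal.rpow_le_rpow hnV (by norm_num))
      (ENNReal.rpow_le_rpow hJ (by norm_num))).trans (le_of_eq ?_))
    rw [ENNReal.ofReal_rpow_of_nonneg (by positivity) (by norm_num),
      ENNReal.ofReal_rpow_of_nonneg (by positivity) (by norm_num),
      ← ENNReal.ofReal_mul (by positivity), ← Real.sqrt_eq_rpow, ← Real.sqrt_eq_rpow,
      Real.sqrt_sq hnV0, Real.sqrt_sq hJ0]
  have j2 : Integrable (fun x => V x * ‖u x‖ ^ 2) (vol Ω) :=
    ⟨(hV.mul ((measurable_coe u).norm.pow_const 2).aemeasurable).aestronglyMeasurable,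
      lt_of_le_of_lt hVJ ENNReal.ofReal_lt_top⟩
  have j3 : Integrable (fun x => (a * Vcon x) * ‖u x‖ ^ 2) (vol Ω) := by
    refine ((h1.sub j1).sub j2).congr (ae_of_all _ fun x => ?_)
    simp only [Pi.sub_apply]
    ring
  have j4 : Integrable (fun x => V x * ‖u x‖ ^ 2 + (a * Vcon x) * ‖u x‖ ^ 2) (vol Ω) := j2.add j3
  have e3 : ∫ x in Ω, (V x + a * Vcon x + hartreePotential Ω k u x) * ‖u x‖ ^ 2
      = (∫ x in Ω, V x * ‖u x‖ ^ 2) + (∫ x in Ω, (a * Vcon x) * ‖u x‖ ^ 2)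
        + selfEnergy Ω k u := by
    simp only [add_mul (V _ + _), add_mul (V _)]
    rw [integral_add j4 j1, integral_add j2 j3]
    rfl
  have b1 : |∫ x in Ω, V x * ‖u x‖ ^ 2| ≤ nV * J := by
    rw [← ENNReal.ofReal_le_ofReal_iff (by positivity), ← Real.norm_eq_abs, ofReal_norm]
    exact (enorm_integral_le_lintegral_enorm _).trans hVJ
  have hKKc : ∀ᵐ x ∂vol Ω, |a * Vcon x| ≤ K * Kc := by
    filter_upwards [hcon] with x hx
    rw [abs_mul]
    exact mul_le_mul ha hx (abs_nonneg _) hK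
  have b2 : |∫ x in Ω, (a * Vcon x) * ‖u x‖ ^ 2| ≤ K * Kc * ‖u‖ ^ 2 := by
    rw [← integral_norm_sq, ← integral_const_mul, ← Real.norm_eq_abs]
    refine norm_integral_le_of_norm_le ((integrable_norm_sq u).const_mul _) ?_
    filter_upwards [hKKc] with x hx
    rw [Real.norm_eq_abs, abs_mul, abs_of_nonneg (sq_nonneg ‖u x‖)]
    gcongr
  have c1 := neg_abs_le (∫ x in Ω, V x * ‖u x‖ ^ 2)
  have c2 := neg_abs_le (∫ x in Ω, (a * Vcon x) * ‖u x‖ ^ 2)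
  rw [h5, Complex.sub_re, ← h4, h2, e3]
  linarith

/-- Conservation of energy, up to the work of the control, bounds the self-consistent potential of
solutions with the Coulomb kernel. -/
theorem Setting.exists_potBound_coulomb (St : Setting Ω T V Vcon c S K B Kc nV) {A : ℝ}
    (hA : 0 ≤ A) : ∃ Q : ℝ, 0 ≤ Q ∧ ∀ {φ₀ l₀ : L2 Ω} {ψ ψ' l : ℝ → L2 Ω},
      Flow Ω T V Vcon c coulomb φ₀ l₀ ψ ψ' l → ‖φ₀‖ ≤ A → ‖l₀‖ ≤ A →
      ∀ᵐ t ∂volume.restrict (Ioo 0 T), PotBound Ω coulomb (fun x => ‖ψ t x‖ₑ) Q := by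
  have hK := St.control.nonneg
  have hB := St.control.nonneg'
  have hKc := St.con_nonneg
  have hnV := St.norm_nonneg
  obtain ⟨C, hC, hsup⟩ := exists_ae_norm_le St.isOpen St.isBounded one_pos
  obtain ⟨C₄, hC₄, hfour⟩ := exists_lintegral_pow_four_le Ω (ε := 1 / (2 * (nV + 1)))
    (by positivity)
  obtain ⟨F₁, F₂, hF₁, hF₂, hk₁, hk₂⟩ := exists_lintegral_coulomb_le St.isBounded
  set m := A + C * A with hm
  have hm0 : 0 ≤ m := by positivity
  set Q₀ := F₁ * m ^ 2 with hQ₀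
  set C₁ := A * A + A * (nV * m + K * Kc * A) + Q₀ * A ^ 2 with hC₁
  set E := 2 * (C₁ + B * (Kc * (A * A)) + K * Kc * A ^ 2 + nV * (C₄ * A ^ 2)) with hE
  have hE0 : 0 ≤ E := by positivity
  refine ⟨F₂ * (1 / (2 * (nV + 1)) * E + C₄ * A ^ 2), by positivity, ?_⟩
  intro φ₀ l₀ ψ ψ' l F hφ hl
  have hnorm : ∀ t ∈ Icc 0 T, ‖ψ t‖ ≤ A := fun t ht => (F.norm_le ht).trans hφ
  -- This bound depends on the particular solution. It makes all quantities finite and supplies the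
  -- coefficients of h², but is absent from the final constant.
  obtain ⟨b, hb0, hb⟩ := F.bounded
  set Q := F₁ * (b + C * A) ^ 2 with hQ
  have hQ0 : 0 ≤ Q := by positivity
  have hpot : ∀ᵐ t ∂volume.restrict (Ioo 0 T), PotBound Ω coulomb (fun x => ‖ψ t x‖ₑ) Q := by
    filter_upwards [F.dirLap, hb, ae_restrict_mem measurableSet_Ioo] with t h1 h2 h3
    refine PotBound.of_ae_norm_le St.isOpen hF₁ hk₁ (by positivity) ?_
    filter_upwards [hsup _ _ h1] with x hx
    have := hnorm t (Ioo_subset_Icc_self h3)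
    refine hx.trans ?_
    rw [one_mul]
    gcongr
  have hsupφ : ∀ᵐ x ∂vol Ω, ‖φ₀ x‖ ≤ m := by
    filter_upwards [hsup _ _ F.dirLap_initial] with x hx
    refine hx.trans ?_
    rw [one_mul, hm]
    gcongr
  have hpotφ : PotBound Ω coulomb (fun x => ‖φ₀ x‖ₑ) Q₀ :=
    PotBound.of_ae_norm_le St.isOpen hF₁ hk₁ hm0 hsupφ
  obtain ⟨D, K', R, hD, -, -, hreg⟩ := St.exists_regularity hA hQ0
  obtain ⟨hlip, -⟩ := hreg F hφ hl le_rfl hpot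
  set L : ℝ := 2 * Q * (D * (A + A)) with hL
  have hL0 : 0 ≤ L := by positivity
  -- The potential bound holds only at almost every time. The self-energy is Lipschitz on this set
  -- of full measure and is extended to a continuous function; the absolute value restores
  -- nonnegativity.
  set G : Set ℝ := {t | t ∈ Ioo 0 T ∧ PotBound Ω coulomb (fun x => ‖ψ t x‖ₑ) Q} with hG
  have hGlip : LipschitzOnWith L.toNNReal (fun t => selfEnergy Ω coulomb (ψ t)) G := by
    refine LipschitzOnWith.of_dist_le_mul fun t ht s hs => ?_
    rw [Real.dist_eq, Real.dist_eq, Real.coe_toNNReal L hL0]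
    refine (abs_selfEnergy_sub_le St.isOpen measurable_coulomb coulomb_neg ht.2 hs.2).trans ?_
    have h1 := hlip s (Ioo_subset_Icc_self hs.1) t (Ioo_subset_Icc_self ht.1)
    have h2 := hnorm t (Ioo_subset_Icc_self ht.1)
    have h3 := hnorm s (Ioo_subset_Icc_self hs.1)
    have h4 : ‖ψ t - ψ s‖ * (‖ψ t‖ + ‖ψ s‖) ≤ D * |t - s| * (A + A) := by gcongr
    have := mul_le_mul_of_nonneg_left h4 (show 0 ≤ 2 * Q by positivity)
    rw [hL]
    linarith
  obtain ⟨g, hg, hgeq⟩ := hGlip.extend_real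
  have heG : ∀ t ∈ G, |g t| = selfEnergy Ω coulomb (ψ t) := fun t ht => by
    rw [← hgeq ht, abs_of_nonneg (selfEnergy_nonneg coulomb_nonneg _)]
  have hGae : ∀ᵐ t ∂volume.restrict (Ioo 0 T), t ∈ G := by
    filter_upwards [hpot, ae_restrict_mem measurableSet_Ioo] with t h1 h2 using ⟨h2, h1⟩
  have hmain := F.prim.ae_re_inner_le (e := fun t => |g t|) hg.continuous.abs
    (fun _ _ => abs_nonneg _) (B := B * (Kc * (A * A))) (q := Q * D ^ 2) (C₁ := C₁)
    (C₂ := Q * (D * A)) (by positivity) (by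
      intro h hh hhT
      obtain ⟨ℓ, hℓ0, hℓ1, hℓ2⟩ := St.control.variation h hh
      refine ⟨fun s => ℓ s * (Kc * (A * A)), fun τ hτ => ?_, ?_⟩
      · obtain ⟨i1, i2⟩ := hℓ1 τ hτ
        refine ⟨i1.mul_const _, ?_⟩
        rw [intervalIntegral.integral_mul_const]
        have := mul_le_mul_of_nonneg_right i2 (show 0 ≤ Kc * (A * A) by positivity)
        linarith
      · have hT' : T - h ≤ T := by linarith
        filter_upwards [ae_restrict_Ioo_mono hT' F.dirLap, ae_restrict_Ioo_mono hT' F.equation,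
          ae_restrict_Ioo_mono hT' hGae, ae_restrict_Ioo_shift hh.le F.dirLap,
          ae_restrict_Ioo_shift hh.le F.equation, ae_restrict_Ioo_shift hh.le hGae,
          ae_notMem_finset S _, ae_restrict_Ioo_shift (τ := T) hh.le (ae_notMem_finset S _),
          ae_restrict_mem measurableSet_Ioo] with s a1 a2 a3 b1 b2 b3 c1 c2 hs
        have hsT : s ∈ Icc 0 T := ⟨hs.1.le, by linarith [hs.2]⟩
        have hshT : s + h ∈ Icc 0 T := ⟨by linarith [hs.1], by linarith [hs.2]⟩
        refine le_trans ?_ (re_inner_commutator_ge St.isOpen St.con_le hKc St.aemeasurable_con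
          measurable_coulomb coulomb_neg b1 a1 b2 a2 b3.2 a3.2)
        rw [heG s a3, heG (s + h) b3]
        have h1 := hℓ2 s hs.1 (by linarith [hs.2]) c1 c2
        have h2 := hnorm s hsT
        have h3 := hnorm (s + h) hshT
        have h4 : |c (s + h) - c s| * Kc * (‖ψ (s + h)‖ * ‖ψ s‖) ≤ ℓ s * (Kc * (A * A)) := by
          have := hℓ0 s
          rw [mul_assoc]
          gcongr
        have h5 := hlip s hsT (s + h) hshT
        rw [add_sub_cancel_left, abs_of_pos hh] at h5
        have h6 : Q * ‖ψ (s + h) - ψ s‖ ^ 2 ≤ Q * (D * h) ^ 2 := by gcongr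
        rw [mul_pow] at h6
        linarith) (by
      intro h hh hhT
      have p1 := F.prim.mono le_rfl hh.le hhT.le
      have p2 : IsPrim 0 h (fun _ : ℝ => Complex.I • φ₀) (fun _ => 0) := IsPrim.const hh.le _
      have hid := p1.re_inner_sub_eq p2
      rw [F.initial, re_inner_I_smul_self, sub_zero] at hid
      rw [F.initial, hid]
      have i1 := (p1.intervalIntegrable_re_inner_left p2).add
        (p1.intervalIntegrable_re_inner_right p2)
      have hmono : ∫ s in (0 : ℝ)..h, (-(C₁ + Q * (D * A) * h))
          ≤ ∫ s in (0 : ℝ)..h, ((inner ℂ (ψ' s) (Complex.I • φ₀)).re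
            + (inner ℂ (ψ s) (0 : L2 Ω)).re) := by
        refine intervalIntegral.integral_mono_ae_restrict hh.le intervalIntegrable_const i1 ?_
        rw [← restrict_Ioo_eq_restrict_Icc]
        filter_upwards [ae_restrict_Ioo_mono hhT.le F.dirLap,
          ae_restrict_Ioo_mono hhT.le F.equation, ae_restrict_Ioo_mono hhT.le hGae,
          ae_notMem_finset S _, ae_restrict_mem measurableSet_Ioo] with s a1 a2 a3 c1 hs
        have hsT : s ∈ Icc 0 T := Ioo_subset_Icc_self a3.1
        have hct := St.control.bound s a3.1 c1
        have h1 := re_inner_initial_ge St.isOpen St.aemeasurable hnV St.lintegral_le St.con_le hKc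
          hK hct St.aemeasurable_con measurable_coulomb coulomb_neg hm0 hsupφ a1 F.dirLap_initial
          a2 a3.2 hpotφ
        have h2 := hnorm s hsT
        have h5 := hlip 0 (left_mem_Icc.2 St.pos.le) s hsT
        rw [F.initial, sub_zero, abs_of_pos hs.1] at h5
        have h6 : ‖ψ s - φ₀‖ ≤ D * h := h5.trans (by
          have := hs.2.le
          gcongr)
        have h7 : Q * (‖ψ s - φ₀‖ * ‖φ₀‖) ≤ Q * (D * h * A) := by gcongr
        have h8 : ‖ψ s‖ * ‖l₀‖ ≤ A * A := by gcongr
        have h9 : ‖ψ s‖ * (nV * m + K * Kc * ‖φ₀‖) ≤ A * (nV * m + K * Kc * A) := by gcongr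
        have hQ₀0 := hpotφ.nonneg
        have h10 : Q₀ * ‖ψ s‖ ^ 2 ≤ Q₀ * A ^ 2 := by gcongr
        rw [inner_zero_right, Complex.zero_re, add_zero]
        refine le_trans ?_ h1
        rw [hC₁]
        linarith
      refine le_trans (le_of_eq ?_) hmono
      rw [intervalIntegral.integral_const, smul_eq_mul]
      ring)
  filter_upwards [hmain, F.dirLap, F.equation, hGae, ae_notMem_finset S _] with t h1 h2 h3 h4 h5
  have hψ := hnorm t (Ioo_subset_Icc_self h4.1)
  have hψ2 : ‖ψ t‖ ^ 2 ≤ A ^ 2 := by gcongr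
  -- g' is the squared gradient norm. The energy inequality bounds it, after dropping the
  -- nonnegative self-energy, by known constants plus nV times the L⁴ term, which takes at most
  -- g'/2.
  obtain ⟨g', hkin⟩ : ∃ g' : ℝ, g' = -(inner ℂ (ψ t) (l t)).re := ⟨_, rfl⟩
  have hkin0 : 0 ≤ g' := by
    obtain ⟨d, hd⟩ := h2
    rw [hkin, hd.re_inner_eq, neg_neg]
    exact Finset.sum_nonneg fun _ _ => sq_nonneg _
  have h6 := hfour _ _ h2
  rw [← hkin] at h6
  have h7 := kinetic_le (J := 1 / (2 * (nV + 1)) * g' + C₄ * ‖ψ t‖ ^ 2) St.isOpen St.aemeasurable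
    hnV St.lintegral_le St.con_le hK (St.control.bound t h4.1 h5) measurable_coulomb h3 h4.2
    (by positivity) h6
  rw [← hkin] at h7
  simp only [heG t h4] at h1
  have h8 := selfEnergy_nonneg coulomb_nonneg (ψ t)
  have h9 : nV * (1 / (2 * (nV + 1)) * g') ≤ g' / 2 := by
    rw [← mul_assoc, mul_one_div, div_mul_eq_mul_div, div_le_div_iff₀ (by positivity) two_pos]
    nlinarith
  have h10 : nV * (C₄ * ‖ψ t‖ ^ 2) ≤ nV * (C₄ * A ^ 2) := by gcongr
  have h11 : K * Kc * ‖ψ t‖ ^ 2 ≤ K * Kc * A ^ 2 := by gcongr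
  have h12 : g' ≤ E := by
    rw [hE]
    linarith
  -- The convolution is bounded by the L² norm of 1/|x| on the difference set times the L² norm of
  -- the density.
  refine PotBound.of_lintegral_pow_four_le St.isOpen measurable_coulomb hF₂ hk₂ (by positivity)
    (h6.trans (ENNReal.ofReal_le_ofReal ?_))
  gcongr

end Energy

end Hartree
end


/-! ### Continuation argument and stability with respect to the kernel. -/

noncomputable section

namespace Hartree

variable {Ω : Set E3}

theorem exists_mem_Ioo_of_ae {T a b : ℝ} {r : ℝ → Prop}
    (h : ∀ᵐ s ∂volume.restrict (Ioo 0 T), r s) (ha : 0 ≤ a) (hab : a < b) (hb : b ≤ T) :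
    ∃ s ∈ Ioo a b, r s := by
  have h1 : ∀ᵐ s ∂volume.restrict (Ioo a b), r s :=
    ae_restrict_of_ae_restrict_of_subset (Ioo_subset_Ioo ha hb) h
  have : (ae (volume.restrict (Ioo a b))).NeBot := by
    rw [ae_neBot, Ne, Measure.restrict_eq_zero, Real.volume_Ioo, ENNReal.ofReal_eq_zero]
    linarith
  obtain ⟨s, hs, hr⟩ := ((ae_restrict_mem measurableSet_Ioo).and h1).exists
  exact ⟨s, hs, hr⟩

/-- A continuation principle for properties that hold almost everywhere: `q` improves `p`, and `q`
at a time gives `p` at the times nearby. -/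
theorem ae_of_continuation {T η : ℝ} (hη : 0 < η) {p q : ℝ → Prop}
    (base : ∀ᵐ t ∂volume.restrict (Ioo 0 T), t < η → p t)
    (improve : ∀ τ, 0 < τ → τ ≤ T → (∀ᵐ t ∂volume.restrict (Ioo 0 τ), p t) →
      ∀ᵐ t ∂volume.restrict (Ioo 0 τ), q t)
    (near : ∀ᵐ t ∂volume.restrict (Ioo 0 T), ∀ᵐ s ∂volume.restrict (Ioo 0 T),
      |t - s| < η → q s → p t) : ∀ᵐ t ∂volume.restrict (Ioo 0 T), p t := by
  rcases le_or_gt T 0 with hT | hT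
  · simp [Ioo_eq_empty (not_lt.2 hT)]
  -- Time is covered in steps of length η, which is independent of n.
  have key : ∀ n : ℕ, ∀ᵐ t ∂volume.restrict (Ioo 0 T), t < (n + 1) * η → p t := by
    intro n
    induction n with
    | zero => simpa using base
    | succ n ih =>
      set τ := min T ((n + 1) * η) with hτ
      have hτ0 : 0 < τ := lt_min hT (by positivity)
      have hq := improve τ hτ0 (min_le_left _ _) (by
        filter_upwards [ae_restrict_Ioo_mono (min_le_left _ _) ih,
          ae_restrict_mem measurableSet_Ioo] with t h1 h2
        exact h1 (h2.2.trans_le (min_le_right _ _)))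
      filter_upwards [ih, near, ae_restrict_mem measurableSet_Ioo] with t h1 h2 h3 h4
      by_cases h5 : t < (n + 1) * η
      · exact h1 h5
      rw [not_lt] at h5
      have hτe : τ = (n + 1) * η := min_eq_right (h5.trans h3.2.le)
      push_cast at h4
      -- Since t lies less than η beyond τ, the times before τ within distance η of t form an
      -- interval of positive measure; one at which the almost everywhere properties hold can be
      -- chosen there.
      have hlt : max 0 (t - η) < τ := max_lt hτ0 (by rw [hτe]; linarith)
      obtain ⟨s, hs, h6, h7⟩ := exists_mem_Ioo_of_ae (T := τ)
        ((ae_restrict_Ioo_mono (min_le_left _ _) h2).and hq) (le_max_left _ _) hlt le_rfl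
      have h8 := (le_max_right 0 (t - η)).trans_lt hs.1
      have h9 : s < t := hs.2.trans_le (hτe ▸ h5)
      exact h6 (by rw [abs_of_pos] <;> linarith) h7
  obtain ⟨n, hn⟩ := exists_nat_gt (T / η)
  filter_upwards [key n, ae_restrict_mem measurableSet_Ioo] with t h1 h2
  refine h1 (h2.2.trans ?_)
  rw [div_lt_iff₀ hη] at hn
  linarith

section Stability

variable {T : ℝ} {V Vcon : E3 → ℝ} {c : ℝ → ℝ} {S : Finset ℝ} {K B Kc nV : ℝ}

/-- The factor χ − ψ is estimated pointwise by 1 instead of in L². The source in the inequality for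
‖ξ‖² is then linear in δ, which is why ‖ξ‖² rather than ‖ξ‖ is of order δ. -/
theorem lintegral_kernel_sub_le (hΩ : IsOpen Ω) {g : E3 → ℝ} {δ R m : ℝ} (hδ : 0 ≤ δ)
    (hg : ∫⁻ z in Ω - Ω, ‖g z‖ₑ ≤ ENNReal.ofReal δ) (hR : 0 ≤ R) (hm : 0 ≤ m)
    {χ ψ : L2 Ω} (hψ : ∀ᵐ x ∂vol Ω, ‖ψ x‖ ≤ R) (hχ : ∀ᵐ x ∂vol Ω, ‖χ x‖ ≤ m)
    (hξ : ∀ᵐ x ∂vol Ω, ‖χ x - ψ x‖ ≤ 1) [IsFiniteMeasure (vol Ω)] :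
    ∫⁻ x in Ω, ‖χ x - ψ x‖ₑ * ‖ψ x‖ₑ * ∫⁻ y in Ω, ‖g (x - y)‖ₑ * ‖χ y‖ₑ ^ 2
      ≤ ENNReal.ofReal (R * (δ * m ^ 2) * (vol Ω).real univ) := by
  have hq := PotBound.of_ae_norm_le hΩ hδ hg hm hχ
  calc ∫⁻ x in Ω, ‖χ x - ψ x‖ₑ * ‖ψ x‖ₑ * ∫⁻ y in Ω, ‖g (x - y)‖ₑ * ‖χ y‖ₑ ^ 2
      ≤ ∫⁻ x in Ω, ENNReal.ofReal (R * (δ * m ^ 2)) := by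
        refine lintegral_mono_ae ?_
        filter_upwards [hψ, hξ, ae_restrict_mem hΩ.measurableSet] with x h1 h2 h3
        rw [ENNReal.ofReal_mul hR, ← one_mul (ENNReal.ofReal R), ← ENNReal.ofReal_one,
          ← ofReal_norm, ← ofReal_norm (ψ x)]
        gcongr
        exact hq.left x h3
    _ = _ := by
        rw [lintegral_const, ENNReal.ofReal_mul (p := R * (δ * m ^ 2)) (by positivity),
          ofReal_measureReal (measure_ne_top _ _)]

/-- The solution depends on the kernel with an error of order one half in the `L¹` distance to the
Coulomb kernel. -/
theorem Setting.exists_stability (St : Setting Ω T V Vcon c S K B Kc nV) {A : ℝ} (hA : 0 ≤ A) :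
    ∃ C : ℝ, 0 ≤ C ∧ ∀ {f : E3 → ℝ} {φ₀ l₀ : L2 Ω} {ψ ψ' l χ χ' k : ℝ → L2 Ω},
      Flow Ω T V Vcon c coulomb φ₀ l₀ ψ ψ' l → Flow Ω T V Vcon c f φ₀ l₀ χ χ' k →
      ‖φ₀‖ ≤ A → ‖l₀‖ ≤ A → ∀ {δ : ℝ}, 0 ≤ δ →
      ∫⁻ z in Ω - Ω, ‖f z - coulomb z‖ₑ ≤ ENNReal.ofReal δ →
      ∀ t ∈ Icc 0 T, ‖χ t - ψ t‖ ^ 2 ≤ C * δ := by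
  have hΩ := St.isOpen
  have : Fact (Bornology.IsBounded Ω) := ⟨St.isBounded⟩
  have hKc := St.con_nonneg
  have hT := St.pos.le
  obtain ⟨F₁, -, hF₁, -, hk₁, -⟩ := exists_lintegral_coulomb_le St.isBounded
  obtain ⟨Qψ, hQψ, hpotψ⟩ := St.exists_potBound_coulomb hA
  obtain ⟨_, Kψ, R, -, hKψ, hR, hregψ⟩ := St.exists_regularity hA hQψ
  -- While |ξ| ≤ 1 and δ ≤ 1, R + 1 bounds χ pointwise and F₁ + 1 bounds the L¹ norm of f; the
  -- product bounds the potentials of both solutions.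
  set Q := (F₁ + 1) * (R + 1) ^ 2 with hQ
  have hQ0 : 0 ≤ Q := by positivity
  obtain ⟨_, Kχ, _, -, hKχ, -, hregχ⟩ := St.exists_regularity hA hQ0
  obtain ⟨Cε, hCε, hsup⟩ := exists_ae_norm_le hΩ St.isBounded
    (show 0 < 1 / (4 * (Kχ + Kψ + 1)) by positivity)
  set C₀ := Real.exp (2 * (8 * Q) * T) * (2 * (T * (R * (R + 1) ^ 2 * (vol Ω).real univ)))
    with hC₀
  have hC₀0 : 0 ≤ C₀ := by positivity
  -- Chosen so that ‖ξ‖² ≤ C₀δ₀ gives Cε‖ξ‖ ≤ 1/4. The Laplacians contribute at most another 1/4 by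
  -- the choice of ε.
  set δ₀ := min 1 (1 / (16 * (Cε + 1) ^ 2 * (C₀ + 1))) with hδ₀
  have hδ₀0 : 0 < δ₀ := lt_min one_pos (by positivity)
  refine ⟨C₀ + 4 * A ^ 2 / δ₀, by positivity, ?_⟩
  intro f φ₀ l₀ ψ ψ' l χ χ' k Fψ Fχ hφ hl δ hδ hdist t ht
  -- Above the threshold the L² bound ‖ξ‖ ≤ 2A suffices: 4A² is less than (4A²/δ₀)δ up to equality.
  rcases le_or_gt δ δ₀ with hδδ | hδδ
  swap
  · have h1 := (Fψ.norm_le ht).trans hφ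
    have h2 := (Fχ.norm_le ht).trans hφ
    have h3 : ‖χ t - ψ t‖ ^ 2 ≤ (A + A) ^ 2 := by
      have := (norm_sub_le (χ t) (ψ t)).trans (add_le_add h2 h1)
      gcongr
    have h4 : 4 * A ^ 2 ≤ 4 * A ^ 2 / δ₀ * δ := by
      rw [div_mul_eq_mul_div, le_div_iff₀ hδ₀0]
      gcongr
    have h5 : 0 ≤ C₀ * δ := by positivity
    nlinarith
  have hδ1 : δ ≤ 1 := hδδ.trans (min_le_left _ _)
  have hpotψ := hpotψ Fψ hφ hl
  have hregψ := (hregψ Fψ hφ hl le_rfl hpotψ).2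
  have hf1 : ∫⁻ z in Ω - Ω, ‖f z‖ₑ ≤ ENNReal.ofReal (F₁ + 1) := by
    rw [ENNReal.ofReal_add hF₁ zero_le_one]
    have m1 : Measurable fun z => ‖coulomb z‖ₑ := measurable_coulomb.enorm
    calc ∫⁻ z in Ω - Ω, ‖f z‖ₑ ≤ ∫⁻ z in Ω - Ω, (‖coulomb z‖ₑ + ‖f z - coulomb z‖ₑ) := by
          refine lintegral_mono fun z => ?_
          have := enorm_add_le (coulomb z) (f z - coulomb z)
          rwa [add_sub_cancel] at this
      _ = (∫⁻ z in Ω - Ω, ‖coulomb z‖ₑ) + ∫⁻ z in Ω - Ω, ‖f z - coulomb z‖ₑ :=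
          lintegral_add_left m1 _
      _ ≤ _ := add_le_add hk₁ (hdist.trans (ENNReal.ofReal_le_ofReal hδ1))
  have hξp := Fχ.prim.sub Fψ.prim
  have hξ0 : χ 0 - ψ 0 = 0 := by rw [Fχ.initial, Fψ.initial, sub_self]
  have hsupχ : ∀ {s}, (∀ᵐ x ∂vol Ω, ‖ψ s x‖ ≤ R) → (∀ᵐ x ∂vol Ω, ‖χ s x - ψ s x‖ ≤ 1) →
      ∀ᵐ x ∂vol Ω, ‖χ s x‖ ≤ R + 1 := fun {s} h1 h2 => by
    filter_upwards [h1, h2] with x h3 h4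
    have := norm_add_le (χ s x - ψ s x) (ψ s x)
    rw [sub_add_cancel] at this
    linarith
  have gron : ∀ τ, 0 < τ → τ ≤ T →
      (∀ᵐ s ∂volume.restrict (Ioo 0 τ), ∀ᵐ x ∂vol Ω, ‖χ s x - ψ s x‖ ≤ 1) →
      ∀ s ∈ Icc 0 τ, ‖χ s - ψ s‖ ^ 2 ≤ C₀ * δ := by
    intro τ hτ hτT hp s hs
    have h1 := (hξp.mono le_rfl hτ.le hτT).norm_sq_le_gronwall (Λ := 8 * Q)
      (r := fun _ => R * (δ * (R + 1) ^ 2) * (vol Ω).real univ) (by positivity)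
      intervalIntegrable_const (fun _ => by positivity) (by
        filter_upwards [hp, ae_restrict_Ioo_mono hτT hregψ, ae_restrict_Ioo_mono hτT Fψ.dirLap,
          ae_restrict_Ioo_mono hτT Fχ.dirLap, ae_restrict_Ioo_mono hτT Fψ.equation,
          ae_restrict_Ioo_mono hτT Fχ.equation] with s a1 a2 a3 a4 a5 a6
        have b1 := hsupχ a2.2 a1
        have q1 := PotBound.of_ae_norm_le hΩ (by positivity) hf1 (by positivity) b1
        have q2 := PotBound.of_ae_norm_le hΩ hF₁ hk₁ (by positivity) b1
        have q3 := PotBound.of_ae_norm_le hΩ hF₁ hk₁ hR a2.2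
        have e2 : F₁ * (R + 1) ^ 2 ≤ Q := by rw [hQ]; gcongr; linarith
        have e3 : F₁ * R ^ 2 ≤ Q := by rw [hQ]; gcongr <;> linarith
        have b2 := lintegral_kernel_sub_le (g := fun z => f z - coulomb z) hΩ hδ hdist hR
          (by positivity) a2.2 b1 a1
        have b3 := abs_re_inner_le_of_hartree hΩ St.con_le hKc Fχ.measurable measurable_coulomb
          a4 a3 a6 a5 q1 (q2.mono e2) (q3.mono e3) (by positivity) b2
        rw [sub_self, abs_zero, zero_mul, zero_mul, zero_mul, zero_add] at b3
        have := (le_abs_self _).trans b3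
        linarith) hs
    rw [hξ0, norm_zero, intervalIntegral.integral_const, smul_eq_mul, sub_zero] at h1
    refine h1.trans ?_
    have h2 : Real.exp (2 * (8 * Q) * τ) ≤ Real.exp (2 * (8 * Q) * T) :=
      Real.exp_le_exp.2 (mul_le_mul_of_nonneg_left hτT (by positivity))
    calc Real.exp (2 * (8 * Q) * τ) * (0 ^ 2 + 2 * (τ * (R * (δ * (R + 1) ^ 2)
          * (vol Ω).real univ)))
        ≤ Real.exp (2 * (8 * Q) * T) * (0 ^ 2 + 2 * (T * (R * (δ * (R + 1) ^ 2)
          * (vol Ω).real univ))) := by gcongr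
      _ = C₀ * δ := by rw [hC₀]; ring
  -- Continuity of ξ in the supremum norm, away from a null set of times: L² continuity is combined
  -- with the elliptic estimate and the Laplacian bounds of these particular solutions. The
  -- resulting η may depend on the solutions, since it only starts and propagates the continuation.
  have hsmall : ∃ η > 0, (∀ᵐ s ∂volume.restrict (Ioo 0 T), s < η →
      ∀ᵐ x ∂vol Ω, ‖χ s x - ψ s x‖ ≤ 1) ∧ ∀ᵐ s ∂volume.restrict (Ioo 0 T),
      ∀ᵐ s' ∂volume.restrict (Ioo 0 T), |s - s'| < η →
      (∀ᵐ x ∂vol Ω, ‖χ s' x - ψ s' x‖ ≤ 1 / 2) → ∀ᵐ x ∂vol Ω, ‖χ s x - ψ s x‖ ≤ 1 := by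
    obtain ⟨b₁, hb₁, hbd₁⟩ := Fψ.bounded
    obtain ⟨b₂, hb₂, hbd₂⟩ := Fχ.bounded
    obtain ⟨C₃, hC₃, hsup₃⟩ := exists_ae_norm_le hΩ St.isBounded
      (show 0 < 1 / (8 * (b₂ + b₁ + 1)) by positivity)
    have huc := (isCompact_Icc (a := (0 : ℝ)) (b := T)).uniformContinuousOn_of_continuous
      hξp.continuousOn
    rw [Metric.uniformContinuousOn_iff] at huc
    obtain ⟨η, hη, huc⟩ := huc (1 / (4 * (C₃ + 1))) (by positivity)
    have est : ∀ {u y : L2 Ω}, DirLap Ω u y → ‖y‖ ≤ 2 * (b₂ + b₁) → ‖u‖ ≤ 1 / (4 * (C₃ + 1)) →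
        ∀ᵐ x ∂vol Ω, ‖u x‖ ≤ 1 / 2 := by
      intro u y h1 h2 h3
      filter_upwards [hsup₃ _ _ h1] with x hx
      have e1 : 1 / (8 * (b₂ + b₁ + 1)) * ‖y‖ ≤ 1 / 4 := by
        rw [div_mul_eq_mul_div, one_mul, div_le_div_iff₀ (by positivity) (by norm_num)]
        linarith
      have e2 : C₃ * ‖u‖ ≤ 1 / 4 := by
        refine (mul_le_mul_of_nonneg_left h3 hC₃).trans ?_
        rw [mul_one_div, div_le_div_iff₀ (by positivity) (by norm_num)]
        linarith
      linarith
    refine ⟨η, hη, ?_, ?_⟩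
    · filter_upwards [Fψ.dirLap, Fχ.dirLap, hbd₁, hbd₂, ae_restrict_mem measurableSet_Ioo]
        with s a1 a2 a3 a4 hs hsη
      have h1 := huc s (Ioo_subset_Icc_self hs) 0 (left_mem_Icc.2 hT) (by
        rwa [Real.dist_eq, sub_zero, abs_of_pos hs.1])
      rw [hξ0, dist_zero_right] at h1
      have h2 := est (a2.sub a1) ((norm_sub_le _ _).trans (by linarith)) h1.le
      filter_upwards [h2, Lp.coeFn_sub (χ s) (ψ s)] with x h3 h4
      rw [h4, Pi.sub_apply] at h3
      linarith
    · have hall : ∀ᵐ s ∂volume.restrict (Ioo 0 T), s ∈ Icc 0 T ∧ DirLap Ω (ψ s) (l s) ∧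
          DirLap Ω (χ s) (k s) ∧ ‖l s‖ ≤ b₁ ∧ ‖k s‖ ≤ b₂ := by
        filter_upwards [Fψ.dirLap, Fχ.dirLap, hbd₁, hbd₂, ae_restrict_mem measurableSet_Ioo]
          with s a1 a2 a3 a4 hs using ⟨Ioo_subset_Icc_self hs, a1, a2, a3, a4⟩
      filter_upwards [hall] with s hs
      filter_upwards [hall] with s' hs' hss hq
      obtain ⟨a0, a1, a2, a3, a4⟩ := hs
      obtain ⟨b0, b1, b2, b3, b4⟩ := hs'
      have h1 := huc s a0 s' b0 (by rwa [Real.dist_eq])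
      rw [dist_eq_norm] at h1
      have h2 := est ((a2.sub a1).sub (b2.sub b1)) (by
        refine (norm_sub_le _ _).trans ?_
        have := norm_sub_le (k s) (l s)
        have := norm_sub_le (k s') (l s')
        linarith) h1.le
      filter_upwards [h2, hq, Lp.coeFn_sub (χ s) (ψ s), Lp.coeFn_sub (χ s') (ψ s'),
        Lp.coeFn_sub (χ s - ψ s) (χ s' - ψ s')] with x h3 h4 h5 h6 h7
      rw [h7, Pi.sub_apply, h5, h6, Pi.sub_apply, Pi.sub_apply] at h3
      have := norm_add_le ((χ s x - ψ s x) - (χ s' x - ψ s' x)) (χ s' x - ψ s' x)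
      rw [sub_add_cancel] at this
      linarith
  obtain ⟨η, hη, hbase, hcont⟩ := hsmall
  -- The improvement from 1 to 1/2: Grönwall makes ‖ξ‖ small, the potential bound for f yields the
  -- uniform Laplacian bound Kχ, and the elliptic estimate adds 1/4 + 1/4.
  have hall := ae_of_continuation hη hbase (by
    intro τ hτ hτT hp
    have h1 := gron τ hτ hτT hp
    have hpotχ : ∀ᵐ s ∂volume.restrict (Ioo 0 τ), PotBound Ω f (fun x => ‖χ s x‖ₑ) Q := by
      filter_upwards [hp, ae_restrict_Ioo_mono hτT hregψ] with s a1 a2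
      exact PotBound.of_ae_norm_le hΩ (by positivity) hf1 (by positivity) (hsupχ a2.2 a1)
    have h2 := (hregχ Fχ hφ hl hτT hpotχ).2
    filter_upwards [h2, ae_restrict_Ioo_mono hτT hregψ, ae_restrict_Ioo_mono hτT Fψ.dirLap,
      ae_restrict_Ioo_mono hτT Fχ.dirLap, ae_restrict_mem measurableSet_Ioo] with s a1 a2 a3 a4 hs
    have h3 := h1 s (Ioo_subset_Icc_self hs)
    have e1 : 1 / (4 * (Kχ + Kψ + 1)) * ‖k s - l s‖ ≤ 1 / 4 := by
      have := (norm_sub_le (k s) (l s)).trans (add_le_add a1.1 a2.1)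
      rw [div_mul_eq_mul_div, one_mul, div_le_div_iff₀ (by positivity) (by norm_num)]
      linarith
    have e2 : Cε * ‖χ s - ψ s‖ ≤ 1 / 4 := by
      refine abs_le_of_sq_le_sq' ?_ (by norm_num) |>.2
      have e3 : C₀ * δ ≤ C₀ * (1 / (16 * (Cε + 1) ^ 2 * (C₀ + 1))) :=
        mul_le_mul_of_nonneg_left (hδδ.trans (min_le_right _ _)) hC₀0
      calc (Cε * ‖χ s - ψ s‖) ^ 2 = Cε ^ 2 * ‖χ s - ψ s‖ ^ 2 := by ring
        _ ≤ (Cε + 1) ^ 2 * (C₀ * (1 / (16 * (Cε + 1) ^ 2 * (C₀ + 1)))) := by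
            have := h3.trans e3
            gcongr
            linarith
        _ = C₀ / (C₀ + 1) / 16 := by
            field_simp
        _ ≤ 1 / 16 := by
            have : C₀ / (C₀ + 1) ≤ 1 := div_le_one_of_le₀ (by linarith) (by positivity)
            linarith
        _ = (1 / 4) ^ 2 := by norm_num
    filter_upwards [hsup _ _ (a4.sub a3), Lp.coeFn_sub (χ s) (ψ s)] with x hx h4
    rw [h4, Pi.sub_apply] at hx
    linarith) hcont
  refine (gron T St.pos le_rfl hall t ht).trans ?_
  have : 0 ≤ 4 * A ^ 2 / δ₀ * δ := by positivity
  linarith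

end Stability

end Hartree
end


/-! ### Solutions as flows, the softened kernel and the assembly. -/

noncomputable section

namespace Hartree

variable {Ω : Set E3}

section Solutions

theorem DirGradLap.ext (hΩ : IsOpen Ω) {u l l' : L2 Ω} {d d' : Fin 3 → L2 Ω}
    (h : DirGradLap Ω u d l) (h' : DirGradLap Ω u d' l') : l = l' := by
  obtain ⟨h1, w, h2, rfl⟩ := h
  obtain ⟨k1, w', k2, rfl⟩ := h'
  refine Finset.sum_congr rfl fun i _ => Lp.ext ?_
  have hd : d i =ᵐ[vol Ω] d' i :=
    (h1.hasWeakPartial i).ae_eq hΩ (k1.hasWeakPartial i) (Lp.memLp _) (Lp.memLp _)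
  exact ((h2 i).congr hd EventuallyEq.rfl).ae_eq hΩ (k2 i) (Lp.memLp _) (Lp.memLp _)

theorem DirLap.ext (hΩ : IsOpen Ω) {u l l' : L2 Ω} (h : DirLap Ω u l) (h' : DirLap Ω u l') :
    l = l' := by
  obtain ⟨d, h⟩ := h
  obtain ⟨d', h'⟩ := h'
  exact h.ext hΩ h'

theorem HasLaplacian.exists_dirLap (hΩ : IsOpen Ω) {u : L2 Ω} (hu : MemH10 Ω u) {lap : E3 → ℂ}
    (h : HasLaplacian Ω u lap) : ∃ l, DirLap Ω u l ∧ l =ᵐ[vol Ω] lap := by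
  obtain ⟨v, w, hj, he⟩ := h
  refine ⟨_, ⟨_, exists_dirGradLap hΩ hu hj⟩, ?_⟩
  have h1 : ∀ᵐ x ∂vol Ω, ∀ i, (hj.memLp_two i i).toLp (w i i) x = w i i x :=
    ae_all_iff.2 fun i => (hj.memLp_two i i).coeFn_toLp
  rw [Fin.sum_univ_three]
  filter_upwards [he, h1, Lp.coeFn_add
    ((hj.memLp_two 0 0).toLp (w 0 0) + (hj.memLp_two 1 1).toLp (w 1 1))
    ((hj.memLp_two 2 2).toLp (w 2 2)),
    Lp.coeFn_add ((hj.memLp_two 0 0).toLp (w 0 0)) ((hj.memLp_two 1 1).toLp (w 1 1))]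
    with x a1 a2 a3 a4
  rw [a3, Pi.add_apply, a4, Pi.add_apply, a1, Fin.sum_univ_three, a2, a2, a2]

/-- The Laplacian in the equation and the one bounded through the H²₂ norm come from different jets;
uniqueness of the Dirichlet Laplacian identifies them. -/
theorem IsSolution.exists_flow (hΩ : IsOpen Ω) {T : ℝ} (hT : 0 < T) {V Vcon : E3 → ℝ} {c : ℝ → ℝ}
    {f : E3 → ℝ} (hf : Measurable f) {φ₀ l₀ : L2 Ω} {ψ : ℝ → L2 Ω}
    (h : IsSolution T V Vcon c f φ₀ ψ) (hφ : DirLap Ω φ₀ l₀) :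
    ∃ ψ' l, Flow Ω T V Vcon c f φ₀ l₀ ψ ψ' l := by
  obtain ⟨ψ', hd, heq⟩ := h.equation
  obtain ⟨b, hb⟩ := h.bounded
  have hex : ∀ᵐ t ∂volume.restrict (Ioo 0 T), ∃ l, DirLap Ω (ψ t) l ∧ ‖l‖ ≤ 3 * (b + 1) ∧
      ⇑(Complex.I • ψ' t + l) =ᵐ[vol Ω]
        fun x => ((V x + c t * Vcon x + hartreePotential Ω f (ψ t) x : ℝ) : ℂ) * ψ t x := by
    filter_upwards [heq, h.dirichlet, hb] with t h1 h2 h3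
    obtain ⟨lap, h4, h5⟩ := h1
    obtain ⟨l, h6, h7⟩ := h4.exists_dirLap hΩ h2
    obtain ⟨l', h8, h9, -, -⟩ := exists_dirLap_of_normH22_le hΩ h2 h3
    refine ⟨l, h6, h6.ext hΩ h8 ▸ h9, ?_⟩
    filter_upwards [h5, h7, Lp.coeFn_add (Complex.I • ψ' t) l, Lp.coeFn_smul Complex.I (ψ' t)]
      with x a1 a2 a3 a4
    rw [a3, Pi.add_apply, a4, Pi.smul_apply, smul_eq_mul, a1, a2]
    push_cast
    ring
  have : (ae (volume.restrict (Ioo 0 T))).NeBot := by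
    rw [ae_neBot, Ne, Measure.restrict_eq_zero, Real.volume_Ioo, ENNReal.ofReal_eq_zero]
    linarith
  obtain ⟨l, hl⟩ := hex.choice
  exact ⟨ψ', l, hf, hd.isPrim hT.le, h.initial, hφ, hl.mono fun _ h => h.1,
    hl.mono fun _ h => h.2.2, 3 * (b + 1), by positivity, hl.mono fun _ h => h.2.1⟩

theorem hartreePotential_congr (hΩ : MeasurableSet Ω) {f g : E3 → ℝ} (h : EqOn f g (Ω - Ω))
    (u : E3 → ℂ) {x : E3} (hx : x ∈ Ω) : hartreePotential Ω f u x = hartreePotential Ω g u x :=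
  setIntegral_congr_fun hΩ fun y hy => by simp only [h (sub_mem_sub hx hy)]

theorem IsSolution.congr_kernel (hΩ : IsOpen Ω) {T : ℝ} {V Vcon : E3 → ℝ} {c : ℝ → ℝ}
    {f g : E3 → ℝ} (hfg : EqOn f g (Ω - Ω)) {φ₀ : L2 Ω} {ψ : ℝ → L2 Ω}
    (h : IsSolution T V Vcon c f φ₀ ψ) : IsSolution T V Vcon c g φ₀ ψ where
  initial := h.initial
  bounded := h.bounded
  dirichlet := h.dirichlet
  equation := by
    obtain ⟨ψ', hd, heq⟩ := h.equation
    refine ⟨ψ', hd, ?_⟩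
    filter_upwards [heq] with t ht
    obtain ⟨lap, h1, h2⟩ := ht
    refine ⟨lap, h1, ?_⟩
    filter_upwards [h2, ae_restrict_mem hΩ.measurableSet] with x h3 hx
    rw [h3, hartreePotential_congr hΩ.measurableSet hfg _ hx]

theorem HasTimeDeriv.sub {T : ℝ} (hT : 0 ≤ T) {χ χ' ψ ψ' : ℝ → L2 Ω} (h : HasTimeDeriv T χ χ')
    (k : HasTimeDeriv T ψ ψ') :
    HasTimeDeriv T (fun t => χ t - ψ t) (fun t => χ' t - ψ' t) :=
  ⟨h.1.sub k.1, ((h.isPrim hT).sub (k.isPrim hT)).eq⟩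

theorem IsSolution.differenceEquation {T : ℝ} (hT : 0 ≤ T) {V Vcon : E3 → ℝ} {c : ℝ → ℝ}
    {f : E3 → ℝ} {φ₀ : L2 Ω} {ψ χ : ℝ → L2 Ω} (hψ : IsSolution T V Vcon c coulomb φ₀ ψ)
    (hχ : IsSolution T V Vcon c f φ₀ χ) :
    DifferenceEquation T V Vcon c f χ ψ (fun t => χ t - ψ t) := by
  obtain ⟨ψ', hd, heq⟩ := hψ.equation
  obtain ⟨χ', kd, keq⟩ := hχ.equation
  refine ⟨_, kd.sub hT hd, ?_⟩
  filter_upwards [heq, keq] with t ht kt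
  obtain ⟨l, h1, h2⟩ := ht
  obtain ⟨m, k1, k2⟩ := kt
  refine ⟨_, (k1.sub h1).congr (Lp.coeFn_sub (χ t) (ψ t)).symm, ?_⟩
  filter_upwards [h2, k2, Lp.coeFn_sub (χ t) (ψ t), Lp.coeFn_sub (χ' t) (ψ' t)] with x a1 a2 a3 a4
  rw [a3, a4, Pi.sub_apply, Pi.sub_apply, mul_sub, a1, a2]
  ring

theorem memLp_top_of_weight (hΩ : IsOpen Ω) (hb : Bornology.IsBounded Ω) {W : E3 → ℝ}
    (h : MemLp (fun x => (1 + ‖x‖ ^ 2)⁻¹ * W x) ⊤ (vol Ω)) : MemLp W ⊤ (vol Ω) := by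
  obtain ⟨R, hR⟩ := hb.exists_norm_le
  have hw : MemLp (fun x : E3 => 1 + ‖x‖ ^ 2) ⊤ (vol Ω) := by
    refine memLp_top_of_bound (by fun_prop) (1 + R ^ 2) ?_
    filter_upwards [ae_restrict_mem hΩ.measurableSet] with x hx
    have := hR x hx
    rw [Real.norm_of_nonneg (by positivity)]
    gcongr
  refine (h.mul hw (r := ⊤)).ae_eq (ae_of_all _ fun x => ?_)
  have : (1 : ℝ) + ‖x‖ ^ 2 ≠ 0 := by positivity
  simp only [Pi.mul_apply]
  field_simp

theorem AdmissiblePotentials.exists_setting (hΩ : IsOpen Ω) (hb : Bornology.IsBounded Ω) {T : ℝ}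
    (hT : 0 < T) {Wreg Wsing Vcon : E3 → ℝ} (hpot : AdmissiblePotentials Ω Wreg Wsing Vcon)
    {c : ℝ → ℝ} (hc : PiecewiseW11 T c) :
    ∃ S K B Kc nV, Setting Ω T (fun x => Wreg x + Wsing x) Vcon c S K B Kc nV := by
  have : Fact (Bornology.IsBounded Ω) := ⟨hb⟩
  obtain ⟨S, K, B, hcb⟩ := hc.exists_controlBound
  have hcon := memLp_top_of_weight hΩ hb hpot.con
  have hreg : MemLp Wreg 2 (vol Ω) := (memLp_top_of_weight hΩ hb hpot.reg).mono_exponent le_top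
  have hV : MemLp (fun x => Wreg x + Wsing x) 2 (vol Ω) := hreg.add hpot.sing
  refine ⟨S, K, B, (eLpNorm Vcon ⊤ (vol Ω)).toReal,
    (eLpNorm (fun x => Wreg x + Wsing x) 2 (vol Ω)).toReal, hΩ, hb, hT, hV.1.aemeasurable,
    hcon.1.aemeasurable, by positivity, (lintegral_enorm_sq_eq_of_memLp hV).le, by positivity,
    ?_, hcb⟩
  filter_upwards [ae_le_eLpNormEssSup (f := Vcon) (μ := vol Ω)] with x hx
  rw [← Real.norm_eq_abs, ← toReal_enorm]
  exact ENNReal.toReal_mono hcon.2.ne (by rwa [eLpNorm_exponent_top])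

end Solutions

section SoftCoulomb

theorem contDiff_softCoulomb {ε : ℝ} (hε : 0 < ε) : ContDiff ℝ ∞ (softCoulomb ε) := by
  have h : ∀ x : E3, ‖x‖ ^ 2 + ε ^ 2 ≠ 0 := fun x => by positivity
  refine ContDiff.div contDiff_const (ContDiff.sqrt ?_ h) fun x => by
    have : 0 < ‖x‖ ^ 2 + ε ^ 2 := by positivity
    positivity
  exact (contDiff_norm_sq ℝ).add contDiff_const

/-- With r = |x| and s = √(r² + ε²) one has r ≤ s ≤ r + ε, so 1/r − 1/s = (s − r)/(sr) ≤ ε/r². -/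
theorem abs_softCoulomb_sub_coulomb_le {ε : ℝ} (hε : 0 < ε) {x : E3} (hx : x ≠ 0) :
    |softCoulomb ε x - coulomb x| ≤ ε * ‖x‖ ^ (-2 : ℝ) := by
  have hr : 0 < ‖x‖ := norm_pos_iff.2 hx
  unfold softCoulomb coulomb
  set r := ‖x‖
  set s := √(r ^ 2 + ε ^ 2)
  have hrs : r ≤ s := Real.le_sqrt_of_sq_le (by nlinarith)
  have hs : s ≤ r + ε := Real.sqrt_le_iff.2 ⟨by positivity, by nlinarith⟩
  have hs0 : 0 < s := hr.trans_le hrs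
  have e : 1 / s - 1 / r = -((s - r) / (s * r)) := by field_simp; ring
  rw [e, abs_neg, abs_of_nonneg (div_nonneg (by linarith) (by positivity)),
    Real.rpow_neg hr.le, Real.rpow_ofNat, ← div_eq_mul_inv, sq]
  gcongr
  linarith

theorem exists_kernelDist_softCoulomb_le {D : Set E3} (hD : Bornology.IsBounded D) :
    ∃ C : ℝ≥0, ∀ ε : ℝ, 0 < ε → kernelDist D (softCoulomb ε) ≤ C * ENNReal.ofReal ε := by
  obtain ⟨R, hR⟩ := hD.subset_ball 0
  have hfin := (integrableOn_norm_rpow_neg_two R).2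
  unfold HasFiniteIntegral at hfin
  refine ⟨(∫⁻ x in Metric.ball (0 : E3) R, ‖‖x‖ ^ (-2 : ℝ)‖ₑ).toNNReal, fun ε hε => ?_⟩
  rw [ENNReal.coe_toNNReal hfin.ne, mul_comm, ← lintegral_const_mul' _ _ ENNReal.ofReal_ne_top,
    kernelDist, eLpNorm_one_eq_lintegral_enorm]
  refine le_trans (lintegral_mono_ae ?_) (lintegral_mono_set hR)
  have h0 : ∀ᵐ x ∂vol D, x ≠ 0 :=
    ae_restrict_of_ae (measure_eq_zero_iff_ae_notMem.1 (measure_singleton (0 : E3)))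
  filter_upwards [h0] with x hx
  rw [← ofReal_norm, ← ofReal_norm, ← ENNReal.ofReal_mul hε.le, Real.norm_eq_abs,
    Real.norm_of_nonneg (by positivity)]
  exact ENNReal.ofReal_le_ofReal (abs_softCoulomb_sub_coulomb_le hε hx)

end SoftCoulomb

theorem exists_difference_bound (hΩ : IsOpen Ω) (hΩb : Bornology.IsBounded Ω)
    {T : ℝ} (hT : 0 < T) {Wreg Wsing Vcon : E3 → ℝ}
    (hpot : AdmissiblePotentials Ω Wreg Wsing Vcon) {c : ℝ → ℝ} (hc : PiecewiseW11 T c) (M : ℝ≥0) :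
    ∃ C : ℝ≥0, ∀ φ₀ : L2 Ω, normH22 Ω φ₀ ≤ M → MemH10 Ω φ₀ →
      ∀ ψ : ℝ → L2 Ω, IsSolution T (fun x => Wreg x + Wsing x) Vcon c coulomb φ₀ ψ →
      ∀ f : E3 → ℝ, ContDiffOn ℝ ∞ f (Ω - Ω) →
      ∀ χ : ℝ → L2 Ω, IsSolution T (fun x => Wreg x + Wsing x) Vcon c f φ₀ χ →
        normLinftyL2 T (fun t => χ t - ψ t) ^ 2 ≤ C * kernelDist (Ω - Ω) f := by
  obtain ⟨S, K, B, Kc, nV, St⟩ := hpot.exists_setting hΩ hΩb hT hc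
  obtain ⟨C, hC, hstab⟩ := St.exists_stability (A := 3 * (M + 1)) (by positivity)
  -- Adding 1 makes the constant positive, so that the bound is infinite, not 0 · ∞ = 0, when the
  -- kernel distance is infinite.
  refine ⟨(C + 1).toNNReal, fun φ₀ hM hφ₀ ψ hψ f hf χ hχ => ?_⟩
  obtain ⟨l₀, h1, h2, h3, -⟩ := exists_dirLap_of_normH22_le hΩ hφ₀ hM
  have hd : MeasurableSet (Ω - Ω) := hΩ.sub_right.measurableSet
  -- Only the values of f on the difference set matter. Cutting f off outside it provides a Borel
  -- function on the whole space, as the flow estimates require.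
  set g := (Ω - Ω).indicator f with hg
  have hgf : EqOn f g (Ω - Ω) := fun x hx => (indicator_of_mem hx f).symm
  have mg : Measurable g := by
    classical
    rw [hg, ← piecewise_eq_indicator]
    exact hf.continuousOn.measurable_piecewise continuousOn_const hd
  obtain ⟨ψ', l, Fψ⟩ := hψ.exists_flow hΩ hT measurable_coulomb h1
  obtain ⟨χ', k, Fχ⟩ := (hχ.congr_kernel hΩ hgf).exists_flow hΩ hT mg h1
  have hdist : kernelDist (Ω - Ω) f = ∫⁻ z in Ω - Ω, ‖g z - coulomb z‖ₑ := by
    rw [kernelDist, eLpNorm_one_eq_lintegral_enorm]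
    exact setLIntegral_congr_fun hd fun z hz => by simp only [hgf hz]
  have hC1 : (0 : ℝ≥0∞) < ((C + 1).toNNReal : ℝ≥0∞) := by
    rw [ENNReal.coe_pos, Real.toNNReal_pos]
    linarith
  rcases eq_or_ne (kernelDist (Ω - Ω) f) ⊤ with htop | htop
  · rw [htop, ENNReal.mul_top hC1.ne']
    exact le_top
  set δ := (kernelDist (Ω - Ω) f).toReal with hδ
  have hδe : kernelDist (Ω - Ω) f = ENNReal.ofReal δ := (ENNReal.ofReal_toReal htop).symm
  have key := hstab Fψ Fχ (h3.trans (by linarith [M.coe_nonneg])) h2 (δ := δ) (by positivity)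
    (by rw [← hdist, hδe])
  have hle : normLinftyL2 T (fun t => χ t - ψ t) ≤ ENNReal.ofReal (√(C * δ)) := by
    rw [normLinftyL2, eLpNorm_exponent_top]
    refine eLpNormEssSup_le_of_ae_bound ?_
    filter_upwards [ae_restrict_mem measurableSet_Ioo] with t ht
    exact Real.le_sqrt_of_sq_le (key t (Ioo_subset_Icc_self ht))
  calc normLinftyL2 T (fun t => χ t - ψ t) ^ 2 ≤ ENNReal.ofReal (√(C * δ)) ^ 2 := by gcongr
    _ = ENNReal.ofReal (C * δ) := by
        rw [← ENNReal.ofReal_pow (by positivity), Real.sq_sqrt (by positivity)]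
    _ ≤ _ := by
        rw [hδe, ← ENNReal.ofReal, ← ENNReal.ofReal_mul (by positivity)]
        apply ENNReal.ofReal_le_ofReal
        have : 0 ≤ δ := by positivity
        nlinarith

end Hartree
end

theorem mainTheorem7 (Ω : Set Hartree.E3) (hΩ : IsOpen Ω) (hΩb : Bornology.IsBounded Ω)
    (T : ℝ) (hT : 0 < T) (Wreg Wsing Vcon : Hartree.E3 → ℝ)
    (hpot : Hartree.AdmissiblePotentials Ω Wreg Wsing Vcon)
    (c : ℝ → ℝ) (hc : Hartree.PiecewiseW11 T c) :
    (∀ M : ℝ≥0, ∃ C : ℝ≥0,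
      ∀ φ₀ : Hartree.L2 Ω, Hartree.normH22 Ω φ₀ ≤ M → Hartree.MemH10 Ω φ₀ →
      ∀ ψ : ℝ → Hartree.L2 Ω,
        Hartree.IsSolution T (fun x => Wreg x + Wsing x) Vcon c Hartree.coulomb φ₀ ψ →
      ∀ f : Hartree.E3 → ℝ, ContDiffOn ℝ ∞ f (Ω - Ω) → MemLp f 2 (Hartree.vol (Ω - Ω)) →
      ∀ χ : ℝ → Hartree.L2 Ω,
        Hartree.IsSolution T (fun x => Wreg x + Wsing x) Vcon c f φ₀ χ →
        Hartree.DifferenceEquation T (fun x => Wreg x + Wsing x) Vcon c f χ ψ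
            (fun t => χ t - ψ t) ∧
          Hartree.normLinftyL2 T (fun t => χ t - ψ t) ^ 2
            ≤ C * Hartree.kernelDist (Ω - Ω) f) ∧
    (∀ ε : ℝ, 0 < ε → ContDiff ℝ ∞ (Hartree.softCoulomb ε)) ∧
    (∀ D : Set Hartree.E3, Bornology.IsBounded D → ∃ C : ℝ≥0, ∀ ε : ℝ, 0 < ε →
      Hartree.kernelDist D (Hartree.softCoulomb ε) ≤ C * ENNReal.ofReal ε) ∧
    (∀ M : ℝ≥0, ∃ C : ℝ≥0,
      ∀ φ₀ : Hartree.L2 Ω, Hartree.normH22 Ω φ₀ ≤ M → Hartree.MemH10 Ω φ₀ →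
      ∀ ψ : ℝ → Hartree.L2 Ω,
        Hartree.IsSolution T (fun x => Wreg x + Wsing x) Vcon c Hartree.coulomb φ₀ ψ →
      ∀ ε : ℝ, 0 < ε → ∀ χ : ℝ → Hartree.L2 Ω,
        Hartree.IsSolution T (fun x => Wreg x + Wsing x) Vcon c (Hartree.softCoulomb ε) φ₀ χ →
        Hartree.normLinftyL2 T (fun t => χ t - ψ t) ^ 2 ≤ C * ENNReal.ofReal ε) := by
  refine ⟨fun M => ?_, fun ε hε => Hartree.contDiff_softCoulomb hε,
    fun D hD => Hartree.exists_kernelDist_softCoulomb_le hD, fun M => ?_⟩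
  · obtain ⟨C, hC⟩ := Hartree.exists_difference_bound hΩ hΩb hT hpot hc M
    exact ⟨C, fun φ₀ hM hφ₀ ψ hψ f hf _ χ hχ =>
      ⟨hψ.differenceEquation hT.le hχ, hC φ₀ hM hφ₀ ψ hψ f hf χ hχ⟩⟩
  · obtain ⟨C, hC⟩ := Hartree.exists_difference_bound hΩ hΩb hT hpot hc M
    obtain ⟨C', hC'⟩ := Hartree.exists_kernelDist_softCoulomb_le (hΩb.sub hΩb)
    refine ⟨C * C', fun φ₀ hM hφ₀ ψ hψ ε hε χ hχ => ?_⟩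
    refine (hC φ₀ hM hφ₀ ψ hψ _ (Hartree.contDiff_softCoulomb hε).contDiffOn χ hχ).trans ?_
    rw [ENNReal.coe_mul, mul_assoc]
    exact mul_le_mul' le_rfl (hC' ε hε)
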